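/- All posets are finite. Let $P$ be a bounded poset and let $I\subset P$ be a proper ideal, i.e. a down-closed subset with $\emptyset\ne I\ne P$. The Bier poset $\mathrm{Bier}(P,I)$ consists of all intervals $[x,y]=\{z\in P: x\le z\le y\}$ with $x\le y$, $x\in I$, $y\notin I$, ordered by reverse inclusion ($[x,y]\le[v,w]$ iff $x\le v$ and $w\le y$), together with an additional top element. For a bounded poset $Q$, let $\overline Q=Q\setminus\{\hat 0,\hat 1\}$ be its proper part. For a poset $R$, let $\Delta(R)$ be its order complex, the simplicial complex of all chains of $R$, and $\|\Delta(R)\|$ its geometric realization. Two compact polyhedra are PL homeomorphic if there is a homeomorphism between them such that it and its inverse are each affine on every simplex of some finite triangulation of their domain. A strongly regular PL CW-sphere of dimension $d\ge -1$ is a CW decomposition of the sphere $S^{d}$ (with $S^{-1}=\emptyset$) such that every characteristic map is a homeomorphism from a closed ball onto the closed cell (regularity), the intersection of any two closed cells is empty or a closed cell (strong regularity), and the realization of the order complex of the poset of closed cells ordered by inclusion (the barycentric subdivision) is PL homeomorphic to the boundary of a $(d+1)$-simplex. Its face lattice is the poset of closed cells ordered by inclusion, with a new bottom element (the empty face) and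 a new top element adjoined. Corollary. Let $L$ be a finite lattice and let $I\subset L$ be a proper ideal. Then $\|\Delta(\overline{\mathrm{Bier}(L,I)})\|$ and $\|\Delta(\overline L)\|$ are PL homeomorphic. Furthermore, if $L$ is (isomorphic to) the face lattice of a strongly regular PL CW-sphere, then so is $\mathrm{Bier}(L,I)$. -/

import Mathlib

/-! ## Bier posets -/

/-- The intervals `[lo, hi]` of a poset `P` with `lo ∈ I` and `hi ∉ I`. -/
@[ext]
structure BierInterval {P : Type*} [PartialOrder P] (I : Set P) where
  lo : P
  hi : P
  lo_mem : lo ∈ I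
  hi_notMem : hi ∉ I
  lo_le_hi : lo ≤ hi

/-- Intervals are ordered by reverse inclusion: `[x, y] ≤ [v, w]` iff `x ≤ v` and `w ≤ y`. -/
instance {P : Type*} [PartialOrder P] (I : Set P) : PartialOrder (BierInterval I) where
  le a b := a.lo ≤ b.lo ∧ b.hi ≤ a.hi
  le_refl _ := ⟨le_rfl, le_rfl⟩
  le_trans _ _ _ h₁ h₂ := ⟨h₁.1.trans h₂.1, h₂.2.trans h₁.2⟩
  le_antisymm _ _ h₁ h₂ := BierInterval.ext (le_antisymm h₁.1 h₂.1) (le_antisymm h₂.2 h₁.2)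

/-- The Bier poset `Bier(P, I)`: the intervals `[x, y]` with `x ∈ I`, `y ∉ I`, ordered by reverse
inclusion, together with an additional top element. -/
abbrev Bier (P : Type*) [PartialOrder P] (I : Set P) : Type _ := WithTop (BierInterval I)

/-- The proper part of a (bounded) poset: all elements except the minimum and the maximum. -/
def properPart (P : Type*) [PartialOrder P] : Set P := {x | ¬ IsBot x ∧ ¬ IsTop x}

/-! ## Simplicial complexes, their realizations, and piecewise linear homeomorphisms -/

/-- The order complex of a poset: its faces are the chains. (Mathlib's abstract simplicial
complexes do not list the empty face.) -/
def orderComplex (P : Type*) [PartialOrder P] : PreAbstractSimplicialComplex P where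
  faces := {s | s.Nonempty ∧ IsChain (· ≤ ·) (s : Set P)}
  isRelLowerSet_faces := fun {_} hs =>
    ⟨hs.1, fun _ hts ht => ⟨ht, hs.2.mono (Finset.coe_subset.mpr hts)⟩⟩

/-- The boundary complex of the `n`-simplex with vertex set `{0, …, n}`: its faces are the proper
subsets of the vertex set. -/
def simplexBoundary (n : ℕ) : PreAbstractSimplicialComplex (Fin (n + 1)) where
  faces := {s | s.Nonempty ∧ s ≠ Finset.univ}
  isRelLowerSet_faces := fun {_} hs =>
    ⟨hs.1, fun _ hts ht =>
      ⟨ht, fun h => hs.2 (Finset.univ_subset_iff.mp (h ▸ hts))⟩⟩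

/-- The standard geometric realization, in barycentric coordinates, of a simplicial complex with
finitely many vertices: the points with non-negative coordinates of sum `1` that are supported on
a face. It carries the topology induced from `ι → ℝ`. -/
def PreAbstractSimplicialComplex.realization {ι : Type*} (K : PreAbstractSimplicialComplex ι) :
    Set (ι → ℝ) :=
  {x | (∀ v, 0 ≤ x v) ∧ ∃ s ∈ K.faces, (∀ v, v ∉ s → x v = 0) ∧ ∑ v ∈ s, x v = 1}

section PL

variable {E F : Type*} [AddCommGroup E] [Module ℝ E] [AddCommGroup F] [Module ℝ F]

/-- A map `f : X → Y` between compact polyhedra is piecewise linear if `X` has a finite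
triangulation such that `f` is affine on each of its simplices. -/
def IsPL {X : Set E} {Y : Set F} (f : X → Y) : Prop :=
  ∃ T : Geometry.SimplicialComplex ℝ E, T.faces.Finite ∧ T.space = X ∧
    ∀ s ∈ T.faces, ∃ g : E →ᵃ[ℝ] F,
      ∀ x : X, (x : E) ∈ convexHull ℝ (s : Set E) → (f x : F) = g x

/-- Two compact polyhedra are PL homeomorphic if there is a homeomorphism between them that is
piecewise linear in both directions. -/
def PLHomeomorphic [TopologicalSpace E] [TopologicalSpace F] (X : Set E) (Y : Set F) : Prop :=
  ∃ e : X ≃ₜ Y, IsPL e ∧ IsPL e.symm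

end PL

/-! ## Strongly regular PL CW-spheres and their face lattices -/

section CW

open Topology

variable {X : Type*} [TopologicalSpace X] (C : Set X) [CWComplex C]

/-- The face poset of a CW complex: its closed cells, ordered by inclusion. -/
def closedCells : Set (Set X) :=
  {s | ∃ (n : ℕ) (i : RelCWComplex.cell C n), s = RelCWComplex.closedCell n i}

/-- A CW complex is regular if every characteristic map is injective on the whole closed ball
(and hence, in a Hausdorff space, a homeomorphism onto the closed cell). -/
def IsRegularCW : Prop :=
  ∀ (n : ℕ) (i : RelCWComplex.cell C n),
    Set.InjOn (RelCWComplex.map n i) (Metric.closedBall (0 : Fin n → ℝ) 1)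

/-- A CW complex is strongly regular if it is regular and the intersection of any two closed cells
is empty or a closed cell. -/
def IsStronglyRegularCW : Prop :=
  IsRegularCW C ∧ ∀ s ∈ closedCells C, ∀ t ∈ closedCells C, s ∩ t = ∅ ∨ s ∩ t ∈ closedCells C

/-- The face lattice of a CW complex: the face poset with a bottom element (the empty face) and an
additional top element adjoined. -/
abbrev CWFaceLattice : Type _ := WithTop (WithBot (closedCells C))

end CW

/-- `P` is (isomorphic to) the face lattice of a strongly regular PL CW-sphere: for some `n`, there
is a strongly regular CW decomposition of the sphere `S^(n-1)` whose barycentric subdivision (the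
order complex of its face poset) is PL homeomorphic to the boundary of the `n`-simplex and whose
face lattice is isomorphic to `P`. For `n = 0` this is the empty sphere. -/
def IsFaceLatticeOfStronglyRegularPLSphere (P : Type*) [PartialOrder P] : Prop :=
  ∃ (n : ℕ) (_ : Topology.CWComplex (Metric.sphere (0 : EuclideanSpace ℝ (Fin n)) 1)),
    IsStronglyRegularCW (Metric.sphere (0 : EuclideanSpace ℝ (Fin n)) 1) ∧
    PLHomeomorphic
      (orderComplex (closedCells (Metric.sphere (0 : EuclideanSpace ℝ (Fin n)) 1))).realization
      (simplexBoundary n).realization ∧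
    Nonempty (P ≃o CWFaceLattice (Metric.sphere (0 : EuclideanSpace ℝ (Fin n)) 1))

/-!
# Bier posets of lattices and piecewise linear spheres

*The subdivision.* The order complex of the proper part of `Bier(L, I)` is a linear subdivision of
the order complex of the proper part of `L`: an interval `[x, y]` is placed at the midpoint of the
edge `{x, y}`, or at the remaining end if `x = ⊥` or `y = ⊤` (`ProperBier.position`). To see that
the resulting linear map of realizations is a bijection (`ProperBier.bijOn_position`), let `l` be a
point supported on a chain of `L`. Its mass on `I` and its mass outside `I`, one of them padded at
`⊥` or `⊤` so that they agree, are matched with each other, starting from the cut that `I`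
makes in the chain; the matched pairs form a chain of intervals. Conversely, for a point `x` on a
chain of intervals, the mass of `x` on the intervals `b ≥ [a, c]`, counted with the weights of the
midpoints and ends, is the minimum of the masses of its image on the elements of `I` above `a` and
on the elements outside `I` below `c` (only one of the two matters if `a = ⊥` or `c = ⊤`, see
`ProperBier.sum_ge_eq`), so the image determines `x`.

*Piecewise linear maps.* A linear bijection of realizations is a PL homeomorphism, since the
simplices themselves form a triangulation. To compose it with a further PL homeomorphism, as in
`PLHomeomorphic.of_bijOn`, one needs a triangulation of the source each of whose simplices is
mapped into a simplex of a given triangulation of the target. A triangulation is therefore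
subdivided along finitely many hyperplanes, by stellar subdivisions of crossing edges
(`exists_refinement_signs`), the hyperplanes being the boundaries of pullbacks of half-spaces
that cut out the given simplices.

*Spheres.* It remains to show that a finite poset `Q` whose order complex is a PL `(n - 1)`-sphere
is the face poset of a regular CW decomposition of the sphere (`exists_CWComplex_of_plSphere`). The
homogeneous extension of the PL homeomorphism is a conewise linear bijection from the cone over the
order complex onto `ℝⁿ` (`exists_coneMap_euclideanSpace`). Its one-sided derivative at a generic
point of the cone over a face `σ` is additive in the directions of `σ`, and modulo these directions
it becomes a homogeneous continuous bijection from the cone over the link of `σ` onto `ℝⁿ⁻ᵏ`, with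
`k` the number of vertices of `σ` (`exists_bijOn_linkCone`). Taking for `σ` a longest chain with
least element `q`, its link is the order complex of the elements below `q`; the chains of elements `≤ q`
form the cone with apex `q` over this link, which is therefore a ball. These balls are the cells.

The proper part of `Bier(L, I)` is such a poset by the first two steps, and strong regularity
follows from the meets `[x, y] ⊓ [v, w] = [x ⊓ v, y ⊔ w]`.
-/

/-! ### Realizations and their linear images -/

section Realization

variable {V E : Type*} [AddCommGroup E] [Module ℝ E]

/-- The set of vertices at which a point has a nonzero coordinate. -/
noncomputable def coordSupport [Finite V] (x : V → ℝ) : Finset V :=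
  (Set.toFinite (Function.support x)).toFinset

@[simp]
theorem mem_coordSupport [Finite V] {x : V → ℝ} {v : V} : v ∈ coordSupport x ↔ x v ≠ 0 := by
  simp [coordSupport]

/-- The points of the standard simplex of `V` which are supported on `s`. -/
def faceSimplex (s : Finset V) : Set (V → ℝ) :=
  {x | (∀ v, 0 ≤ x v) ∧ (∀ v, v ∉ s → x v = 0) ∧ ∑ v ∈ s, x v = 1}

theorem mem_realization_iff_exists_faceSimplex {K : PreAbstractSimplicialComplex V} {x : V → ℝ} :
    x ∈ K.realization ↔ ∃ s ∈ K.faces, x ∈ faceSimplex s := by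
  constructor
  · rintro ⟨h0, s, hs, h1, h2⟩
    exact ⟨s, hs, h0, h1, h2⟩
  · rintro ⟨s, hs, h0, h1, h2⟩
    exact ⟨h0, s, hs, h1, h2⟩

theorem faceSimplex_subset_realization {K : PreAbstractSimplicialComplex V} {s : Finset V}
    (hs : s ∈ K.faces) : faceSimplex s ⊆ K.realization := fun _ hx =>
  mem_realization_iff_exists_faceSimplex.2 ⟨s, hs, hx⟩

theorem mem_faceSimplex_iff [Fintype V] {s : Finset V} {x : V → ℝ} :
    x ∈ faceSimplex s ↔ (∀ v, 0 ≤ x v) ∧ (∀ v, v ∉ s → x v = 0) ∧ ∑ v, x v = 1 := by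
  refine and_congr_right fun _ => and_congr_right fun h => ?_
  rw [Finset.sum_subset (Finset.subset_univ s) fun v _ hv => h v hv]

theorem mem_realization_iff [Fintype V] {K : PreAbstractSimplicialComplex V} {x : V → ℝ} :
    x ∈ K.realization ↔ (∀ v, 0 ≤ x v) ∧ coordSupport x ∈ K.faces ∧ ∑ v, x v = 1 := by
  rw [mem_realization_iff_exists_faceSimplex]
  simp only [mem_faceSimplex_iff]
  constructor
  · rintro ⟨s, hs, h0, h1, h2⟩
    refine ⟨h0, (K.isRelLowerSet_faces hs).2 (fun v hv => ?_) ?_, h2⟩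
    · by_contra hvs
      exact (mem_coordSupport.1 hv) (h1 v hvs)
    · by_contra hne
      rw [Finset.not_nonempty_iff_eq_empty] at hne
      have : ∀ v, x v = 0 := fun v => by
        by_contra hv
        have := mem_coordSupport.2 hv
        simp [hne] at this
      simp [this] at h2
  · rintro ⟨h0, h1, h2⟩
    exact ⟨_, h1, h0, fun v hv => by simpa using hv, h2⟩

theorem faceSimplex_inter [Fintype V] [DecidableEq V] (s t : Finset V) :
    faceSimplex s ∩ faceSimplex t = faceSimplex (s ∩ t) := by
  ext x
  simp only [Set.mem_inter_iff, mem_faceSimplex_iff, Finset.mem_inter]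
  constructor
  · rintro ⟨⟨h0, h1, h2⟩, -, h3, -⟩
    exact ⟨h0, fun v hv => by by_cases h : v ∈ s <;> grind, h2⟩
  · rintro ⟨h0, h1, h2⟩
    exact ⟨⟨h0, fun v hv => h1 v (by tauto), h2⟩, h0, fun v hv => h1 v (by tauto), h2⟩

theorem linearCombination_eq_sum [Fintype V] (φ : V → E) {s : Finset V} {x : V → ℝ}
    (hx : ∀ v, v ∉ s → x v = 0) : Fintype.linearCombination ℝ φ x = ∑ v ∈ s, x v • φ v := by
  rw [Fintype.linearCombination_apply]
  exact (Finset.sum_subset (Finset.subset_univ s) fun v _ hv => by simp [hx v hv]).symm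

theorem image_faceSimplex [Fintype V] (φ : V → E) (s : Finset V) :
    Fintype.linearCombination ℝ φ '' faceSimplex s = convexHull ℝ (φ '' s) := by
  classical
  apply Set.Subset.antisymm
  · rintro _ ⟨x, ⟨h0, h1, h2⟩, rfl⟩
    rw [linearCombination_eq_sum φ h1]
    exact (convex_convexHull ℝ _).sum_mem (fun v _ => h0 v) h2
      fun v hv => subset_convexHull ℝ _ ⟨v, hv, rfl⟩
  · apply convexHull_min
    · rintro _ ⟨v, hv, rfl⟩
      refine ⟨Pi.single v 1, mem_faceSimplex_iff.2 ⟨fun w => ?_, fun w hw => ?_, by simp⟩, ?_⟩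
      · by_cases h : w = v <;> simp [h]
      · have : w ≠ v := fun h => hw (h ▸ hv)
        simp [this]
      · simp [Fintype.linearCombination_apply_single]
    · apply Convex.linear_image
      rintro x ⟨h0, h1, h2⟩ y ⟨h0', h1', h2'⟩ a b ha hb hab
      refine ⟨fun v => ?_, fun v hv => ?_, ?_⟩
      · have := h0 v; have := h0' v
        simp only [Pi.add_apply, Pi.smul_apply, smul_eq_mul]; positivity
      · simp [h1 v hv, h1' v hv]
      · simp [Finset.sum_add_distrib, ← Finset.mul_sum, h2, h2', hab]

theorem faceSimplex_eq_convexHull [Fintype V] [DecidableEq V] (s : Finset V) :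
    faceSimplex s = convexHull ℝ ((fun v => Pi.single v (1 : ℝ)) '' (s : Set V)) := by
  rw [← image_faceSimplex]
  convert (Set.image_id _).symm
  ext x
  simp [Fintype.linearCombination_apply, Finset.sum_apply, Pi.single_apply]

theorem realization_eq_biUnion (K : PreAbstractSimplicialComplex V) :
    K.realization = ⋃ s ∈ K.faces, faceSimplex s := by
  ext x
  simp [mem_realization_iff_exists_faceSimplex]

theorem isCompact_faceSimplex [Fintype V] (s : Finset V) : IsCompact (faceSimplex s) := by
  classical
  rw [faceSimplex_eq_convexHull]
  exact (s.finite_toSet.image _).isCompact_convexHull ℝ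

theorem isCompact_realization [Finite V] (K : PreAbstractSimplicialComplex V) :
    IsCompact K.realization := by
  have := Fintype.ofFinite V
  rw [realization_eq_biUnion]
  exact (Set.toFinite _).isCompact_biUnion fun s _ => isCompact_faceSimplex s

/-- Two faces of a complex, mapped to a vector space by a linear map which is injective on the
realization, meet in the image of their common face. -/
theorem convexHull_image_inter [Fintype V] [DecidableEq V] {K : PreAbstractSimplicialComplex V}
    {φ : V → E} (h : Set.InjOn (Fintype.linearCombination ℝ φ) K.realization) {s t : Finset V}
    (hs : s ∈ K.faces) (ht : t ∈ K.faces) :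
    convexHull ℝ (φ '' s) ∩ convexHull ℝ (φ '' t) = convexHull ℝ (φ '' (s ∩ t : Finset V)) := by
  rw [← image_faceSimplex, ← image_faceSimplex, ← image_faceSimplex, ← faceSimplex_inter,
    h.image_inter (faceSimplex_subset_realization hs) (faceSimplex_subset_realization ht)]

theorem injOn_vertices [Fintype V] {K : PreAbstractSimplicialComplex V}
    {φ : V → E} (h : Set.InjOn (Fintype.linearCombination ℝ φ) K.realization) {s : Finset V}
    (hs : s ∈ K.faces) : Set.InjOn φ s := by
  classical
  have key : ∀ v ∈ s, Pi.single v (1 : ℝ) ∈ K.realization := fun v hv =>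
    faceSimplex_subset_realization hs (by
      rw [faceSimplex_eq_convexHull]; exact subset_convexHull ℝ _ ⟨v, hv, rfl⟩)
  intro v hv w hw hvw
  have := h (key v hv) (key w hw) (by simp [Fintype.linearCombination_apply_single, hvw])
  by_contra hne
  have h1 := congrFun this v
  simp [hne] at h1

/-- The vertices of a face are mapped to affinely independent points by a linear map which is
injective on the realization: an affine dependence would, by Radon's theorem, give a common point
of the images of two disjoint faces. -/
theorem affineIndependent_of_injOn [Fintype V] {K : PreAbstractSimplicialComplex V}
    {φ : V → E} (h : Set.InjOn (Fintype.linearCombination ℝ φ) K.realization) {s : Finset V}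
    (hs : s ∈ K.faces) : AffineIndependent ℝ (fun v : s => φ v) := by
  classical
  by_contra hcon
  obtain ⟨I, p, hp1, hp2⟩ := Convex.radon_partition hcon
  have key : ∀ J : Set s, p ∈ convexHull ℝ ((fun v : s => φ v) '' J) →
      ∃ t ⊆ s, t ∈ K.faces ∧ p ∈ convexHull ℝ (φ '' (t : Set V)) ∧ ∀ v : s, ↑v ∈ t → v ∈ J := by
    intro J hJ
    have hne : ((fun v : s => φ v) '' J).Nonempty := convexHull_nonempty_iff.1 ⟨p, hJ⟩
    obtain ⟨_, v, hv, -⟩ := hne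
    refine ⟨(J.toFinite.toFinset).map (Function.Embedding.subtype _), ?_, ?_, ?_, ?_⟩
    · intro v; simp only [Finset.mem_map]; rintro ⟨w, -, rfl⟩; exact w.2
    · refine (K.isRelLowerSet_faces hs).2 ?_ ⟨v, by simpa using hv⟩
      intro v; simp only [Finset.mem_map]; rintro ⟨w, -, rfl⟩; exact w.2
    · convert hJ using 2
      ext; simp
    · intro v; simp
  obtain ⟨t, -, ht, hpt, htI⟩ := key I hp1
  obtain ⟨u, hus, hu, hpu, huI⟩ := key Iᶜ hp2
  have hp : p ∈ convexHull ℝ (φ '' ((t ∩ u : Finset V) : Set V)) := by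
    rw [← convexHull_image_inter h ht hu]; exact ⟨hpt, hpu⟩
  obtain ⟨_, v, hv, -⟩ := convexHull_nonempty_iff.1 ⟨p, hp⟩
  simp only [Finset.coe_inter, Set.mem_inter_iff, Finset.mem_coe] at hv
  exact huI ⟨v, hus hv.2⟩ hv.2 (htI ⟨v, hus hv.2⟩ hv.1)

/-- A linear map which is injective on the realization of a finite complex maps it onto a
geometric simplicial complex. -/
theorem exists_simplicialComplex_of_injOn [Fintype V] (K : PreAbstractSimplicialComplex V)
    (φ : V → E) (h : Set.InjOn (Fintype.linearCombination ℝ φ) K.realization) :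
    ∃ T : Geometry.SimplicialComplex ℝ E,
      (∀ t, t ∈ T.faces ↔ ∃ s ∈ K.faces, (t : Set E) = φ '' s) ∧ T.faces.Finite ∧
      T.space = Fintype.linearCombination ℝ φ '' K.realization := by
  classical
  let faces : Set (Finset E) := {t | ∃ s ∈ K.faces, (t : Set E) = φ '' s}
  have hfin : faces.Finite := by
    refine ((Set.toFinite K.faces).image (Finset.image φ)).subset ?_
    rintro t ⟨s, hs, ht⟩
    exact ⟨s, hs, by apply Finset.coe_injective; simp [ht]⟩
  let T : Geometry.SimplicialComplex ℝ E :=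
    { faces := faces
      isRelLowerSet_faces := by
        rintro t ⟨s, hs, ht⟩
        refine ⟨?_, fun u hut hu => ?_⟩
        · rw [← Finset.coe_nonempty, ht]
          exact (Finset.coe_nonempty.2 (K.isRelLowerSet_faces hs).1).image _
        · have hu' : (u : Set E) = φ '' ({v ∈ s | φ v ∈ u} : Finset V) := by
            ext e
            constructor
            · intro he
              have : e ∈ (t : Set E) := hut he
              rw [ht] at this
              obtain ⟨v, hv, rfl⟩ := this
              exact ⟨v, by simpa using ⟨hv, he⟩, rfl⟩
            · rintro ⟨v, hv, rfl⟩
              simp only [Finset.coe_filter, Set.mem_ofPred_eq] at hv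
              exact hv.2
          refine ⟨_, (K.isRelLowerSet_faces hs).2 (Finset.filter_subset _ s) ?_, hu'⟩
          rw [← Finset.coe_nonempty, hu'] at hu
          exact Finset.coe_nonempty.1 hu.of_image
      indep := by
        rintro t ⟨s, hs, ht⟩
        have h1 := (affineIndependent_of_injOn h hs).range
        have h2 : Set.range (fun v : s => φ v) = (t : Set E) := by
          rw [ht]; ext; simp
        rw [h2] at h1
        exact h1
      inter_subset_convexHull := by
        rintro t u ⟨s, hs, ht⟩ ⟨r, hr, hu⟩
        rw [ht, hu, convexHull_image_inter h hs hr]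
        apply convexHull_mono
        rw [Finset.coe_inter]
        exact Set.image_inter_subset _ _ _ }
  refine ⟨T, fun t => Iff.rfl, hfin, ?_⟩
  ext x
  rw [Geometry.SimplicialComplex.mem_space_iff, realization_eq_biUnion, Set.image_iUnion₂]
  simp only [Set.mem_iUnion, image_faceSimplex]
  constructor
  · rintro ⟨t, ⟨s, hs, ht⟩, hx⟩
    exact ⟨s, hs, ht ▸ hx⟩
  · rintro ⟨s, hs, hx⟩
    exact ⟨s.image φ, ⟨s, hs, by simp⟩, by simpa using hx⟩

/-- The abstract simplicial complex underlying a geometric one, on the type of its vertices. -/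
def Geometry.SimplicialComplex.abstractComplex (T : Geometry.SimplicialComplex ℝ E) :
    PreAbstractSimplicialComplex T.vertices where
  faces := {s | s.map (Function.Embedding.subtype _) ∈ T.faces}
  isRelLowerSet_faces := fun {s} hs => ⟨by simpa using T.nonempty_of_mem_faces hs,
    fun _ htu ht => T.down_closed hs (Finset.map_subset_map.2 htu) (by simpa using ht)⟩

theorem Geometry.SimplicialComplex.exists_abstractComplex_face (T : Geometry.SimplicialComplex ℝ E)
    {t : Finset E} (ht : t ∈ T.faces) :
    ∃ s ∈ T.abstractComplex.faces, s.map (Function.Embedding.subtype _) = t := by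
  classical
  have hv : ∀ x ∈ t, x ∈ T.vertices := fun x hx =>
    T.down_closed ht (Finset.singleton_subset_iff.2 hx) (Finset.singleton_nonempty x)
  have : (t.subtype (· ∈ T.vertices)).map (Function.Embedding.subtype _) = t :=
    Finset.subtype_map_of_mem hv
  exact ⟨t.subtype (· ∈ T.vertices), by simpa [abstractComplex, this] using ht, this⟩

theorem Geometry.SimplicialComplex.finite_vertices {T : Geometry.SimplicialComplex ℝ E}
    (hT : T.faces.Finite) : Finite T.vertices := by
  have : T.vertices.Finite := by
    rw [vertices_eq]
    exact hT.biUnion fun s _ => s.finite_toSet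
  exact this

/-- The realization of the underlying abstract complex is mapped injectively to the ambient
space. -/
theorem Geometry.SimplicialComplex.injOn_abstractComplex (T : Geometry.SimplicialComplex ℝ E)
    [Fintype T.vertices] :
    Set.InjOn (Fintype.linearCombination ℝ ((↑) : T.vertices → E))
      T.abstractComplex.realization := by
  classical
  -- Barycentric coordinates with respect to one face are unique by affine independence.
  have huniq : ∀ s ∈ T.abstractComplex.faces, Set.InjOn
      (Fintype.linearCombination ℝ ((↑) : T.vertices → E)) (faceSimplex s) := by
    intro s hs x hx y hy hxy
    rw [mem_faceSimplex_iff] at hx hy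
    have hind := T.indep hs
    rw [linearCombination_eq_sum _ hx.2.1, linearCombination_eq_sum _ hy.2.1] at hxy
    have hsum : ∀ z : T.vertices → ℝ, (∀ v, v ∉ s → z v = 0) → ∑ v, z v = 1 →
        ∑ v ∈ s, z v = 1 := fun z hz h => by
      rw [← h]; exact Finset.sum_subset (Finset.subset_univ s) fun v _ hv => hz v hv
    have hind' : AffineIndependent ℝ (fun v : s => ((v : T.vertices) : E)) := by
      refine hind.comp_embedding ⟨fun v : s => (⟨v, by simp⟩ :
        (s.map (Function.Embedding.subtype _) : Finset E)), fun a b hab => ?_⟩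
      have h : ((a : T.vertices) : E) = b := by simpa only [Subtype.mk.injEq] using hab
      exact Subtype.ext (Subtype.ext h)
    rw [affineIndependent_iff] at hind'
    ext v
    by_cases hv : v ∈ s
    · have := hind' Finset.univ (fun v => x v - y v) ?_ ?_ ⟨v, hv⟩ (Finset.mem_univ _)
      · linarith
      · rw [Finset.sum_coe_sort s (fun v => x v - y v), Finset.sum_sub_distrib,
          hsum x hx.2.1 hx.2.2, hsum y hy.2.1 hy.2.2, sub_self]
      · rw [Finset.sum_coe_sort s (fun v => (x v - y v) • (v : E))]
        simp only [sub_smul, Finset.sum_sub_distrib]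
        rw [hxy, sub_self]
    · rw [hx.2.1 v hv, hy.2.1 v hv]
  intro x hx y hy hxy
  rw [mem_realization_iff_exists_faceSimplex] at hx hy
  obtain ⟨s, hs, hx⟩ := hx
  obtain ⟨t, ht, hy⟩ := hy
  have hsub : (fun v : T.vertices => (v : E)) '' (s : Set T.vertices) =
      (s.map (Function.Embedding.subtype _) : Finset E) := by ext; simp
  have htub : (fun v : T.vertices => (v : E)) '' (t : Set T.vertices) =
      (t.map (Function.Embedding.subtype _) : Finset E) := by ext; simp
  have hp1 := Set.mem_image_of_mem (Fintype.linearCombination ℝ ((↑) : T.vertices → E)) hx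
  have hp2 := Set.mem_image_of_mem (Fintype.linearCombination ℝ ((↑) : T.vertices → E)) hy
  rw [← hxy] at hp2
  rw [image_faceSimplex, hsub] at hp1
  rw [image_faceSimplex, htub] at hp2
  have hp := T.inter_subset_convexHull hs ht ⟨hp1, hp2⟩
  have hst : ((s.map (Function.Embedding.subtype _) : Finset E) : Set E) ∩
      (t.map (Function.Embedding.subtype _) : Finset E) =
      (fun v : T.vertices => (v : E)) '' ((s ∩ t : Finset T.vertices) : Set T.vertices) := by
    rw [← hsub, ← htub, Finset.coe_inter, Set.image_inter Subtype.val_injective]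
  rw [hst, ← image_faceSimplex, ← faceSimplex_inter] at hp
  obtain ⟨z, ⟨hzs, hzt⟩, hz⟩ := hp
  rw [← huniq s hs hzs hx hz]
  exact huniq t ht hzt hy (hz.trans hxy)

theorem Geometry.SimplicialComplex.image_abstractComplex (T : Geometry.SimplicialComplex ℝ E)
    [Fintype T.vertices] :
    Fintype.linearCombination ℝ ((↑) : T.vertices → E) '' T.abstractComplex.realization =
      T.space := by
  classical
  ext x
  rw [mem_space_iff, realization_eq_biUnion, Set.image_iUnion₂]
  simp only [Set.mem_iUnion, image_faceSimplex]
  constructor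
  · rintro ⟨s, hs, hx⟩
    refine ⟨_, hs, ?_⟩
    rwa [Finset.coe_map]
  · rintro ⟨t, ht, hx⟩
    obtain ⟨s, hs, rfl⟩ := T.exists_abstractComplex_face ht
    refine ⟨s, hs, ?_⟩
    rwa [Finset.coe_map] at hx

end Realization

/-! ### Affine functions and half-spaces attached to a simplex -/

section Simplex

variable {E F : Type*} [AddCommGroup E] [Module ℝ E] [AddCommGroup F] [Module ℝ F]

theorem exists_affineBasis_extending {s : Finset E}
    (hs : AffineIndependent ℝ ((↑) : s → E)) :
    ∃ (t : Set E) (b : AffineBasis t ℝ E), (s : Set E) ⊆ t ∧ ∀ i, b i = i := by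
  obtain ⟨t, hst, hi, ht⟩ := exists_subset_affineIndependent_affineSpan_eq_top
    (show AffineIndependent ℝ ((↑) : ((s : Set E) : Type _) → E) from hs)
  exact ⟨t, ⟨_, hi, by simpa using ht⟩, hst, fun _ => rfl⟩

/-- An affine map can be prescribed on affinely independent points. -/
theorem AffineIndependent.exists_affineMap {s : Finset E}
    (hs : AffineIndependent ℝ ((↑) : s → E)) (q : E → F) :
    ∃ g : E →ᵃ[ℝ] F, ∀ v ∈ s, g v = q v := by
  classical
  obtain ⟨t, b, hst, hb⟩ := exists_affineBasis_extending hs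
  let c : s → E →ᵃ[ℝ] ℝ := fun v => b.coord ⟨v, hst v.2⟩
  let g : E →ᵃ[ℝ] F :=
    (Fintype.linearCombination ℝ fun w : s => q w).toAffineMap.comp (AffineMap.pi c)
  refine ⟨g, fun v hv => ?_⟩
  have hc : ∀ w : s, c w v = if w = ⟨v, hv⟩ then 1 else 0 := by
    intro w
    have := b.coord_apply ⟨w, hst w.2⟩ ⟨v, hst hv⟩
    rw [hb] at this
    simp only [c, this, Subtype.ext_iff]
  have hg : g v = ∑ w : s, c w v • q w := by
    simp [g, Fintype.linearCombination_apply]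
  rw [hg]
  simp [hc]

/-- A simplex in a finite-dimensional space is an intersection of finitely many half-spaces. -/
theorem AffineIndependent.exists_halfSpaces [FiniteDimensional ℝ E] {s : Finset E}
    (hs : AffineIndependent ℝ ((↑) : s → E)) :
    ∃ Λ : Set (E →ᵃ[ℝ] ℝ), Λ.Finite ∧ ∀ y, y ∈ convexHull ℝ (s : Set E) ↔ ∀ l ∈ Λ, 0 ≤ l y := by
  classical
  obtain ⟨t, b, hst, hb⟩ := exists_affineBasis_extending hs
  have : Finite t := finite_of_fin_dim_affineIndependent ℝ b.ind
  have := Fintype.ofFinite t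
  refine ⟨Set.range b.coord ∪ (fun i => -b.coord i) '' {i : t | (i : E) ∉ s},
    (Set.finite_range _).union ((Set.toFinite _).image _), fun y => ⟨fun hy l hl => ?_, fun hy => ?_⟩⟩
  · have hconv : Convex ℝ {y | 0 ≤ l y} := (convex_Ici (𝕜 := ℝ) (0 : ℝ)).affine_preimage l
    refine convexHull_min (fun v hv => ?_) hconv hy
    have hv' := fun i => b.coord_apply i ⟨v, hst hv⟩
    simp only [hb] at hv'
    rcases hl with ⟨i, rfl⟩ | ⟨i, hi, rfl⟩
    · simp only [Set.mem_ofPred_eq, hv']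
      split_ifs <;> norm_num
    · have hne : i ≠ ⟨v, hst hv⟩ := fun h => hi (by rw [h]; exact hv)
      simp [hv', hne]
  · have h0 : ∀ i, 0 ≤ b.coord i y := fun i => hy _ (Or.inl ⟨i, rfl⟩)
    have h1 : ∀ i : t, (i : E) ∉ s → b.coord i y = 0 := fun i hi =>
      le_antisymm (by simpa using hy _ (Or.inr ⟨i, hi, rfl⟩)) (h0 i)
    have hsum := b.sum_coord_apply_eq_one y
    have hlin := b.linear_combination_coord_eq_self y
    rw [← Finset.sum_filter_add_sum_filter_not Finset.univ (fun i : t => (i : E) ∈ s)] at hsum hlin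
    rw [Finset.sum_eq_zero (s := Finset.univ.filter fun i : t => (i : E) ∉ s)
      fun i hi => h1 i (by simpa using hi), add_zero] at hsum
    rw [Finset.sum_eq_zero (s := Finset.univ.filter fun i : t => (i : E) ∉ s)
      fun i hi => by rw [h1 i (by simpa using hi), zero_smul], add_zero] at hlin
    rw [← hlin]
    refine (convex_convexHull ℝ _).sum_mem (fun i _ => h0 i) hsum fun i hi => ?_
    rw [hb]
    exact subset_convexHull ℝ _ (by simpa using hi)

theorem AffineMap.map_sum_smul {ι : Type*} (g : E →ᵃ[ℝ] F) (s : Finset ι) (w : ι → ℝ) (p : ι → E)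
    (hw : ∑ i ∈ s, w i = 1) : g (∑ i ∈ s, w i • p i) = ∑ i ∈ s, w i • g (p i) := by
  have h : ∀ y, g y = g.linear y + g 0 := fun y => congrFun g.decomp y
  rw [h, map_sum]
  simp only [map_smul, h (p _), smul_add, Finset.sum_add_distrib]
  rw [← Finset.sum_smul, hw, one_smul]

end Simplex

/-! ### Inverses of piecewise linear bijections -/

section Inverse

variable {E F : Type*} [AddCommGroup E] [Module ℝ E] [AddCommGroup F] [Module ℝ F]

/-- The images of the simplices of a triangulation on which a bijection is affine form a
triangulation on which its inverse is affine. -/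
theorem IsPL.symm {X : Set E} {Y : Set F} {e : X ≃ Y} (he : IsPL e) : IsPL e.symm := by
  classical
  obtain ⟨T, hT, rfl, hg⟩ := he
  have := Geometry.SimplicialComplex.finite_vertices hT
  have := Fintype.ofFinite T.vertices
  let ψ := Fintype.linearCombination ℝ ((↑) : T.vertices → E)
  let φ : T.vertices → F := fun v => e ⟨v, T.vertices_subset_space v.2⟩
  have hψ : ∀ x ∈ T.abstractComplex.realization, ψ x ∈ T.space := fun x hx => by
    rw [← T.image_abstractComplex]; exact ⟨x, hx, rfl⟩
  -- On each simplex `e` is affine, hence interpolates its own values at the vertices.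
  have key : ∀ (x) (hx : x ∈ T.abstractComplex.realization),
      Fintype.linearCombination ℝ φ x = e ⟨ψ x, hψ x hx⟩ := by
    intro x hx
    obtain ⟨s, hs, hxs⟩ := mem_realization_iff_exists_faceSimplex.1 hx
    obtain ⟨g, hg⟩ := hg _ hs
    rw [Finset.coe_map] at hg
    have hmem : ψ x ∈ convexHull ℝ ((↑) '' (s : Set T.vertices)) := by
      rw [← image_faceSimplex]; exact ⟨x, hxs, rfl⟩
    have h2 : ψ x = ∑ v ∈ s, x v • (v : E) := linearCombination_eq_sum _ hxs.2.1
    rw [hg ⟨ψ x, hψ x hx⟩ hmem, linearCombination_eq_sum φ hxs.2.1]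
    simp only [h2]
    rw [g.map_sum_smul _ _ _ hxs.2.2]
    refine Finset.sum_congr rfl fun v hv => ?_
    rw [← hg ⟨v, T.vertices_subset_space v.2⟩ (subset_convexHull ℝ _ ⟨v, hv, rfl⟩)]
  have hinj : Set.InjOn (Fintype.linearCombination ℝ φ) T.abstractComplex.realization := by
    intro x hx y hy hxy
    rw [key x hx, key y hy] at hxy
    have := e.injective (Subtype.ext hxy)
    exact T.injOn_abstractComplex hx hy (Subtype.ext_iff.1 this)
  obtain ⟨S, hS, hSfin, hSspace⟩ := exists_simplicialComplex_of_injOn _ φ hinj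
  refine ⟨S, hSfin, ?_, ?_⟩
  · rw [hSspace]
    ext y
    constructor
    · rintro ⟨x, hx, rfl⟩
      rw [key x hx]
      exact Subtype.prop _
    · intro hy
      obtain ⟨x, hx, hxy⟩ : (e.symm ⟨y, hy⟩ : E) ∈ ψ '' T.abstractComplex.realization := by
        rw [T.image_abstractComplex]; exact Subtype.prop _
      refine ⟨x, hx, ?_⟩
      rw [key x hx]
      have : (⟨ψ x, hψ x hx⟩ : T.space) = e.symm ⟨y, hy⟩ := Subtype.ext hxy
      rw [this, e.apply_symm_apply]
  · intro t ht
    obtain ⟨s, hs, hts⟩ := (hS t).1 ht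
    have hφ := injOn_vertices hinj hs
    -- The inverse is affine on each image simplex: it sends the vertices back.
    let q : F → E := fun y => if hy : ∃ v ∈ s, φ v = y then (hy.choose : E) else 0
    have hq : ∀ v ∈ s, q (φ v) = v := by
      intro v hv
      have hy : ∃ w ∈ s, φ w = φ v := ⟨v, hv, rfl⟩
      simp only [q, dif_pos hy]
      rw [hφ hy.choose_spec.1 hv hy.choose_spec.2]
    obtain ⟨g, hgq⟩ := (S.indep ht).exists_affineMap q
    refine ⟨g, fun y hy => ?_⟩
    rw [hts, ← image_faceSimplex] at hy
    obtain ⟨x, hxs, hxy⟩ := hy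
    have hx := faceSimplex_subset_realization hs hxs
    have hy' : y = e ⟨ψ x, hψ x hx⟩ := Subtype.ext (by rw [← hxy, key x hx])
    have h2 : ψ x = ∑ v ∈ s, x v • (v : E) := linearCombination_eq_sum _ hxs.2.1
    rw [← hxy, linearCombination_eq_sum φ hxs.2.1, g.map_sum_smul _ _ _ hxs.2.2, hy',
      e.symm_apply_apply]
    show ψ x = _
    rw [h2]
    refine Finset.sum_congr rfl fun v hv => ?_
    have : φ v ∈ t := by
      rw [← Finset.mem_coe, hts]; exact ⟨v, hv, rfl⟩
    rw [hgq _ this, hq v hv]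

end Inverse

/-! ### Subdividing an edge -/

section EdgeSubdivision

variable {V : Type*}

/-- The stellar subdivision of a complex at a point in the interior of the edge `{a, b}`. The new
vertex is `none`. -/
def edgeSubdivision (K : PreAbstractSimplicialComplex V) (a b : V) :
    PreAbstractSimplicialComplex (Option V) where
  faces := {s | s.Nonempty ∧ ¬ (some a ∈ s ∧ some b ∈ s) ∧
    ∃ u ∈ K.faces, (∀ v, some v ∈ s → v ∈ u) ∧ (none ∈ s → a ∈ u ∧ b ∈ u)}
  isRelLowerSet_faces := by
    rintro s ⟨h1, h2, u, hu, h3, h4⟩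
    exact ⟨h1, fun t hts ht => ⟨ht, fun h => h2 ⟨hts h.1, hts h.2⟩, u, hu,
      fun v hv => h3 v (hts hv), fun h => h4 (hts h)⟩⟩

open Classical in
/-- The position of the vertices of the subdivided complex in the original one. -/
noncomputable def edgeSubdivisionVertex (a b : V) (r : ℝ) : Option V → V → ℝ
  | none => (1 - r) • Pi.single a 1 + r • Pi.single b 1
  | some v => Pi.single v 1

theorem linearCombination_edgeSubdivisionVertex [Fintype V] [DecidableEq V] (a b : V) (r : ℝ)
    (x : Option V → ℝ) (v : V) :
    Fintype.linearCombination ℝ (edgeSubdivisionVertex a b r) x v =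
      x (some v) + x none * ((1 - r) * (if v = a then 1 else 0) + r * (if v = b then 1 else 0)) := by
  rw [Fintype.linearCombination_apply, Fintype.sum_option]
  simp only [edgeSubdivisionVertex, Pi.add_apply, Pi.smul_apply, Finset.sum_apply, smul_eq_mul,
    Pi.single_apply]
  rw [add_comm]
  congr 1
  · simp
  · congr

/-- Subdividing an edge does not change the realization. The coordinate of a point at the new vertex
is the largest multiple of that vertex which can be split off. -/
theorem bijOn_edgeSubdivision [Fintype V] (K : PreAbstractSimplicialComplex V) {a b : V}
    (hab : a ≠ b) {r : ℝ} (h0 : 0 < r) (h1 : r < 1) :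
    Set.BijOn (Fintype.linearCombination ℝ (edgeSubdivisionVertex a b r))
      (edgeSubdivision K a b).realization K.realization := by
  classical
  have hF := linearCombination_edgeSubdivisionVertex (V := V) a b r
  have hFa : ∀ x, Fintype.linearCombination ℝ (edgeSubdivisionVertex a b r) x a =
      x (some a) + x none * (1 - r) := fun x => by rw [hF]; simp [hab]
  have hFb : ∀ x, Fintype.linearCombination ℝ (edgeSubdivisionVertex a b r) x b =
      x (some b) + x none * r := fun x => by rw [hF]; simp [hab.symm]
  have hFv : ∀ x v, v ≠ a → v ≠ b →
      Fintype.linearCombination ℝ (edgeSubdivisionVertex a b r) x v = x (some v) :=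
    fun x v ha hb => by rw [hF]; simp [ha, hb]
  have hsum : ∀ x, ∑ v, Fintype.linearCombination ℝ (edgeSubdivisionVertex a b r) x v =
      ∑ v, x v := fun x => by
    simp only [hF, Finset.sum_add_distrib, Fintype.sum_option, ← Finset.mul_sum]
    simp
    ring
  have hr' : 0 < 1 - r := by linarith
  refine ⟨fun x hx => ?_, fun x hx y hy hxy => ?_, fun y hy => ?_⟩
  · rw [mem_realization_iff] at hx
    obtain ⟨hx0, ⟨-, -, u, hu, hu1, hu2⟩, hx1⟩ := hx
    rw [mem_realization_iff_exists_faceSimplex]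
    refine ⟨u, hu, mem_faceSimplex_iff.2 ⟨fun v => ?_, fun v hv => ?_, by rw [hsum, hx1]⟩⟩
    · rw [hF]
      have := hx0 (some v); have := hx0 none
      positivity
    · have h1 : x (some v) = 0 := by
        by_contra h
        exact hv (hu1 v (by simpa using h))
      by_cases hn : x none = 0
      · rw [hF, h1, hn]; simp
      · obtain ⟨ha, hb⟩ := hu2 (by simpa using hn)
        rw [hFv x v (fun h => hv (h ▸ ha)) (fun h => hv (h ▸ hb)), h1]
  -- One of the coordinates at `a` and `b` vanishes, so the image determines the coordinate at
  -- the new vertex.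
  · have key : ∀ x ∈ (edgeSubdivision K a b).realization, x none =
        min (Fintype.linearCombination ℝ (edgeSubdivisionVertex a b r) x a / (1 - r))
          (Fintype.linearCombination ℝ (edgeSubdivisionVertex a b r) x b / r) := by
      intro x hx
      rw [mem_realization_iff] at hx
      obtain ⟨hx0, ⟨-, hx2, -⟩, -⟩ := hx
      simp only [mem_coordSupport] at hx2
      have e1 : (x (some a) + x none * (1 - r)) / (1 - r) = x (some a) / (1 - r) + x none := by
        field_simp
      have e2 : (x (some b) + x none * r) / r = x (some b) / r + x none := by field_simp
      rw [hFa, hFb, e1, e2]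
      have p1 : 0 ≤ x (some a) / (1 - r) := div_nonneg (hx0 _) hr'.le
      have p2 : 0 ≤ x (some b) / r := div_nonneg (hx0 _) h0.le
      by_cases h : x (some a) = 0
      · rw [h, zero_div, zero_add, min_eq_left (by linarith)]
      · have : x (some b) = 0 := by tauto
        rw [this, zero_div, zero_add, min_eq_right (by linarith)]
    have hn : x none = y none := by rw [key x hx, key y hy, hxy]
    ext o
    cases o with
    | none => exact hn
    | some v =>
      have := congrFun hxy v
      rw [hF, hF, hn] at this
      linarith
  · rw [mem_realization_iff] at hy
    obtain ⟨hy0, hy1, hy2⟩ := hy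
    let m := min (y a / (1 - r)) (y b / r)
    have hm0 : 0 ≤ m := le_min (div_nonneg (hy0 a) hr'.le) (div_nonneg (hy0 b) h0.le)
    have hma : m * (1 - r) ≤ y a := (le_div_iff₀ hr').1 (min_le_left _ _)
    have hmb : m * r ≤ y b := (le_div_iff₀ h0).1 (min_le_right _ _)
    let x : Option V → ℝ := fun o => o.elim m fun v =>
      y v - m * ((1 - r) * (if v = a then 1 else 0) + r * (if v = b then 1 else 0))
    have hxn : x none = m := rfl
    have hxs : ∀ v, x (some v) =
      y v - m * ((1 - r) * (if v = a then 1 else 0) + r * (if v = b then 1 else 0)) := fun _ => rfl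
    have hFx : Fintype.linearCombination ℝ (edgeSubdivisionVertex a b r) x = y := by
      ext v
      rw [hF, hxn, hxs]; ring
    have hxa : x (some a) = y a - m * (1 - r) := by rw [hxs]; simp [hab]
    have hxb : x (some b) = y b - m * r := by rw [hxs]; simp [hab.symm]
    have hxv : ∀ v, v ≠ a → v ≠ b → x (some v) = y v := fun v ha hb => by rw [hxs]; simp [ha, hb]
    have hx0 : ∀ o, 0 ≤ x o := by
      intro o
      cases o with
      | none => exact hm0
      | some v =>
        by_cases ha : v = a
        · subst ha; rw [hxa]; linarith
        by_cases hb : v = b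
        · subst hb; rw [hxb]; linarith
        rw [hxv v ha hb]; exact hy0 v
    have hx1 : ∑ o, x o = 1 := by rw [← hsum, hFx, hy2]
    refine ⟨x, mem_realization_iff.2 ⟨hx0, ⟨?_, ?_, coordSupport y, hy1, ?_, ?_⟩, hx1⟩, hFx⟩
    · by_contra hne
      rw [Finset.not_nonempty_iff_eq_empty] at hne
      have : ∀ v, x v = 0 := fun v => by
        by_contra hv
        have := mem_coordSupport.2 hv
        simp [hne] at this
      simp [this] at hx1
    · simp only [mem_coordSupport, hxa, hxb]
      rintro ⟨ha, hb⟩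
      rcases min_choice (y a / (1 - r)) (y b / r) with h | h
      · apply ha; simp only [m, h]; field_simp; ring
      · apply hb; simp only [m, h]; field_simp; ring
    · intro v
      simp only [mem_coordSupport]
      intro hv h
      apply hv
      by_cases ha : v = a
      · subst ha; exact le_antisymm (by rw [hxa, h]; have := mul_nonneg hm0 hr'.le; linarith) (hx0 _)
      by_cases hb : v = b
      · subst hb; exact le_antisymm (by rw [hxb, h]; have := mul_nonneg hm0 h0.le; linarith) (hx0 _)
      rw [hxv v ha hb, h]
    · simp only [mem_coordSupport, hxn]
      intro hm
      have hm' : 0 < m := lt_of_le_of_ne hm0 (Ne.symm hm)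
      have := mul_pos hm' hr'
      have := mul_pos hm' h0
      exact ⟨by linarith, by linarith⟩

end EdgeSubdivision

/-! ### Subdividing a triangulation along hyperplanes -/

section Refinement

variable {E : Type*} [AddCommGroup E] [Module ℝ E]

/-- The stellar subdivision of a finite triangulation at a point `p` in the interior of an edge
`{a, b}`. The simplices without the vertex `p` are simplices of the original triangulation, so
all new edges contain `p`, and the edge `{a, b}` has disappeared. -/
theorem exists_edge_subdivision {T : Geometry.SimplicialComplex ℝ E} (hT : T.faces.Finite)
    {e : Finset E} (he : e ∈ T.faces) {a b p : E} (ha : a ∈ e) (hb : b ∈ e) (hab : a ≠ b)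
    {r : ℝ} (h0 : 0 < r) (h1 : r < 1) (hp : p = (1 - r) • a + r • b) :
    ∃ S : Geometry.SimplicialComplex ℝ E, S.faces.Finite ∧ S.space = T.space ∧
      (∀ s ∈ S.faces, ∃ t ∈ T.faces, (s : Set E) ⊆ convexHull ℝ (t : Set E)) ∧
      ∀ s ∈ S.faces, p ∉ s → s ∈ T.faces ∧ ¬ (a ∈ s ∧ b ∈ s) := by
  classical
  have := Geometry.SimplicialComplex.finite_vertices hT
  have := Fintype.ofFinite T.vertices
  have hv : ∀ x ∈ e, x ∈ T.vertices := fun x hx =>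
    T.down_closed he (Finset.singleton_subset_iff.2 hx) (Finset.singleton_nonempty x)
  let a' : T.vertices := ⟨a, hv a ha⟩
  let b' : T.vertices := ⟨b, hv b hb⟩
  have hab' : a' ≠ b' := fun h => hab (Subtype.ext_iff.1 h)
  let φ : Option T.vertices → E := fun o => o.elim p fun v => v
  have hφ : ∀ x, Fintype.linearCombination ℝ φ x =
      Fintype.linearCombination ℝ ((↑) : T.vertices → E)
        (Fintype.linearCombination ℝ (edgeSubdivisionVertex a' b' r) x) := by
    intro x
    simp only [Fintype.linearCombination_apply ℝ φ, Fintype.linearCombination_apply ℝ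
      (edgeSubdivisionVertex a' b' r), map_sum, map_smul]
    refine Finset.sum_congr rfl fun o _ => ?_
    congr 1
    cases o with
    | none =>
      simp [edgeSubdivisionVertex, φ, hp, Fintype.linearCombination_apply_single, a', b']
    | some v =>
      simp only [edgeSubdivisionVertex, φ, Fintype.linearCombination_apply_single]
      simp
  have hbij := bijOn_edgeSubdivision T.abstractComplex hab' h0 h1
  have hinj : Set.InjOn (Fintype.linearCombination ℝ φ)
      (edgeSubdivision T.abstractComplex a' b').realization := by
    intro x hx y hy hxy
    rw [hφ, hφ] at hxy
    exact hbij.injOn hx hy (T.injOn_abstractComplex (hbij.mapsTo hx) (hbij.mapsTo hy) hxy)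
  obtain ⟨S, hS, hSfin, hSspace⟩ := exists_simplicialComplex_of_injOn _ φ hinj
  refine ⟨S, hSfin, ?_, fun s hs => ?_, fun s hs hps => ?_⟩
  · rw [hSspace, ← T.image_abstractComplex, ← hbij.image_eq, Set.image_image]
    exact Set.image_congr fun x _ => hφ x
  · obtain ⟨s', ⟨-, -, u, hu, hu1, hu2⟩, hs'⟩ := (hS s).1 hs
    refine ⟨_, hu, ?_⟩
    rw [hs']
    rintro _ ⟨o, ho, rfl⟩
    cases o with
    | none =>
      obtain ⟨h3, h4⟩ := hu2 ho
      have : p ∈ segment ℝ a b := ⟨1 - r, r, by linarith, h0.le, by ring, hp.symm⟩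
      exact segment_subset_convexHull (by simpa using ⟨hv a ha, h3⟩)
        (by simpa using ⟨hv b hb, h4⟩) this
    | some v =>
      exact subset_convexHull ℝ _ (by simpa [φ] using hu1 v ho)
  · obtain ⟨s', ⟨hs1, hs2, u, hu, hu1, -⟩, hs'⟩ := (hS s).1 hs
    have hn : none ∉ s' := fun h => hps (by rw [← Finset.mem_coe, hs']; exact ⟨none, h, rfl⟩)
    have hmem : ∀ x, x ∈ s ↔ ∃ v : T.vertices, some v ∈ s' ∧ (v : E) = x := by
      intro x
      rw [← Finset.mem_coe, hs']
      constructor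
      · rintro ⟨o, ho, rfl⟩
        cases o with
        | none => exact absurd ho hn
        | some v => exact ⟨v, ho, rfl⟩
      · rintro ⟨v, hv, rfl⟩
        exact ⟨some v, hv, rfl⟩
    refine ⟨T.down_closed hu (fun x hx => ?_) (S.nonempty_of_mem_faces hs), ?_⟩
    · obtain ⟨v, hv, rfl⟩ := (hmem x).1 hx
      simpa using hu1 v hv
    · rintro ⟨has, hbs⟩
      obtain ⟨v, hv, hva⟩ := (hmem a).1 has
      obtain ⟨w, hw, hwb⟩ := (hmem b).1 hbs
      have hva' : v = a' := Subtype.ext hva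
      have hwb' : w = b' := Subtype.ext hwb
      exact hs2 ⟨hva' ▸ hv, hwb' ▸ hw⟩

/-- A finite triangulation can be subdivided so that a given affine function has constant sign on
every simplex: the edges on which the function changes sign are subdivided at its zeros. -/
theorem exists_refinement_sign {T : Geometry.SimplicialComplex ℝ E} (hT : T.faces.Finite)
    (l : E →ᵃ[ℝ] ℝ) :
    ∃ S : Geometry.SimplicialComplex ℝ E, S.faces.Finite ∧ S.space = T.space ∧
      (∀ s ∈ S.faces, ∃ t ∈ T.faces, (s : Set E) ⊆ convexHull ℝ (t : Set E)) ∧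
      ∀ s ∈ S.faces, (∀ x ∈ s, 0 ≤ l x) ∨ ∀ x ∈ s, l x ≤ 0 := by
  classical
  -- The edges on which `l` changes sign. Each subdivision removes one and creates none, as `l`
  -- vanishes at the new vertex.
  let cross : Geometry.SimplicialComplex ℝ E → Set (Finset E) := fun T =>
    {e ∈ T.faces | ∃ a b, e = {a, b} ∧ l a < 0 ∧ 0 < l b}
  induction hN : (cross T).ncard using Nat.strong_induction_on generalizing T with
  | _ N ih =>
  by_cases hne : (cross T).Nonempty
  · obtain ⟨e, he, a, b, hab, ha, hb⟩ := hne
    have hae : a ∈ e := by simp [hab]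
    have hbe : b ∈ e := by simp [hab]
    have hne : a ≠ b := fun h => by rw [h] at ha; linarith
    let r := l a / (l a - l b)
    have hd : l a - l b < 0 := by linarith
    have h0 : 0 < r := div_pos_of_neg_of_neg ha hd
    have h1 : r < 1 := (div_lt_one_of_neg hd).2 (by linarith)
    let p := (1 - r) • a + r • b
    have hlp : l p = 0 := by
      have := l.map_sum_smul Finset.univ ![1 - r, r] ![a, b] (by simp)
      simp only [Fin.sum_univ_two, Matrix.cons_val_zero, Matrix.cons_val_one, smul_eq_mul] at this
      simp only [p, this, r]
      field_simp [hd.ne]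
      ring
    obtain ⟨S, hSfin, hSspace, hSsub, hSp⟩ := exists_edge_subdivision hT he hae hbe hne h0 h1
      (rfl : p = _)
    have hlt : (cross S).ncard < N := by
      rw [← hN]
      refine Set.ncard_lt_ncard ?_ (hT.subset fun s hs => hs.1)
      rw [Set.ssubset_iff_exists]
      have hp : ∀ s ∈ cross S, s ∈ T.faces ∧ ¬ (a ∈ s ∧ b ∈ s) := by
        rintro s ⟨hs, c, d, rfl, hc, hd⟩
        refine hSp _ hs fun h => ?_
        simp only [Finset.mem_insert, Finset.mem_singleton] at h
        rcases h with h | h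
        · rw [← h, hlp] at hc; exact lt_irrefl _ hc
        · rw [← h, hlp] at hd; exact lt_irrefl _ hd
      exact ⟨fun s hs => ⟨(hp s hs).1, hs.2⟩, e, ⟨he, a, b, hab, ha, hb⟩,
        fun h => (hp e h).2 ⟨hae, hbe⟩⟩
    obtain ⟨S', hS'fin, hS'space, hS'sub, hS'l⟩ := ih _ hlt hSfin rfl
    refine ⟨S', hS'fin, hS'space.trans hSspace, fun s hs => ?_, hS'l⟩
    obtain ⟨t, ht, hst⟩ := hS'sub s hs
    obtain ⟨u, hu, htu⟩ := hSsub t ht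
    exact ⟨u, hu, hst.trans (convexHull_min htu (convex_convexHull ℝ _))⟩
  · refine ⟨T, hT, rfl, fun s hs => ⟨s, hs, subset_convexHull ℝ _⟩, fun s hs => ?_⟩
    by_contra! hcon
    obtain ⟨⟨a, ha, hla⟩, b, hb, hlb⟩ := hcon
    exact hne ⟨{a, b}, T.down_closed hs (by
      intro x; simp only [Finset.mem_insert, Finset.mem_singleton]
      rintro (rfl | rfl) <;> assumption) ⟨a, by simp⟩, a, b, rfl, hla, hlb⟩

theorem sign_of_subset_convexHull {s t : Set E} (l : E →ᵃ[ℝ] ℝ) (hst : s ⊆ convexHull ℝ t)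
    (ht : (∀ x ∈ t, 0 ≤ l x) ∨ ∀ x ∈ t, l x ≤ 0) : (∀ x ∈ s, 0 ≤ l x) ∨ ∀ x ∈ s, l x ≤ 0 := by
  have h1 : Convex ℝ {y | 0 ≤ l y} := (convex_Ici (𝕜 := ℝ) (0 : ℝ)).affine_preimage l
  have h2 : Convex ℝ {y | l y ≤ 0} := (convex_Iic (𝕜 := ℝ) (0 : ℝ)).affine_preimage l
  exact ht.imp (fun h x hx => convexHull_min h h1 (hst hx)) fun h x hx =>
    convexHull_min h h2 (hst hx)

/-- Simultaneous version of `exists_refinement_sign`: the simplices of a subdivision lie in simplices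
of the triangulation subdivided, so signs which are constant remain constant. -/
theorem exists_refinement_signs {T : Geometry.SimplicialComplex ℝ E} (hT : T.faces.Finite)
    {Λ : Set (E →ᵃ[ℝ] ℝ)} (hΛ : Λ.Finite) :
    ∃ S : Geometry.SimplicialComplex ℝ E, S.faces.Finite ∧ S.space = T.space ∧
      ∀ s ∈ S.faces, ∀ l ∈ Λ, (∀ x ∈ s, 0 ≤ l x) ∨ ∀ x ∈ s, l x ≤ 0 := by
  induction Λ, hΛ using Set.Finite.induction_on with
  | empty => exact ⟨T, hT, rfl, by simp⟩
  | @insert l Λ _ _ ih =>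
    obtain ⟨S, hS, hST, hSΛ⟩ := ih
    obtain ⟨S', hS', hS'S, hsub, hl⟩ := exists_refinement_sign hS l
    refine ⟨S', hS', hS'S.trans hST, fun s hs l' hl' => ?_⟩
    rcases hl' with rfl | hl'
    · exact hl s hs
    · obtain ⟨t, ht, hst⟩ := hsub s hs
      exact sign_of_subset_convexHull l' hst (hSΛ t ht l' hl')

end Refinement

/-! ### Linear isomorphisms of realizations -/

section LinearIso

/-- Composing a piecewise linear homeomorphism with a homeomorphism which is the restriction of an
affine map. A triangulation of the source is subdivided so that each simplex has constant sign with
respect to the half-spaces cutting out the simplices of the target; then it is mapped into any of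
those simplices which contains the image of its barycentre. -/
theorem PLHomeomorphic.of_affineMap {E F G : Type*} [AddCommGroup E] [Module ℝ E]
    [AddCommGroup F] [Module ℝ F] [AddCommGroup G] [Module ℝ G]
    [TopologicalSpace E] [TopologicalSpace F] [TopologicalSpace G] [FiniteDimensional ℝ F]
    {X : Set E} {Y : Set F} {Z : Set G} (f : X ≃ₜ Y) (A : E →ᵃ[ℝ] F) (hfA : ∀ x : X, (f x : F) = A x)
    (hX : ∃ T : Geometry.SimplicialComplex ℝ E, T.faces.Finite ∧ T.space = X)
    (h : PLHomeomorphic Y Z) : PLHomeomorphic X Z := by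
  classical
  obtain ⟨T, hT, hTX⟩ := hX
  obtain ⟨e, ⟨S, hS, hSY, hSe⟩, -⟩ := h
  suffices IsPL (f.trans e) from ⟨f.trans e, this, IsPL.symm (e := (f.trans e).toEquiv) this⟩
  choose! Λ hΛfin hΛ using fun s (hs : s ∈ S.faces) => (S.indep hs).exists_halfSpaces
  have hfin : ((fun l : F →ᵃ[ℝ] ℝ => l.comp A) '' ⋃ s ∈ S.faces, Λ s).Finite :=
    (hS.biUnion fun s hs => hΛfin s hs).image _
  obtain ⟨R, hR, hRT, hRΛ⟩ := exists_refinement_signs hT hfin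
  refine ⟨R, hR, hRT.trans hTX, fun s hs => ?_⟩
  have hsne := R.nonempty_of_mem_faces hs
  have hcard : (0 : ℝ) < s.card := by exact_mod_cast hsne.card_pos
  -- The barycentre of `s`.
  let c : E := ∑ v ∈ s, (s.card : ℝ)⁻¹ • v
  have hw : ∑ v ∈ s, (s.card : ℝ)⁻¹ = 1 := by simp [hcard.ne']
  have hc : c ∈ X := by
    rw [← hTX, ← hRT]
    exact R.convexHull_subset_space hs ((convex_convexHull ℝ _).sum_mem
      (fun _ _ => by positivity) hw fun v hv => subset_convexHull ℝ _ hv)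
  obtain ⟨t, ht, hct⟩ : ∃ t ∈ S.faces, (f ⟨c, hc⟩ : F) ∈ convexHull ℝ (t : Set F) := by
    rw [← S.mem_space_iff, hSY]
    exact (f ⟨c, hc⟩).2
  rw [hfA, hΛ t ht] at hct
  have hst : ∀ x ∈ s, A x ∈ convexHull ℝ (t : Set F) := by
    intro x hx
    rw [hΛ t ht]
    intro l hl
    rcases hRΛ s hs (l.comp A) ⟨l, Set.mem_biUnion ht hl, rfl⟩ with h | h
    · exact h x hx
    -- `l ∘ A` is non-positive on `s` and non-negative at the barycentre, so it vanishes on `s`.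
    · have h0 : 0 ≤ (l.comp A) c := hct l hl
      rw [(l.comp A).map_sum_smul _ _ _ hw] at h0
      have hle : ∀ v ∈ s, (s.card : ℝ)⁻¹ • (l.comp A) v ≤ 0 := fun v hv =>
        smul_nonpos_of_nonneg_of_nonpos (by positivity) (h v hv)
      have := (Finset.sum_eq_zero_iff_of_nonpos hle).1
        (le_antisymm (Finset.sum_nonpos hle) h0) x hx
      have h2 : (l.comp A) x = 0 := by simpa [hcard.ne'] using this
      exact h2.ge
  obtain ⟨g, hg⟩ := hSe t ht
  refine ⟨g.comp A, fun x hx => ?_⟩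
  have hAx : A x ∈ convexHull ℝ (t : Set F) := by
    have : Convex ℝ (A ⁻¹' convexHull ℝ (t : Set F)) := (convex_convexHull ℝ _).affine_preimage A
    exact convexHull_min (fun v hv => hst v hv) this hx
  rw [← hfA] at hAx
  exact (hg (f x) hAx).trans (by rw [hfA]; rfl)

variable {V W : Type*} [Finite V]

theorem exists_triangulation_realization (K : PreAbstractSimplicialComplex V) :
    ∃ T : Geometry.SimplicialComplex ℝ (V → ℝ), T.faces.Finite ∧ T.space = K.realization := by
  classical
  have := Fintype.ofFinite V
  have hid : ∀ x, Fintype.linearCombination ℝ (fun v : V => Pi.single v (1 : ℝ)) x = x := by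
    intro x; ext v; simp [Fintype.linearCombination_apply, Finset.sum_apply, Pi.single_apply]
  obtain ⟨T, -, hT, hTK⟩ := exists_simplicialComplex_of_injOn K
    (fun v : V => Pi.single v (1 : ℝ)) (fun x _ y _ h => by rwa [hid, hid] at h)
  refine ⟨T, hT, hTK.trans ?_⟩
  simp [hid]

/-- A linear map which is a bijection between two realizations restricts to a homeomorphism. -/
noncomputable def homeomorphOfBijOn {K : PreAbstractSimplicialComplex V}
    {K' : PreAbstractSimplicialComplex W} (A : (V → ℝ) →ₗ[ℝ] (W → ℝ))
    (hA : Set.BijOn A K.realization K'.realization) : K.realization ≃ₜ K'.realization :=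
  haveI : CompactSpace K.realization := isCompact_iff_compactSpace.1 (isCompact_realization K)
  Continuous.homeoOfEquivCompactToT2 (f := Set.BijOn.equiv A hA)
    (((LinearMap.continuous_of_finiteDimensional A).comp continuous_subtype_val).subtype_mk _)

theorem homeomorphOfBijOn_apply {K : PreAbstractSimplicialComplex V}
    {K' : PreAbstractSimplicialComplex W} (A : (V → ℝ) →ₗ[ℝ] (W → ℝ))
    (hA : Set.BijOn A K.realization K'.realization) (x : K.realization) :
    (homeomorphOfBijOn A hA x : W → ℝ) = A x := rfl

/-- A linear map which is a bijection between two realizations is a piecewise linear homeomorphism,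
the simplices of the first complex being the triangulation. -/
theorem plHomeomorphic_of_bijOn {K : PreAbstractSimplicialComplex V}
    {K' : PreAbstractSimplicialComplex W} (A : (V → ℝ) →ₗ[ℝ] (W → ℝ))
    (hA : Set.BijOn A K.realization K'.realization) :
    PLHomeomorphic K.realization K'.realization := by
  obtain ⟨T, hT, hTK⟩ := exists_triangulation_realization K
  have h : IsPL (homeomorphOfBijOn A hA) :=
    ⟨T, hT, hTK, fun s _ => ⟨A.toAffineMap, fun x _ => homeomorphOfBijOn_apply A hA x⟩⟩
  exact ⟨_, h, IsPL.symm (e := (homeomorphOfBijOn A hA).toEquiv) h⟩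

/-- Linear bijections of realizations can be composed with piecewise linear homeomorphisms. -/
theorem PLHomeomorphic.of_bijOn [Finite W] {K : PreAbstractSimplicialComplex V}
    {K' : PreAbstractSimplicialComplex W} (A : (V → ℝ) →ₗ[ℝ] (W → ℝ))
    (hA : Set.BijOn A K.realization K'.realization) {G : Type*} [AddCommGroup G] [Module ℝ G]
    [TopologicalSpace G] {Z : Set G} (h : PLHomeomorphic K'.realization Z) :
    PLHomeomorphic K.realization Z :=
  h.of_affineMap (homeomorphOfBijOn A hA) A.toAffineMap (homeomorphOfBijOn_apply A hA)
    (exists_triangulation_realization K)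

end LinearIso

/-! ### The Bier poset as a subdivision -/

theorem BierInterval.lo_ne_hi {P : Type*} [PartialOrder P] {I : Set P} (b : BierInterval I) :
    b.lo ≠ b.hi := fun h => b.hi_notMem (h ▸ b.lo_mem)

section BierSubdivision

variable {P : Type*} [PartialOrder P] [BoundedOrder P] {I : Set P}

theorem mem_properPart_iff {x : P} : x ∈ properPart P ↔ x ≠ ⊥ ∧ x ≠ ⊤ := by
  simp [properPart, isBot_iff_eq_bot, isTop_iff_eq_top]

/-- The elements of the Bier poset other than its bottom `[⊥, ⊤]` and its top. -/
abbrev ProperBier (I : Set P) : Type _ := {b : BierInterval I // ¬ (b.lo = ⊥ ∧ b.hi = ⊤)}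

namespace ProperBier

instance [Finite P] : Finite (BierInterval I) :=
  Finite.of_injective (fun b => (b.lo, b.hi)) fun _ _ h =>
    BierInterval.ext (congrArg Prod.fst h) (congrArg Prod.snd h)

open Classical in
/-- The total weight of the point of the order complex of `P` at which the vertex `[x, y]` is
placed is normalized by this factor: there are two end points in the proper part of `P`, unless
`x = ⊥` or `y = ⊤`. -/
noncomputable def weight (b : ProperBier I) : ℝ := if b.1.lo = ⊥ ∨ b.1.hi = ⊤ then 1 else 1 / 2

theorem weight_pos (b : ProperBier I) : 0 < b.weight := by
  unfold weight; split_ifs <;> norm_num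

open Classical in
/-- The position of the vertex `[x, y]` in the order complex of the proper part of `P`: the midpoint
of `x` and `y`, where `⊥` and `⊤` are disregarded. -/
noncomputable def position (b : ProperBier I) (z : properPart P) : ℝ :=
  b.weight * ((if b.1.lo = z then 1 else 0) + (if b.1.hi = z then 1 else 0))

theorem position_nonneg (b : ProperBier I) (z : properPart P) : 0 ≤ b.position z := by
  have := b.weight_pos
  unfold position; split_ifs <;> simp [this.le]

theorem position_ne_zero_iff {b : ProperBier I} {z : properPart P} :
    b.position z ≠ 0 ↔ b.1.lo = z ∨ b.1.hi = z := by
  have := b.weight_pos.ne'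
  by_cases h1 : b.1.lo = z <;> by_cases h2 : b.1.hi = z <;> simp [position, h1, h2, this]

theorem lo_ne_top (b : BierInterval I) : b.lo ≠ ⊤ := fun h =>
  b.lo_ne_hi (le_antisymm b.lo_le_hi (h ▸ le_top))

theorem hi_ne_bot (b : BierInterval I) : b.hi ≠ ⊥ := fun h =>
  b.lo_ne_hi (le_antisymm b.lo_le_hi (h ▸ bot_le))

variable [Fintype P]

noncomputable instance : Fintype (ProperBier I) := Fintype.ofFinite _

noncomputable instance : Fintype (properPart P) := Fintype.ofFinite _

open Classical in
theorem sum_lo (b : BierInterval I) (f : properPart P → ℝ) (hb : b.lo ≠ ⊥) :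
    ∑ z : properPart P, (if b.lo = z then f z else 0) =
      f ⟨b.lo, mem_properPart_iff.2 ⟨hb, lo_ne_top b⟩⟩ := by
  rw [Finset.sum_eq_single ⟨b.lo, mem_properPart_iff.2 ⟨hb, lo_ne_top b⟩⟩] <;> simp
  intro a h h1 h2
  exact absurd h2.symm h1

open Classical in
theorem sum_hi (b : BierInterval I) (f : properPart P → ℝ) (hb : b.hi ≠ ⊤) :
    ∑ z : properPart P, (if b.hi = z then f z else 0) =
      f ⟨b.hi, mem_properPart_iff.2 ⟨hi_ne_bot b, hb⟩⟩ := by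
  rw [Finset.sum_eq_single ⟨b.hi, mem_properPart_iff.2 ⟨hi_ne_bot b, hb⟩⟩] <;> simp
  intro a h h1 h2
  exact absurd h2.symm h1

open Classical in
theorem sum_position_mul (b : ProperBier I) (f : properPart P → ℝ) :
    ∑ z, b.position z * f z = b.weight * ((∑ z : properPart P, if b.1.lo = z then f z else 0) +
      ∑ z : properPart P, if b.1.hi = z then f z else 0) := by
  rw [← Finset.sum_add_distrib, Finset.mul_sum]
  refine Finset.sum_congr rfl fun z _ => ?_
  unfold position
  split_ifs <;> ring

theorem sum_lo_of_eq_bot {b : BierInterval I} [DecidableEq P] (f : properPart P → ℝ)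
    (hb : b.lo = ⊥) : ∑ z : properPart P, (if b.lo = z then f z else 0) = 0 :=
  Finset.sum_eq_zero fun z _ => if_neg fun h => (mem_properPart_iff.1 z.2).1 (h ▸ hb)

theorem sum_hi_of_eq_top {b : BierInterval I} [DecidableEq P] (f : properPart P → ℝ)
    (hb : b.hi = ⊤) : ∑ z : properPart P, (if b.hi = z then f z else 0) = 0 :=
  Finset.sum_eq_zero fun z _ => if_neg fun h => (mem_properPart_iff.1 z.2).2 (h ▸ hb)

theorem sum_position (b : ProperBier I) : ∑ z, b.position z = 1 := by
  classical
  have := sum_position_mul b fun _ => 1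
  simp only [mul_one] at this
  rw [this]
  by_cases h1 : b.1.lo = ⊥
  · have h2 : b.1.hi ≠ ⊤ := fun h => b.2 ⟨h1, h⟩
    rw [sum_lo_of_eq_bot _ h1, sum_hi b.1 _ h2]
    simp [weight, h1]
  · rw [sum_lo b.1 _ h1]
    by_cases h2 : b.1.hi = ⊤
    · rw [sum_hi_of_eq_top _ h2]
      simp [weight, h2]
    · rw [sum_hi b.1 _ h2]
      simp [weight, h1, h2]
      norm_num

theorem linearCombination_position (x : ProperBier I → ℝ) (z : properPart P) :
    Fintype.linearCombination ℝ position x z = ∑ b, x b * b.position z := by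
  simp [Fintype.linearCombination_apply, Finset.sum_apply]

theorem sum_linearCombination_position (x : ProperBier I → ℝ) :
    ∑ z, Fintype.linearCombination ℝ position x z = ∑ b, x b := by
  simp only [linearCombination_position]
  rw [Finset.sum_comm]
  simp [← Finset.mul_sum, sum_position]

theorem linearCombination_position_ne_zero {x : ProperBier I → ℝ} (hx : ∀ b, 0 ≤ x b)
    {z : properPart P} : Fintype.linearCombination ℝ position x z ≠ 0 ↔
      ∃ b, x b ≠ 0 ∧ (b.1.lo = z ∨ b.1.hi = z) := by
  rw [linearCombination_position, Ne, Finset.sum_eq_zero_iff_of_nonneg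
    fun b _ => mul_nonneg (hx b) (position_nonneg b z)]
  simp [← position_ne_zero_iff]

theorem mapsTo_position : Set.MapsTo (Fintype.linearCombination ℝ (position (I := I)))
    (orderComplex (ProperBier I)).realization (orderComplex (properPart P)).realization := by
  intro x hx
  rw [mem_realization_iff] at hx ⊢
  obtain ⟨hx0, ⟨⟨b, hb⟩, hchain⟩, hx1⟩ := hx
  have hlam0 : ∀ z, 0 ≤ Fintype.linearCombination ℝ position x z := fun z => by
    rw [linearCombination_position]
    exact Finset.sum_nonneg fun b _ => mul_nonneg (hx0 b) (position_nonneg b z)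
  refine ⟨hlam0, ⟨?_, ?_⟩, by rw [sum_linearCombination_position, hx1]⟩
  · have hlam1 := sum_linearCombination_position x
    rw [hx1] at hlam1
    obtain ⟨z, -, hz⟩ := Finset.exists_ne_zero_of_sum_ne_zero (hlam1.trans_ne one_ne_zero)
    exact ⟨z, by simpa using hz⟩
  · intro z hz w hw _
    simp only [Finset.mem_coe, mem_coordSupport, linearCombination_position_ne_zero hx0] at hz hw
    obtain ⟨b, hb, hbz⟩ := hz
    obtain ⟨c, hc, hcw⟩ := hw
    have hbc : b ≤ c ∨ c ≤ b := hchain.total (by simpa using hb) (by simpa using hc)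
    show (z : P) ≤ w ∨ (w : P) ≤ z
    have h1 := b.1.lo_le_hi
    have h2 := c.1.lo_le_hi
    rcases hbc with ⟨h3, h4⟩ | ⟨h3, h4⟩ <;> rcases hbz with h | h <;> rcases hcw with h' | h' <;>
      rw [← h, ← h'] <;> first
      | exact Or.inl (by assumption)
      | exact Or.inr (by assumption)
      | exact Or.inl (h3.trans h2)
      | exact Or.inr (h2.trans h4)
      | exact Or.inr (h3.trans h1)
      | exact Or.inl (h1.trans h4)

open Classical in
/-- The weight which a point of the order complex of `P` has on the elements of `I` above `x`. -/
noncomputable def upperWeight (I : Set P) (l : properPart P → ℝ) (x : P) : ℝ :=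
  ∑ z, l z * if (z : P) ∈ I ∧ x ≤ z then 1 else 0

open Classical in
/-- The weight which a point of the order complex of `P` has on the elements outside `I` below
`y`. -/
noncomputable def lowerWeight (I : Set P) (l : properPart P → ℝ) (y : P) : ℝ :=
  ∑ z, l z * if (z : P) ∉ I ∧ z ≤ y then 1 else 0

theorem sum_linearCombination_position_mul (x : ProperBier I → ℝ) (f : properPart P → ℝ) :
    ∑ z, Fintype.linearCombination ℝ position x z * f z = ∑ b, x b * ∑ z, b.position z * f z := by
  simp only [linearCombination_position, Finset.sum_mul, Finset.mul_sum]
  rw [Finset.sum_comm]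
  simp only [mul_assoc]

open Classical in
theorem upperWeight_linearCombination (x : ProperBier I → ℝ) {a : P} (ha : a ≠ ⊥) :
    upperWeight I (Fintype.linearCombination ℝ position x) a =
      ∑ b, if a ≤ b.1.lo then x b * b.weight else 0 := by
  rw [upperWeight, sum_linearCombination_position_mul]
  refine Finset.sum_congr rfl fun b _ => ?_
  rw [sum_position_mul]
  have h2 : ∑ z : properPart P,
      (if b.1.hi = z then (if (z : P) ∈ I ∧ a ≤ z then (1 : ℝ) else 0) else 0) = 0 :=
    Finset.sum_eq_zero fun z _ => by
      split_ifs with h h' <;> try rfl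
      exact absurd (h ▸ h'.1) b.1.hi_notMem
  rw [h2, add_zero]
  by_cases hb : b.1.lo = ⊥
  · rw [sum_lo_of_eq_bot _ hb, if_neg (by rw [hb, le_bot_iff]; exact ha)]; simp
  · rw [sum_lo b.1 _ hb]
    simp only [b.1.lo_mem, true_and]
    split_ifs <;> ring

open Classical in
theorem lowerWeight_linearCombination (x : ProperBier I → ℝ) {a : P} (ha : a ≠ ⊤) :
    lowerWeight I (Fintype.linearCombination ℝ position x) a =
      ∑ b, if b.1.hi ≤ a then x b * b.weight else 0 := by
  rw [lowerWeight, sum_linearCombination_position_mul]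
  refine Finset.sum_congr rfl fun b _ => ?_
  rw [sum_position_mul]
  have h2 : ∑ z : properPart P,
      (if b.1.lo = z then (if (z : P) ∉ I ∧ z ≤ a then (1 : ℝ) else 0) else 0) = 0 :=
    Finset.sum_eq_zero fun z _ => by
      split_ifs with h h' <;> try rfl
      exact absurd b.1.lo_mem (h ▸ h'.1)
  rw [h2, zero_add]
  by_cases hb : b.1.hi = ⊤
  · rw [sum_hi_of_eq_top _ hb, if_neg (by rw [hb, top_le_iff]; exact ha)]; simp
  · rw [sum_hi b.1 _ hb]
    simp only [b.1.hi_notMem, not_false_eq_true, true_and]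
    split_ifs <;> ring

open Classical in
/-- The total weight above `[lo, hi]` can be read off from the image point: along a chain of
intervals, the conditions `lo ≤ lo'` and `hi' ≤ hi` define two nested terminal segments, of which
`[lo, hi] ≤ [lo', hi']` is the smaller one. -/
theorem sum_ge_eq {x : ProperBier I → ℝ} (hx : ∀ b, 0 ≤ x b)
    (hchain : ∀ b c, x b ≠ 0 → x c ≠ 0 → b ≤ c ∨ c ≤ b) (b : ProperBier I) :
    (∑ c, if b ≤ c then x c * c.weight else 0) =
      if b.1.lo = ⊥ then lowerWeight I (Fintype.linearCombination ℝ position x) b.1.hi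
      else if b.1.hi = ⊤ then upperWeight I (Fintype.linearCombination ℝ position x) b.1.lo
      else min (upperWeight I (Fintype.linearCombination ℝ position x) b.1.lo)
        (lowerWeight I (Fintype.linearCombination ℝ position x) b.1.hi) := by
  have hle : ∀ c : ProperBier I, b ≤ c ↔ b.1.lo ≤ c.1.lo ∧ c.1.hi ≤ b.1.hi := fun c => Iff.rfl
  have hnn : ∀ c : ProperBier I, 0 ≤ x c * c.weight := fun c => mul_nonneg (hx c) c.weight_pos.le
  split_ifs with h1 h2
  · rw [lowerWeight_linearCombination _ fun h => b.2 ⟨h1, h⟩]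
    simp [hle, h1]
  · rw [upperWeight_linearCombination _ h1]
    simp [hle, h2]
  · rw [upperWeight_linearCombination _ h1, lowerWeight_linearCombination _ h2]
    -- Either the intervals with `lo ≤ lo'` are among those with `hi' ≤ hi`, or conversely.
    by_cases hnest : ∀ c, x c ≠ 0 → b.1.lo ≤ c.1.lo → c.1.hi ≤ b.1.hi
    · have hcongr : ∀ c, (if b ≤ c then x c * c.weight else 0) =
          if b.1.lo ≤ c.1.lo then x c * c.weight else 0 := fun c => by
        by_cases hc : x c = 0
        · simp [hc]
        · simp only [hle]
          have := hnest c hc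
          congr 1
          exact propext ⟨fun h => h.1, fun h => ⟨h, this h⟩⟩
      rw [Finset.sum_congr rfl fun c _ => hcongr c, min_eq_left]
      refine Finset.sum_le_sum fun c _ => ?_
      by_cases hc : x c = 0
      · simp [hc]
      · have := hnest c hc
        have := hnn c
        split_ifs <;> tauto
    · have hnest' : ∀ c, x c ≠ 0 → c.1.hi ≤ b.1.hi → b.1.lo ≤ c.1.lo := by
        push Not at hnest
        obtain ⟨d, hd, hd1, hd2⟩ := hnest
        intro c hc hcb
        rcases hchain d c hd hc with h | h
        · exact hd1.trans h.1
        · exact absurd (h.2.trans hcb) hd2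
      have hcongr : ∀ c, (if b ≤ c then x c * c.weight else 0) =
          if c.1.hi ≤ b.1.hi then x c * c.weight else 0 := fun c => by
        by_cases hc : x c = 0
        · simp [hc]
        · simp only [hle]
          have := hnest' c hc
          congr 1
          exact propext ⟨fun h => h.2, fun h => ⟨this h, h⟩⟩
      rw [Finset.sum_congr rfl fun c _ => hcongr c, min_eq_right]
      refine Finset.sum_le_sum fun c _ => ?_
      by_cases hc : x c = 0
      · simp [hc]
      · have := hnest' c hc
        have := hnn c
        split_ifs <;> tauto

open Classical in
/-- A function on a finite poset is determined by its sums over principal filters. -/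
theorem eq_of_sum_ge_eq {Q : Type*} [PartialOrder Q] [Fintype Q] {f g : Q → ℝ}
    (h : ∀ b, (∑ c, if b ≤ c then f c else 0) = ∑ c, if b ≤ c then g c else 0) : f = g := by
  ext b
  induction b using (wellFounded_gt (α := Q)).induction with
  | _ b ih =>
  have hsplit : ∀ k : Q → ℝ, (∑ c, if b ≤ c then k c else 0) =
      k b + ∑ c, if b < c then k c else 0 := fun k => by
    have : ∀ c, (if b ≤ c then k c else 0) =
        (if c = b then k c else 0) + if b < c then k c else 0 := fun c => by
      rcases eq_or_ne c b with rfl | hne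
      · simp
      · simp [hne, lt_iff_le_and_ne, hne.symm]
    simp [this, Finset.sum_add_distrib]
  have := h b
  rw [hsplit f, hsplit g] at this
  have h2 : (∑ c, if b < c then f c else 0) = ∑ c, if b < c then g c else 0 :=
    Finset.sum_congr rfl fun c _ => by
      split_ifs with hc
      · exact ih c hc
      · rfl
  linarith

theorem injOn_position : Set.InjOn (Fintype.linearCombination ℝ (position (I := I)))
    (orderComplex (ProperBier I)).realization := by
  classical
  intro x hx y hy hxy
  rw [mem_realization_iff] at hx hy
  have hcx : ∀ b c, x b ≠ 0 → x c ≠ 0 → b ≤ c ∨ c ≤ b := fun b c hb hc =>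
    hx.2.1.2.total (by simpa using hb) (by simpa using hc)
  have hcy : ∀ b c, y b ≠ 0 → y c ≠ 0 → b ≤ c ∨ c ≤ b := fun b c hb hc =>
    hy.2.1.2.total (by simpa using hb) (by simpa using hc)
  have := eq_of_sum_ge_eq (f := fun b : ProperBier I => x b * b.weight)
    (g := fun b => y b * b.weight) fun b => by rw [sum_ge_eq hx.1 hcx, sum_ge_eq hy.1 hcy, hxy]
  ext b
  exact mul_right_cancel₀ b.weight_pos.ne' (congrFun this b)

theorem exists_greatest_of_chain {Q : Type*} [PartialOrder Q] [Finite Q] {s : Set Q}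
    (hs : ∀ x ∈ s, ∀ y ∈ s, x ≤ y ∨ y ≤ x) (hne : s.Nonempty) : ∃ x ∈ s, ∀ y ∈ s, y ≤ x := by
  obtain ⟨x, hx⟩ := (Set.toFinite s).exists_maximal hne
  exact ⟨x, hx.1, fun y hy => (hs x hx.1 y hy).elim (fun h => hx.2 hy h) id⟩

theorem exists_least_of_chain {Q : Type*} [PartialOrder Q] [Finite Q] {s : Set Q}
    (hs : ∀ x ∈ s, ∀ y ∈ s, x ≤ y ∨ y ≤ x) (hne : s.Nonempty) : ∃ x ∈ s, ∀ y ∈ s, x ≤ y := by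
  obtain ⟨x, hx⟩ := (Set.toFinite s).exists_minimal hne
  exact ⟨x, hx.1, fun y hy => (hs x hx.1 y hy).elim id (fun h => hx.2 hy h)⟩

/-- Every non-negative weight on a chain of `P` is distributed over a chain of intervals: the
interval between the largest element in `I` and the smallest element outside `I` takes the largest
possible share, and the rest has smaller support. -/
theorem exists_linearCombination_position_eq (hI : IsLowerSet I) (hbot : ⊥ ∈ I) (htop : ⊤ ∉ I)
    (l : properPart P → ℝ) (hl : ∀ z, 0 ≤ l z)
    (hchain : ∀ z w, l z ≠ 0 → l w ≠ 0 → z ≤ w ∨ w ≤ z) :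
    ∃ x : ProperBier I → ℝ, (∀ b, 0 ≤ x b) ∧ (∀ b c, x b ≠ 0 → x c ≠ 0 → b ≤ c ∨ c ≤ b) ∧
      Fintype.linearCombination ℝ position x = l := by
  classical
  induction hn : (coordSupport l).card using Nat.strong_induction_on generalizing l with
  | _ n ih =>
  by_cases hl0 : ∀ z, l z = 0
  · refine ⟨0, by simp, by simp, ?_⟩
    ext z; simp [hl0]
  push Not at hl0
  obtain ⟨z₁, hz₁⟩ := hl0
  -- The support of `l` in `I` and outside `I`, augmented by `⊥` and `⊤`, respectively.
  let A : Set P := {a | a ∈ I ∧ (a = ⊥ ∨ ∃ z : properPart P, (z : P) = a ∧ l z ≠ 0)}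
  let B : Set P := {a | a ∉ I ∧ (a = ⊤ ∨ ∃ z : properPart P, (z : P) = a ∧ l z ≠ 0)}
  obtain ⟨x, ⟨hxI, hx⟩, hxA⟩ : ∃ x ∈ A, ∀ y ∈ A, y ≤ x := by
    refine exists_greatest_of_chain ?_ ⟨⊥, hbot, Or.inl rfl⟩
    rintro a ⟨-, rfl | ⟨z, rfl, hz⟩⟩ b ⟨-, rfl | ⟨w, rfl, hw⟩⟩
    · exact Or.inl le_rfl
    · exact Or.inl bot_le
    · exact Or.inr bot_le
    · exact hchain z w hz hw
  obtain ⟨y, ⟨hyI, hy⟩, hyB⟩ : ∃ y ∈ B, ∀ z ∈ B, y ≤ z := by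
    refine exists_least_of_chain ?_ ⟨⊤, htop, Or.inl rfl⟩
    rintro a ⟨-, rfl | ⟨z, rfl, hz⟩⟩ b ⟨-, rfl | ⟨w, rfl, hw⟩⟩
    · exact Or.inl le_rfl
    · exact Or.inr le_top
    · exact Or.inl le_top
    · exact hchain z w hz hw
  have hxy : x ≤ y := by
    rcases hx with rfl | ⟨z, rfl, hz⟩
    · exact bot_le
    rcases hy with rfl | ⟨w, rfl, hw⟩
    · exact le_top
    rcases hchain z w hz hw with h | h
    · exact h
    · exact absurd (hI h hxI) hyI
  let b₀ : BierInterval I := ⟨x, y, hxI, hyI, hxy⟩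
  have hb₀ : ¬ (b₀.lo = ⊥ ∧ b₀.hi = ⊤) := by
    rintro ⟨h1, h2⟩
    have h3 := mem_properPart_iff.1 z₁.2
    by_cases hz₁I : (z₁ : P) ∈ I
    · have := hxA z₁ ⟨hz₁I, Or.inr ⟨z₁, rfl, hz₁⟩⟩
      rw [show x = ⊥ from h1, le_bot_iff] at this
      exact h3.1 this
    · have := hyB z₁ ⟨hz₁I, Or.inr ⟨z₁, rfl, hz₁⟩⟩
      rw [show y = ⊤ from h2, top_le_iff] at this
      exact h3.2 this
  let b : ProperBier I := ⟨b₀, hb₀⟩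
  have hlo : ∀ z : properPart P, x = z → l z ≠ 0 := by
    intro z hz
    rcases hx with h | ⟨w, hw, hw0⟩
    · exact absurd (hz.symm.trans h) (mem_properPart_iff.1 z.2).1
    · rwa [← show w = z from Subtype.ext (hw.trans hz)]
  have hhi : ∀ z : properPart P, y = z → l z ≠ 0 := by
    intro z hz
    rcases hy with h | ⟨w, hw, hw0⟩
    · exact absurd (hz.symm.trans h) (mem_properPart_iff.1 z.2).2
    · rwa [← show w = z from Subtype.ext (hw.trans hz)]
  have hS : (Finset.univ.filter fun z : properPart P => x = z ∨ y = z).Nonempty := by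
    by_cases h : x = ⊥
    · have h' : y ≠ ⊤ := fun h' => hb₀ ⟨h, h'⟩
      exact ⟨⟨y, mem_properPart_iff.2 ⟨hi_ne_bot b₀, h'⟩⟩, by simp⟩
    · exact ⟨⟨x, mem_properPart_iff.2 ⟨h, lo_ne_top b₀⟩⟩, by simp⟩
  -- The share of `[x, y]` is limited by the smaller of the values of `l` at those of its ends that
  -- lie in the proper part; subtracting it makes `l` vanish there.
  obtain ⟨z₀, hz₀, hmin⟩ := Finset.exists_min_image _ l hS
  simp only [Finset.mem_filter, Finset.mem_univ, true_and] at hz₀ hmin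
  let r := l z₀
  have hr : 0 < r := lt_of_le_of_ne (hl _) (hz₀.elim (hlo z₀) (hhi z₀)).symm
  let c : ℝ := r / b.weight
  have hc : 0 < c := div_pos hr b.weight_pos
  have hpos : ∀ z, c * b.position z = if x = z ∨ y = z then r else 0 := by
    intro z
    have h := b.weight_pos.ne'
    have hne : x ≠ y := b₀.lo_ne_hi
    have hcw : c * b.weight = r := div_mul_cancel₀ _ h
    rw [position, ← mul_assoc, hcw]
    show r * ((if x = z then 1 else 0) + if y = z then 1 else 0) = _
    by_cases h1 : x = z
    · have : y ≠ z := fun h2 => hne (h1.trans h2.symm)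
      simp [h1, this]
    · by_cases h2 : y = z <;> simp [h1, h2]
  let l' : properPart P → ℝ := fun z => l z - c * b.position z
  have hl'z : ∀ z, l' z = if x = z ∨ y = z then l z - r else l z := fun z => by
    simp only [l', hpos]; split_ifs <;> simp
  have hl' : ∀ z, 0 ≤ l' z := by
    intro z
    rw [hl'z]
    split_ifs with h
    · exact sub_nonneg.2 (hmin z h)
    · exact hl z
  have hsupp : ∀ z, l' z ≠ 0 → l z ≠ 0 := by
    intro z hz
    rw [hl'z] at hz
    split_ifs at hz with h
    · exact h.elim (hlo z) (hhi z)
    · exact hz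
  have hcard : (coordSupport l').card < n := by
    rw [← hn]
    refine Finset.card_lt_card ((Finset.ssubset_iff_of_subset fun z hz => ?_).2 ⟨z₀, ?_, ?_⟩)
    · simpa using hsupp z (by simpa using hz)
    · simpa using hr.ne'
    · simp [hl'z, hz₀, r]
  obtain ⟨x', hx', hchain', hF⟩ := ih _ hcard l' hl'
    (fun z w hz hw => hchain z w (hsupp z hz) (hsupp w hw)) rfl
  -- The remaining intervals have their ends in `A` and `B`, so they contain `[x, y]`.
  have hle : ∀ d, x' d ≠ 0 → d ≤ b := by
    intro d hd
    have hmem : ∀ z : properPart P, d.1.lo = z ∨ d.1.hi = z → l z ≠ 0 := fun z hz =>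
      hsupp z (by rw [← hF]; exact (linearCombination_position_ne_zero hx').2 ⟨d, hd, hz⟩)
    constructor
    · refine hxA _ ⟨d.1.lo_mem, ?_⟩
      by_cases h : d.1.lo = ⊥
      · exact Or.inl h
      · exact Or.inr ⟨⟨_, mem_properPart_iff.2 ⟨h, lo_ne_top d.1⟩⟩, rfl, hmem _ (Or.inl rfl)⟩
    · refine hyB _ ⟨d.1.hi_notMem, ?_⟩
      by_cases h : d.1.hi = ⊤
      · exact Or.inl h
      · exact Or.inr ⟨⟨_, mem_properPart_iff.2 ⟨hi_ne_bot d.1, h⟩⟩, rfl, hmem _ (Or.inr rfl)⟩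
  have hnz : ∀ d, (x' + Pi.single b c : ProperBier I → ℝ) d ≠ 0 → d = b ∨ x' d ≠ 0 := by
    intro d hd
    by_contra! h
    simp [h.1, h.2] at hd
  refine ⟨x' + Pi.single b c, fun d => ?_, fun d e hd he => ?_, ?_⟩
  · by_cases h : d = b
    · subst h; simpa using add_nonneg (hx' _) hc.le
    · simpa [h] using hx' d
  · rcases hnz d hd with rfl | hd' <;> rcases hnz e he with rfl | he'
    · exact Or.inl le_rfl
    · exact Or.inr (hle e he')
    · exact Or.inl (hle d hd')
    · exact hchain' d e hd' he'
  · rw [map_add, hF, Fintype.linearCombination_apply_single]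
    ext z
    simp [l']

/-- The order complex of the proper part of a Bier poset subdivides the order complex of the proper
part of the original poset. -/
theorem bijOn_position (hI : IsLowerSet I) (hbot : ⊥ ∈ I) (htop : ⊤ ∉ I) :
    Set.BijOn (Fintype.linearCombination ℝ (position (I := I)))
      (orderComplex (ProperBier I)).realization (orderComplex (properPart P)).realization := by
  refine ⟨mapsTo_position, injOn_position, fun l hl => ?_⟩
  rw [mem_realization_iff] at hl
  obtain ⟨x, hx, hchain, rfl⟩ := exists_linearCombination_position_eq hI hbot htop l hl.1
    fun z w hz hw => hl.2.1.2.total (by simpa using hz) (by simpa using hw)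
  have hsum : ∑ b, x b = 1 := by rw [← sum_linearCombination_position, hl.2.2]
  refine ⟨x, mem_realization_iff.2 ⟨hx, ⟨?_, ?_⟩, hsum⟩, rfl⟩
  · obtain ⟨b, -, hb⟩ := Finset.exists_ne_zero_of_sum_ne_zero (hsum.trans_ne one_ne_zero)
    exact ⟨b, by simpa using hb⟩
  · intro b hb c hc _
    exact hchain b c (by simpa using hb) (by simpa using hc)

end ProperBier

end BierSubdivision

/-! ### Conewise linear maps and their derivatives -/

section ConewiseLinear

open Filter Topology

variable {E W : Type*} [NormedAddCommGroup E] [NormedSpace ℝ E]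
  [NormedAddCommGroup W] [NormedSpace ℝ W]

/-- The intersection of the half-spaces on which the given linear functionals are non-negative. -/
def polyhedralCone (Λ : Set (E →ₗ[ℝ] ℝ)) : Set E := {x | ∀ l ∈ Λ, 0 ≤ l x}

/-- A map is conewise linear on `S` if `S` is a finite union of polyhedral cones such that the map
is linear on each of them. -/
def IsConewiseLinear (S : Set E) (g : E → W) : Prop :=
  ∃ C : Set (Set (E →ₗ[ℝ] ℝ) × (E →ₗ[ℝ] W)), C.Finite ∧ (∀ c ∈ C, c.1.Finite) ∧
    S = ⋃ c ∈ C, polyhedralCone c.1 ∧ ∀ c ∈ C, ∀ x ∈ polyhedralCone c.1, g x = c.2 x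

theorem smul_mem_polyhedralCone {Λ : Set (E →ₗ[ℝ] ℝ)} {x : E} (hx : x ∈ polyhedralCone Λ) {r : ℝ}
    (hr : 0 ≤ r) : r • x ∈ polyhedralCone Λ := fun l hl => by
  rw [map_smul]; exact mul_nonneg hr (hx l hl)

namespace IsConewiseLinear

variable {S : Set E} {g : E → W}

theorem smul_mem (hg : IsConewiseLinear S g) {x : E} (hx : x ∈ S) {r : ℝ} (hr : 0 ≤ r) :
    r • x ∈ S := by
  obtain ⟨C, -, -, rfl, -⟩ := hg
  simp only [Set.mem_iUnion] at hx ⊢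
  obtain ⟨c, hc, hx⟩ := hx
  exact ⟨c, hc, smul_mem_polyhedralCone hx hr⟩

theorem map_smul (hg : IsConewiseLinear S g) {x : E} (hx : x ∈ S) {r : ℝ} (hr : 0 ≤ r) :
    g (r • x) = r • g x := by
  obtain ⟨C, -, -, rfl, hgC⟩ := hg
  simp only [Set.mem_iUnion] at hx
  obtain ⟨c, hc, hx⟩ := hx
  rw [hgC c hc _ hx, hgC c hc _ (smul_mem_polyhedralCone hx hr), _root_.map_smul]

theorem map_zero (hg : IsConewiseLinear S g) {x : E} (hx : x ∈ S) : g 0 = 0 := by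
  simpa using hg.map_smul hx le_rfl

end IsConewiseLinear

theorem eventually_smul_add_mem_polyhedralCone {Λ : Set (E →ₗ[ℝ] ℝ)} (hΛ : Λ.Finite) {p v : E}
    (hp : p ∈ polyhedralCone Λ) (hv : v ∈ polyhedralCone {l ∈ Λ | l p = 0}) :
    ∀ᶠ ε : ℝ in 𝓝[>] 0, p + ε • v ∈ polyhedralCone Λ := by
  refine (eventually_all_finite hΛ).2 fun l hl => ?_
  rcases eq_or_lt_of_le (hp l hl) with h | h
  · filter_upwards [self_mem_nhdsWithin] with ε hε
    rw [map_add, ← h, zero_add, map_smul]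
    exact mul_nonneg (le_of_lt hε) (hv l ⟨hl, h.symm⟩)
  · have hc : Continuous fun ε : ℝ => l (p + ε • v) := by simp only [map_add, map_smul]; fun_prop
    have : ∀ᶠ ε : ℝ in 𝓝 0, 0 < l (p + ε • v) :=
      hc.continuousAt.eventually (lt_mem_nhds (by simpa using h))
    exact (this.filter_mono nhdsWithin_le_nhds).mono fun _ h => h.le

variable [FiniteDimensional ℝ E]

theorem isClosed_polyhedralCone (Λ : Set (E →ₗ[ℝ] ℝ)) : IsClosed (polyhedralCone Λ) := by
  simp only [polyhedralCone, Set.ofPred_forall]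
  exact isClosed_biInter fun l _ =>
    isClosed_le continuous_const (LinearMap.continuous_of_finiteDimensional l)

namespace IsConewiseLinear

variable {S : Set E} {g : E → W}

theorem isClosed (hg : IsConewiseLinear S g) : IsClosed S := by
  obtain ⟨C, hC, -, rfl, -⟩ := hg
  exact hC.isClosed_biUnion fun c _ => isClosed_polyhedralCone c.1

theorem continuousOn (hg : IsConewiseLinear S g) : ContinuousOn g S := by
  obtain ⟨C, hC, -, rfl, hgC⟩ := hg
  have : Finite C := hC
  rw [Set.biUnion_eq_iUnion]
  refine (locallyFinite_of_finite _).continuousOn_iUnion (fun c => isClosed_polyhedralCone _)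
    fun c => ?_
  exact (LinearMap.continuous_of_finiteDimensional c.1.2).continuousOn.congr (hgC c c.2)

/-- An injective conewise linear map is bounded below, by compactness of the unit sphere. -/
theorem exists_pos_mul_norm_le (hg : IsConewiseLinear S g) (hinj : Set.InjOn g S) :
    ∃ m > 0, ∀ x ∈ S, m * ‖x‖ ≤ ‖g x‖ := by
  have : ProperSpace E := FiniteDimensional.proper ℝ E
  have hK : IsCompact (Metric.sphere (0 : E) 1 ∩ S) := (isCompact_sphere _ _).inter_right hg.isClosed
  have hunit : ∀ x ∈ S, x ≠ 0 → ‖x‖⁻¹ • x ∈ Metric.sphere (0 : E) 1 ∩ S := fun x hx hx0 =>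
    ⟨by simp [norm_smul, hx0], hg.smul_mem hx (by positivity)⟩
  by_cases hne : (Metric.sphere (0 : E) 1 ∩ S).Nonempty
  · obtain ⟨y, hy, hmin⟩ := hK.exists_isMinOn hne
      (hg.continuousOn.norm.mono Set.inter_subset_right)
    have hy0 : y ≠ 0 := by
      rintro rfl
      simpa using hy.1
    have h0S : (0 : E) ∈ S := by simpa using hg.smul_mem hy.2 le_rfl
    have hgy : 0 < ‖g y‖ := norm_pos_iff.2 fun h =>
      hy0 (hinj hy.2 h0S (h.trans (hg.map_zero hy.2).symm))
    refine ⟨‖g y‖, hgy, fun x hx => ?_⟩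
    by_cases hx0 : x = 0
    · simp [hx0]
    · have := hmin (hunit x hx hx0)
      simp only [Set.mem_ofPred_eq, hg.map_smul hx (inv_nonneg.2 (norm_nonneg x)), norm_smul, norm_inv,
        norm_norm] at this
      have hxp : 0 < ‖x‖ := norm_pos_iff.2 hx0
      rwa [inv_mul_eq_div, le_div_iff₀ hxp] at this
  · refine ⟨1, one_pos, fun x hx => ?_⟩
    by_cases hx0 : x = 0
    · simp [hx0]
    · exact absurd ⟨_, hunit x hx hx0⟩ hne

/-- The inverse of an injective conewise linear map is continuous. -/
theorem exists_forall_norm_sub_lt (hg : IsConewiseLinear S g) (hinj : Set.InjOn g S) {p : E}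
    (hp : p ∈ S) {U : Set E} (hU : U ∈ 𝓝 p) :
    ∃ δ > 0, ∀ x ∈ S, ‖g x - g p‖ < δ → x ∈ U := by
  have : ProperSpace E := FiniteDimensional.proper ℝ E
  obtain ⟨m, hm, hgm⟩ := hg.exists_pos_mul_norm_le hinj
  obtain ⟨O, hOU, hO, hpO⟩ := mem_nhds_iff.1 hU
  let R := (‖g p‖ + 1) / m
  have hK : IsCompact (Metric.closedBall (0 : E) R ∩ (S \ O)) :=
    (isCompact_closedBall _ _).inter_right (hg.isClosed.sdiff hO)
  have hbound : ∀ x ∈ S, ‖g x - g p‖ < 1 → x ∈ Metric.closedBall (0 : E) R := fun x hx h => by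
    rw [mem_closedBall_zero_iff, le_div_iff₀ hm, mul_comm]
    have := norm_sub_norm_le (g x) (g p)
    linarith [hgm x hx]
  by_cases hne : (Metric.closedBall (0 : E) R ∩ (S \ O)).Nonempty
  · obtain ⟨y, hy, hmin⟩ := hK.exists_isMinOn hne (f := fun x => ‖g x - g p‖)
      ((hg.continuousOn.mono fun x hx => hx.2.1).sub continuousOn_const).norm
    have hyp : 0 < ‖g y - g p‖ := norm_pos_iff.2 fun h =>
      hy.2.2 (by rwa [hinj hy.2.1 hp (sub_eq_zero.1 h)])
    refine ⟨min 1 ‖g y - g p‖, lt_min one_pos hyp, fun x hx hlt => hOU ?_⟩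
    by_contra hxO
    have : ‖g y - g p‖ ≤ ‖g x - g p‖ :=
      hmin ⟨hbound x hx (hlt.trans_le (min_le_left _ _)), hx, hxO⟩
    exact absurd (hlt.trans_le (min_le_right _ _)) (not_lt.2 this)
  · refine ⟨1, one_pos, fun x hx hlt => hOU ?_⟩
    by_contra hxO
    exact hne ⟨x, hbound x hx hlt, hx, hxO⟩

end IsConewiseLinear

theorem eventually_smul_add_notMem_polyhedralCone {Λ : Set (E →ₗ[ℝ] ℝ)} {p v : E}
    (h : ¬ (p ∈ polyhedralCone Λ ∧ v ∈ polyhedralCone {l ∈ Λ | l p = 0})) :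
    ∀ᶠ ε : ℝ in 𝓝[>] 0, p + ε • v ∉ polyhedralCone Λ := by
  rw [not_and_or] at h
  rcases h with h | h
  · have hc : Continuous fun ε : ℝ => p + ε • v := by fun_prop
    have : ∀ᶠ ε : ℝ in 𝓝 0, p + ε • v ∈ (polyhedralCone Λ)ᶜ :=
      hc.continuousAt.eventually
        ((isClosed_polyhedralCone Λ).isOpen_compl.mem_nhds (by simpa using h))
    exact this.filter_mono nhdsWithin_le_nhds
  · simp only [polyhedralCone, Set.mem_ofPred_eq, not_forall, not_le] at h
    obtain ⟨l, ⟨hl, hlp⟩, hlv⟩ := h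
    filter_upwards [self_mem_nhdsWithin] with ε hε hmem
    have := hmem l hl
    rw [map_add, hlp, zero_add, map_smul, smul_eq_mul] at this
    exact absurd (mul_neg_of_pos_of_neg hε hlv) (not_lt.2 this)

/-- The directions which point from `p` into `S`. -/
def tangentDirections (S : Set E) (p : E) : Set E := {v | ∀ᶠ ε : ℝ in 𝓝[>] 0, p + ε • v ∈ S}

/-- A finite union of closed sets meets a subspace in such a way that a generic point of the
subspace lies in the relative interior of every one of these sets which contains it. -/
theorem exists_generic_point (U : Submodule ℝ E) {O : Set E} (hO : IsOpen O)
    (hne : (O ∩ U).Nonempty) {ι : Type*} {C : Set ι} (hC : C.Finite) {τ : ι → Set E}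
    (hτ : ∀ c ∈ C, IsClosed (τ c)) :
    ∃ p ∈ O, p ∈ U ∧ ∀ c ∈ C, p ∈ τ c → ∃ δ > 0, ∀ w ∈ U, ‖w‖ < δ → p + w ∈ τ c := by
  have : CompleteSpace U := FiniteDimensional.complete ℝ U
  have hdense : Dense (⋂ c ∈ C, (frontier ((↑) ⁻¹' τ c : Set U))ᶜ) := by
    refine dense_biInter_of_isOpen (fun c _ => isClosed_frontier.isOpen_compl) hC.countable
      fun c hc => ?_
    rw [← interior_eq_empty_iff_dense_compl]
    exact interior_frontier ((hτ c hc).preimage continuous_subtype_val)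
  obtain ⟨q, hq, hqU⟩ := hne
  obtain ⟨p, hpO, hp⟩ := hdense.inter_open_nonempty (Subtype.val ⁻¹' O : Set U)
    (hO.preimage continuous_subtype_val) ⟨(⟨q, hqU⟩ : U), hq⟩
  refine ⟨p, hpO, p.2, fun c hc hpc => ?_⟩
  have h1 := Set.mem_iInter₂.1 hp c hc
  have h2 : p ∈ interior ((↑) ⁻¹' τ c : Set U) := by
    by_contra h
    exact h1 ⟨subset_closure hpc, h⟩
  obtain ⟨δ, hδ, hball⟩ := Metric.mem_nhds_iff.1 (mem_interior_iff_mem_nhds.1 h2)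
  refine ⟨δ, hδ, fun w hw hwδ => ?_⟩
  have : (p + ⟨w, hw⟩ : U) ∈ Metric.ball p δ := by
    rw [mem_ball_iff_norm, add_sub_cancel_left]
    exact hwδ
  exact hball this

/-- A conewise linear bijection onto a vector space has, at every point, a conewise linear
derivative which is again a bijection. At a generic point of a subspace, the set of tangent
directions is invariant under translations along the subspace, and the derivative is equivariant
with respect to them. -/
theorem IsConewiseLinear.exists_derivative {S : Set E} {g : E → W} (hg : IsConewiseLinear S g)
    (hbij : Set.BijOn g S Set.univ) (U : Submodule ℝ E) {O : Set E} (hO : IsOpen O)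
    (hne : (O ∩ U).Nonempty) (hOS : O ∩ U ⊆ S) :
    ∃ p ∈ O, p ∈ U ∧ ∃ (D : E → W) (A : E →ₗ[ℝ] W),
      IsConewiseLinear (tangentDirections S p) D ∧
      Set.BijOn D (tangentDirections S p) Set.univ ∧
      ∀ v ∈ tangentDirections S p, ∀ w ∈ U,
        v + w ∈ tangentDirections S p ∧ D (v + w) = D v + A w := by
  classical
  obtain ⟨C, hC, hCfin, hCS, hgC⟩ := id hg
  obtain ⟨p, hpO, hpU, hpC⟩ := exists_generic_point U hO hne hC
    (τ := fun c => polyhedralCone c.1) fun c _ => isClosed_polyhedralCone c.1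
  have hpS : p ∈ S := hOS ⟨hpO, hpU⟩
  have hmemS : ∀ c ∈ C, ∀ x ∈ polyhedralCone c.1, x ∈ S := fun c hc x hx => by
    rw [hCS]; exact Set.mem_biUnion hc hx
  -- The cones of the derivative are given by the functionals which vanish at `p`.
  let τ : Set (E →ₗ[ℝ] ℝ) × (E →ₗ[ℝ] W) → Set (E →ₗ[ℝ] ℝ) := fun c => {l ∈ c.1 | l p = 0}
  let C' := {c ∈ C | p ∈ polyhedralCone c.1}
  have hev : ∀ c ∈ C', ∀ v ∈ polyhedralCone (τ c),
      ∀ᶠ ε : ℝ in 𝓝[>] 0, p + ε • v ∈ polyhedralCone c.1 := fun c hc v hv =>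
    eventually_smul_add_mem_polyhedralCone (hCfin c hc.1) hc.2 hv
  have hT : tangentDirections S p = ⋃ c ∈ C', polyhedralCone (τ c) := by
    ext v
    simp only [Set.mem_iUnion]
    constructor
    · intro hv
      by_contra! hcon
      have : ∀ᶠ ε : ℝ in 𝓝[>] 0, ∀ c ∈ C, p + ε • v ∉ polyhedralCone c.1 :=
        (eventually_all_finite hC).2 fun c hc => eventually_smul_add_notMem_polyhedralCone
          fun h => hcon c ⟨hc, h.1⟩ h.2
      obtain ⟨ε, h1, h2⟩ := (this.and hv).exists
      rw [hCS] at h2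
      obtain ⟨c, hc, h2⟩ := Set.mem_iUnion₂.1 h2
      exact h1 c hc h2
    · rintro ⟨c, hc, hv⟩
      exact (hev c hc v hv).mono fun ε h => hmemS c hc.1 _ h
  -- The definition does not depend on the choice: two of the linear maps agree at `p` and at
  -- `p + ε • v` for small `ε`, hence at `v`.
  let D : E → W := fun v =>
    if h : ∃ c, c ∈ C' ∧ v ∈ polyhedralCone (τ c) then h.choose.2 v else 0
  have hD : ∀ c ∈ C', ∀ v ∈ polyhedralCone (τ c), D v = c.2 v := by
    intro c hc v hv
    have h : ∃ c, c ∈ C' ∧ v ∈ polyhedralCone (τ c) := ⟨c, hc, hv⟩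
    simp only [D, dif_pos h]
    obtain ⟨hd, hvd⟩ := h.choose_spec
    obtain ⟨ε, ⟨h1, h2⟩, hε⟩ := (((hev c hc v hv).and (hev _ hd v hvd)).and
      self_mem_nhdsWithin).exists
    have h3 := (hgC c hc.1 _ h1).symm.trans (hgC _ hd.1 _ h2)
    rw [map_add, map_add, ← hgC c hc.1 p hc.2, ← hgC _ hd.1 p hd.2] at h3
    have h4 := add_left_cancel h3
    rw [_root_.map_smul, _root_.map_smul] at h4
    exact (smul_right_injective W (ne_of_gt hε) h4).symm
  have hDg : ∀ v ∈ tangentDirections S p, ∀ᶠ ε : ℝ in 𝓝[>] 0, g (p + ε • v) = g p + ε • D v := by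
    intro v hv
    rw [hT] at hv
    obtain ⟨c, hc, hv⟩ := Set.mem_iUnion₂.1 hv
    filter_upwards [hev c hc v hv] with ε hε
    rw [hgC c hc.1 _ hε, hgC c hc.1 p hc.2, hD c hc v hv, map_add, _root_.map_smul]
  obtain ⟨c₀, hc₀C, hpc₀⟩ := Set.mem_iUnion₂.1 (hCS ▸ hpS)
  have hc₀ : c₀ ∈ C' := ⟨hc₀C, hpc₀⟩
  -- This is where genericity enters: `p ± w` satisfies the inequality `0 ≤ l` for small `w ∈ U`, and
  -- `l` vanishes at `p`.
  have hU : ∀ c ∈ C', ∀ w ∈ U, ∀ l ∈ τ c, l w = 0 := by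
    intro c hc w hw l hl
    obtain ⟨δ, hδ, hball⟩ := hpC c hc.1 hc.2
    have key : ∀ w ∈ U, 0 ≤ l w := by
      intro w hw
      have hpos : 0 < δ / (‖w‖ + 1) := by positivity
      have h1 : ‖(δ / (‖w‖ + 1)) • w‖ < δ := by
        rw [norm_smul, Real.norm_of_nonneg hpos.le, div_mul_eq_mul_div,
          div_lt_iff₀ (by positivity)]
        nlinarith [norm_nonneg w]
      have h2 := hball _ (U.smul_mem _ hw) h1 l hl.1
      rw [map_add, hl.2, zero_add, _root_.map_smul, smul_eq_mul] at h2
      exact nonneg_of_mul_nonneg_right h2 hpos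
    have := key _ (U.neg_mem hw)
    rw [map_neg] at this
    linarith [key w hw]
  have hUmem : ∀ c ∈ C', ∀ w ∈ U, w ∈ polyhedralCone (τ c) := fun c hc w hw l hl =>
    (hU c hc w hw l hl).ge
  refine ⟨p, hpO, hpU, D, c₀.2, ⟨(fun c => (τ c, c.2)) '' C', (hC.subset fun c hc => hc.1).image _,
    ?_, ?_, ?_⟩, ⟨fun _ _ => trivial, ?_, ?_⟩, ?_⟩
  · rintro _ ⟨c, hc, rfl⟩
    exact (hCfin c hc.1).subset fun l hl => hl.1
  · rw [hT, Set.biUnion_image]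
  · rintro _ ⟨c, hc, rfl⟩ x hx
    exact hD c hc x hx
  · intro v hv v' hv' hvv'
    obtain ⟨ε, ⟨⟨⟨h1, h2⟩, h3⟩, h4⟩, hε⟩ := ((((hDg v hv).and (hDg v' hv')).and hv).and hv').and
      self_mem_nhdsWithin |>.exists
    have := hbij.injOn h3 h4 (by rw [h1, h2, hvv'])
    exact smul_right_injective E (ne_of_gt hε) (add_left_cancel this)
  · intro w _
    -- Surjectivity: a preimage of `g p + t • w` with `t` small is close to `p`, so it lies in a cone
    -- which contains `p`, where `g` is linear.
    have hnhds : {x | ∀ c ∈ C, p ∉ polyhedralCone c.1 → x ∉ polyhedralCone c.1} ∈ 𝓝 p := by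
      refine (eventually_all_finite hC).2 fun c _ => ?_
      by_cases h : p ∈ polyhedralCone c.1
      · simp [h]
      · filter_upwards [(isClosed_polyhedralCone c.1).isOpen_compl.mem_nhds h] with x hx _ using hx
    obtain ⟨δ, hδ, hclose⟩ := hg.exists_forall_norm_sub_lt hbij.injOn hpS hnhds
    have hpos : 0 < δ / (‖w‖ + 1) := by positivity
    obtain ⟨x, hxS, hx⟩ := hbij.surjOn (Set.mem_univ (g p + (δ / (‖w‖ + 1)) • w))
    have hx' := hclose x hxS (by
      rw [hx, add_sub_cancel_left, norm_smul, Real.norm_of_nonneg hpos.le, div_mul_eq_mul_div,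
        div_lt_iff₀ (by positivity)]
      nlinarith [norm_nonneg w])
    obtain ⟨c, hc, hxc⟩ := Set.mem_iUnion₂.1 (hCS ▸ hxS)
    have hpc : p ∈ polyhedralCone c.1 := by
      by_contra h
      exact hx' c hc h hxc
    have hc' : c ∈ C' := ⟨hc, hpc⟩
    have hv : (δ / (‖w‖ + 1))⁻¹ • (x - p) ∈ polyhedralCone (τ c) := by
      intro l hl
      rw [_root_.map_smul, map_sub, hl.2, sub_zero]
      exact mul_nonneg (inv_nonneg.2 hpos.le) (hxc l hl.1)
    refine ⟨_, by rw [hT]; exact Set.mem_biUnion hc' hv, ?_⟩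
    rw [hD c hc' _ hv, _root_.map_smul, map_sub, ← hgC c hc x hxc, ← hgC c hc p hpc, hx,
      add_sub_cancel_left, inv_smul_smul₀ hpos.ne']
  · intro v hv w hw
    rw [hT] at hv ⊢
    obtain ⟨c, hc, hv⟩ := Set.mem_iUnion₂.1 hv
    have hvw : v + w ∈ polyhedralCone (τ c) := fun l hl => by
      rw [map_add, hU c hc w hw l hl, add_zero]; exact hv l hl
    refine ⟨Set.mem_biUnion hc hvw, ?_⟩
    rw [hD c hc _ hvw, hD c hc _ hv, map_add, ← hD c hc w (hUmem c hc w hw),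
      hD c₀ hc₀ w (hUmem c₀ hc₀ w hw)]

end ConewiseLinear

/-! ### Links -/

section Link

open Filter Topology

variable {V : Type*}

/-- The cone with apex `0` over the realization of the link of a face `σ`. -/
def linkCone (K : PreAbstractSimplicialComplex V) (σ : Finset V) : Set (V → ℝ) :=
  {z | (∀ v, 0 ≤ z v) ∧ (∀ v ∈ σ, z v = 0) ∧ ∃ u ∈ K.faces, σ ⊆ u ∧ ∀ v, z v ≠ 0 → v ∈ u}

theorem smul_mem_linkCone {K : PreAbstractSimplicialComplex V} {σ : Finset V} {z : V → ℝ}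
    (hz : z ∈ linkCone K σ) {r : ℝ} (hr : 0 ≤ r) : r • z ∈ linkCone K σ := by
  obtain ⟨h1, h2, u, hu, h3, h4⟩ := hz
  exact ⟨fun v => mul_nonneg hr (h1 v), fun v hv => by simp [h2 v hv], u, hu, h3,
    fun v hv => h4 v (right_ne_zero_of_mul hv)⟩

variable [Fintype V]

/-- The cone with apex `0` over the realization of a complex. -/
def coneOver (K : PreAbstractSimplicialComplex V) : Set (V → ℝ) :=
  {x | (∀ v, 0 ≤ x v) ∧ (x = 0 ∨ coordSupport x ∈ K.faces)}

theorem isClosed_linkCone (K : PreAbstractSimplicialComplex V) (σ : Finset V) :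
    IsClosed (linkCone K σ) := by
  have : linkCone K σ = (⋂ v, {z | 0 ≤ z v}) ∩ ((⋂ v ∈ σ, {z | z v = 0}) ∩
      ⋃ u ∈ {u ∈ K.faces | σ ⊆ u}, ⋂ v ∈ {v | v ∉ u}, {z | z v = 0}) := by
    ext z
    simp only [linkCone, Set.mem_ofPred_eq, Set.mem_inter_iff, Set.mem_iInter, Set.mem_iUnion,
      exists_prop, and_assoc]
    have : ∀ u : Finset V, (∀ v, z v ≠ 0 → v ∈ u) ↔ ∀ v, v ∉ u → z v = 0 := fun u =>
      forall_congr' fun v => by rw [not_imp_comm]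
    simp only [this]
  rw [this]
  refine (isClosed_iInter fun v => isClosed_le continuous_const (continuous_apply v)).inter
    ((isClosed_biInter fun v _ => isClosed_eq (continuous_apply v) continuous_const).inter
      ((Set.toFinite _).isClosed_biUnion fun u _ => isClosed_biInter fun v _ =>
        isClosed_eq (continuous_apply v) continuous_const))

/-- If the cone over a complex is mapped bijectively to a vector space by a conewise linear map,
then so is the cone over the link of each of its faces `σ`, up to linearity. The map is induced by
the derivative at a generic point of `σ`, by dividing out the directions of `σ`. -/
theorem exists_bijOn_linkCone {W : Type*} [NormedAddCommGroup W] [NormedSpace ℝ W]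
    [FiniteDimensional ℝ W] {K : PreAbstractSimplicialComplex V} {g : (V → ℝ) → W}
    (hg : IsConewiseLinear (coneOver K) g) (hbij : Set.BijOn g (coneOver K) Set.univ)
    {σ : Finset V} (hσ : σ ∈ K.faces) :
    ∃ m, m + σ.card = Module.finrank ℝ W ∧ ∃ h : (V → ℝ) → (Fin m → ℝ),
      ContinuousOn h (linkCone K σ) ∧ Set.BijOn h (linkCone K σ) Set.univ ∧
      ∀ z ∈ linkCone K σ, ∀ r : ℝ, 0 ≤ r → h (r • z) = r • h z := by
  classical
  let U : Submodule ℝ (V → ℝ) :=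
    { carrier := {w | ∀ v, v ∉ σ → w v = 0}
      add_mem' := fun {a b} ha hb v hv => by simp [ha v hv, hb v hv]
      zero_mem' := fun _ _ => rfl
      smul_mem' := fun r a ha v hv => by simp [ha v hv] }
  -- `O ∩ U` is the relative interior of the cone over `σ`.
  let O : Set (V → ℝ) := ⋂ v ∈ σ, {x | 0 < x v}
  have hO : IsOpen O := σ.finite_toSet.isOpen_biInter fun v _ =>
    isOpen_lt continuous_const (continuous_apply v)
  have hOmem : ∀ x, x ∈ O ↔ ∀ v ∈ σ, 0 < x v := fun x => by simp [O]
  have hne : (O ∩ U).Nonempty := ⟨fun v => if v ∈ σ then 1 else 0,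
    (hOmem _).2 fun v hv => by simp [hv], fun v hv => if_neg hv⟩
  have hsupp : ∀ x ∈ O, x ∈ U → coordSupport x = σ := fun x hxO hxU => by
    ext v
    rw [mem_coordSupport]
    exact ⟨fun h => by by_contra hv; exact h (hxU v hv), fun h => ((hOmem x).1 hxO v h).ne'⟩
  have hOS : O ∩ U ⊆ coneOver K := fun x hx => by
    refine ⟨fun v => ?_, Or.inr (by rwa [hsupp x hx.1 hx.2])⟩
    by_cases hv : v ∈ σ
    · exact ((hOmem x).1 hx.1 v hv).le
    · exact (hx.2 v hv).ge
  obtain ⟨p, hpO, hpU, D, A, hD, hDbij, hDA⟩ := hg.exists_derivative hbij U hO hne hOS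
  have hpσ : ∀ v ∈ σ, 0 < p v := (hOmem p).1 hpO
  -- The tangent directions at `p` are the sums of a vector in the cone over the link and a direction
  -- of `σ`.
  have hlink : linkCone K σ ⊆ tangentDirections (coneOver K) p := by
    rintro z ⟨h1, h2, u, hu, h3, h4⟩
    filter_upwards [self_mem_nhdsWithin] with ε hε
    have hε : 0 < ε := hε
    have hpn : ∀ v, 0 ≤ p v := (hOS ⟨hpO, hpU⟩).1
    refine ⟨fun v => add_nonneg (hpn v) (mul_nonneg hε.le (h1 v)), Or.inr ?_⟩
    obtain ⟨v₀, hv₀⟩ := (K.isRelLowerSet_faces hσ).1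
    refine (K.isRelLowerSet_faces hu).2 (fun v hv => ?_) ⟨v₀, ?_⟩
    · rw [mem_coordSupport] at hv
      by_contra hvu
      have h5 : p v = 0 := hpU v fun h => hvu (h3 h)
      have h6 : z v = 0 := by
        by_contra h
        exact hvu (h4 v h)
      exact hv (by simp [h5, h6])
    · rw [mem_coordSupport]
      have := hpσ v₀ hv₀
      simp [h2 v₀ hv₀, this.ne']
  have htangent : ∀ v ∈ tangentDirections (coneOver K) p,
      (fun i => if i ∈ σ then 0 else v i) ∈ linkCone K σ := by
    intro v hv
    have hpos : ∀ᶠ ε : ℝ in 𝓝[>] 0, ∀ i ∈ σ, 0 < p i + ε * v i := by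
      refine (eventually_all_finite σ.finite_toSet).2 fun i hi => ?_
      have hc : Continuous fun ε : ℝ => p i + ε * v i := by fun_prop
      have : ∀ᶠ ε : ℝ in 𝓝 0, 0 < p i + ε * v i :=
        hc.continuousAt.eventually (lt_mem_nhds (by simpa using hpσ i hi))
      exact this.filter_mono nhdsWithin_le_nhds
    obtain ⟨ε, ⟨⟨h1, h2⟩, h3⟩, hε⟩ := ((Eventually.and
      (show ∀ᶠ ε : ℝ in 𝓝[>] 0, p + ε • v ∈ coneOver K from hv) hpos).and
      self_mem_nhdsWithin).exists
    have hε : 0 < ε := hε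
    obtain ⟨v₀, hv₀⟩ := (K.isRelLowerSet_faces hσ).1
    have hface : coordSupport (p + ε • v) ∈ K.faces := by
      refine h2.resolve_left fun h => ?_
      have := congrFun h v₀
      exact (h3 v₀ hv₀).ne' this
    refine ⟨fun i => ?_, fun i hi => if_pos hi, _, hface, fun i hi => ?_, fun i hi => ?_⟩
    · dsimp only
      split_ifs with hi
      · exact le_rfl
      · have := h1 i
        simp only [Pi.add_apply, hpU i hi, zero_add, Pi.smul_apply, smul_eq_mul] at this
        exact nonneg_of_mul_nonneg_right this hε
    · rw [mem_coordSupport]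
      exact (h3 i hi).ne'
    · dsimp only at hi
      split_ifs at hi with hiσ
      · exact absurd rfl hi
      · rw [mem_coordSupport]
        simp only [Pi.add_apply, hpU i hiσ, zero_add, Pi.smul_apply, smul_eq_mul]
        exact mul_ne_zero hε.ne' hi
  -- The derivative is injective on the directions of `σ`, so its image has dimension `σ.card`.
  have h0 : (0 : V → ℝ) ∈ tangentDirections (coneOver K) p := by
    simpa [tangentDirections] using hOS ⟨hpO, hpU⟩
  have hAinj : Function.Injective (A.domRestrict U) := by
    rw [← LinearMap.ker_eq_bot, LinearMap.ker_eq_bot']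
    rintro ⟨w, hw⟩ hAw
    obtain ⟨h1, h2⟩ := hDA 0 h0 w hw
    rw [show A w = 0 from hAw, add_zero] at h2
    have := hDbij.injOn h1 h0 h2
    rw [zero_add] at this
    exact Subtype.ext this
  have hUdim : Module.finrank ℝ U = σ.card := by
    let eU : U ≃ₗ[ℝ] (σ → ℝ) :=
      { toFun := fun w v => w.1 v
        invFun := fun y => ⟨fun v => if h : v ∈ σ then y ⟨v, h⟩ else 0, fun v hv => dif_neg hv⟩
        map_add' := fun _ _ => rfl
        map_smul' := fun _ _ => rfl
        left_inv := fun w => by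
          ext v
          by_cases h : v ∈ σ
          · simp [h]
          · simp [h, w.2 v h]
        right_inv := fun y => by ext v; simp }
    rw [eU.finrank_eq]; simp
  let R := LinearMap.range (A.domRestrict U)
  have hR : Module.finrank ℝ R = σ.card := by
    rw [LinearMap.finrank_range_of_inj hAinj, hUdim]
  refine ⟨Module.finrank ℝ (W ⧸ R), by rw [← hR]; exact R.finrank_quotient_add_finrank, ?_⟩
  let eW : (W ⧸ R) ≃ₗ[ℝ] (Fin (Module.finrank ℝ (W ⧸ R)) → ℝ) :=
    LinearEquiv.ofFinrankEq _ _ (by simp)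
  let π : W →ₗ[ℝ] (Fin (Module.finrank ℝ (W ⧸ R)) → ℝ) := eW.toLinearMap ∘ₗ R.mkQ
  have hπ : ∀ w w', π w = π w' ↔ ∃ u ∈ U, w - w' = A u := by
    intro w w'
    have : π w = π w' ↔ w - w' ∈ R := by
      rw [← Submodule.Quotient.eq]
      exact eW.injective.eq_iff
    rw [this]
    constructor
    · rintro ⟨u, hu⟩; exact ⟨u, u.2, hu.symm⟩
    · rintro ⟨u, hu, h⟩; exact ⟨⟨u, hu⟩, h.symm⟩
  have hπsurj : Function.Surjective π := eW.surjective.comp R.mkQ_surjective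
  refine ⟨fun z => π (D z), ?_, ⟨fun _ _ => trivial, ?_, ?_⟩, ?_⟩
  · exact (LinearMap.continuous_of_finiteDimensional π).comp_continuousOn
      (hD.continuousOn.mono hlink)
  · intro z hz z' hz' hzz'
    obtain ⟨w, hw, hzw⟩ := (hπ _ _).1 hzz'
    obtain ⟨h1, h2⟩ := hDA z' (hlink hz') w hw
    have h3 : z = z' + w := hDbij.injOn (hlink hz) h1 (by rw [h2, ← hzw]; abel)
    have hw0 : w = 0 := by
      ext v
      by_cases hv : v ∈ σ
      · have := congrFun h3 v
        simpa [hz.2.1 v hv, hz'.2.1 v hv] using this.symm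
      · exact hw v hv
    rw [h3, hw0, add_zero]
  · intro y _
    obtain ⟨w₀, rfl⟩ := hπsurj y
    obtain ⟨v, hv, rfl⟩ := hDbij.surjOn (Set.mem_univ w₀)
    refine ⟨_, htangent v hv, (hπ _ _).2 ?_⟩
    obtain ⟨-, h2⟩ := hDA v hv (-fun i => if i ∈ σ then v i else 0)
      (U.neg_mem fun i hi => if_neg hi)
    have h3 : (fun i => if i ∈ σ then 0 else v i) = v + -fun i => if i ∈ σ then v i else 0 := by
      ext i
      by_cases hi : i ∈ σ <;> simp [hi]
    refine ⟨-fun i => if i ∈ σ then v i else 0, U.neg_mem fun i hi => if_neg hi, ?_⟩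
    rw [h3, h2, add_sub_cancel_left]
  · intro z hz r hr
    simp only [hD.map_smul (hlink hz) hr, map_smul]

end Link

/-! ### From piecewise linear spheres to conewise linear bijections -/

section ConeMap

variable {V : Type*} [Fintype V]

theorem sum_pos_of_nonneg_of_ne_zero {x : V → ℝ} (hx : ∀ v, 0 ≤ x v) (h0 : x ≠ 0) :
    0 < ∑ v, x v := by
  refine lt_of_le_of_ne (Finset.sum_nonneg fun v _ => hx v) fun h => h0 (funext fun v => ?_)
  exact (Finset.sum_eq_zero_iff_of_nonneg fun v _ => hx v).1 h.symm v (Finset.mem_univ v)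

theorem coordSupport_smul {r : ℝ} (hr : r ≠ 0) (x : V → ℝ) :
    coordSupport (r • x) = coordSupport x := by
  ext v; simp [hr]

theorem smul_mem_coneOver {K : PreAbstractSimplicialComplex V} {x : V → ℝ}
    (hx : x ∈ K.realization) {r : ℝ} (hr : 0 ≤ r) : r • x ∈ coneOver K := by
  rw [mem_realization_iff] at hx
  refine ⟨fun v => mul_nonneg hr (hx.1 v), ?_⟩
  rcases hr.eq_or_lt with rfl | hr
  · exact Or.inl (zero_smul _ _)
  · exact Or.inr (by rw [coordSupport_smul hr.ne']; exact hx.2.1)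

theorem realization_subset_coneOver (K : PreAbstractSimplicialComplex V) :
    K.realization ⊆ coneOver K := fun x hx => by
  simpa using smul_mem_coneOver hx zero_le_one

theorem inv_sum_smul_mem_realization {K : PreAbstractSimplicialComplex V} {x : V → ℝ}
    (hx : x ∈ coneOver K) (h0 : x ≠ 0) : (∑ v, x v)⁻¹ • x ∈ K.realization := by
  have hpos := sum_pos_of_nonneg_of_ne_zero hx.1 h0
  rw [mem_realization_iff, coordSupport_smul (inv_ne_zero hpos.ne')]
  refine ⟨fun v => mul_nonneg (inv_nonneg.2 hpos.le) (hx.1 v), hx.2.resolve_left h0, ?_⟩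
  simp only [Pi.smul_apply, smul_eq_mul, ← Finset.mul_sum]
  exact inv_mul_cancel₀ hpos.ne'

/-- The projection of the boundary of the positive orthant along its diagonal. -/
noncomputable def orthantProjection (n : ℕ) : (Fin (n + 1) → ℝ) →ₗ[ℝ] EuclideanSpace ℝ (Fin n) :=
  (WithLp.linearEquiv 2 ℝ (Fin n → ℝ)).symm.toLinearMap ∘ₗ
    LinearMap.pi fun i : Fin n =>
      LinearMap.proj (R := ℝ) (φ := fun _ : Fin (n + 1) => ℝ) i.succ - LinearMap.proj 0

theorem orthantProjection_apply (n : ℕ) (y : Fin (n + 1) → ℝ) (i : Fin n) :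
    orthantProjection n y i = y i.succ - y 0 := rfl

theorem mem_coneOver_simplexBoundary {n : ℕ} {y : Fin (n + 1) → ℝ} :
    y ∈ coneOver (simplexBoundary n) ↔ (∀ i, 0 ≤ y i) ∧ ∃ i, y i = 0 := by
  refine and_congr_right fun _ => ⟨?_, fun ⟨i, hi⟩ => ?_⟩
  · rintro (rfl | ⟨-, h⟩)
    · exact ⟨0, rfl⟩
    · by_contra! hcon
      exact h (Finset.eq_univ_of_forall fun i => by simpa using hcon i)
  · by_cases h : y = 0
    · exact Or.inl h
    · obtain ⟨j, hj⟩ := Function.ne_iff.1 h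
      refine Or.inr ⟨⟨j, by simpa using hj⟩, fun hu => ?_⟩
      have : i ∈ coordSupport y := hu ▸ Finset.mem_univ i
      exact (mem_coordSupport.1 this) hi

theorem bijOn_orthantProjection (n : ℕ) :
    Set.BijOn (orthantProjection n) (coneOver (simplexBoundary n)) Set.univ := by
  refine ⟨fun _ _ => trivial, fun y hy y' hy' h => ?_, fun u _ => ?_⟩
  · rw [mem_coneOver_simplexBoundary] at hy hy'
    have hd : ∀ i, y i - y' i = y 0 - y' 0 := fun i => by
      refine Fin.cases rfl (fun j => ?_) i
      have := congrArg (fun w : EuclideanSpace ℝ (Fin n) => w j) h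
      simp only [orthantProjection_apply] at this
      linarith
    obtain ⟨h1, i, hi⟩ := hy
    obtain ⟨h2, j, hj⟩ := hy'
    have := hd i; have := hd j; have := h1 j; have := h2 i
    ext k
    have := hd k
    linarith
  · let w : Fin (n + 1) → ℝ := Fin.cons 0 u
    obtain ⟨i, -, hi⟩ := Finset.exists_min_image Finset.univ w Finset.univ_nonempty
    refine ⟨fun j => w j - w i, mem_coneOver_simplexBoundary.2 ⟨fun j =>
      sub_nonneg.2 (hi j (Finset.mem_univ j)), i, sub_self _⟩, ?_⟩
    ext j
    rw [orthantProjection_apply]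
    simp [w]

/-- A piecewise linear homeomorphism between the realizations of two complexes extends
homogeneously to the cones over them. -/
theorem exists_coneMap {V' : Type*} [Fintype V'] {K : PreAbstractSimplicialComplex V}
    {K' : PreAbstractSimplicialComplex V'} (h : PLHomeomorphic K.realization K'.realization) :
    ∃ f : (V → ℝ) → (V' → ℝ), IsConewiseLinear (coneOver K) f ∧
      Set.BijOn f (coneOver K) (coneOver K') := by
  classical
  obtain ⟨e, ⟨T, hT, hTX, hTe⟩, -⟩ := h
  let e' : (V → ℝ) → (V' → ℝ) := fun x => if hx : x ∈ K.realization then e ⟨x, hx⟩ else 0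
  have he' : ∀ x (hx : x ∈ K.realization), e' x = e ⟨x, hx⟩ := fun x hx => dif_pos hx
  let sumL : (V → ℝ) →ₗ[ℝ] ℝ := ∑ v, LinearMap.proj v
  have hsumL : ∀ x, sumL x = ∑ v, x v := fun x => by simp [sumL]
  let f : (V → ℝ) → (V' → ℝ) := fun x => (∑ v, x v) • e' ((∑ v, x v)⁻¹ • x)
  choose! Λ hΛfin hΛ using fun s (hs : s ∈ T.faces) => (T.indep hs).exists_halfSpaces
  choose! G hG using hTe
  -- The homogeneous extension of an affine map on the hyperplane of coordinate sum `1`.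
  let lin : ((V → ℝ) →ᵃ[ℝ] ℝ) → ((V → ℝ) →ₗ[ℝ] ℝ) := fun l => l.linear + l 0 • sumL
  let linG : ((V → ℝ) →ᵃ[ℝ] (V' → ℝ)) → ((V → ℝ) →ₗ[ℝ] (V' → ℝ)) := fun l =>
    l.linear + sumL.smulRight (l 0)
  have hlin : ∀ (l : (V → ℝ) →ᵃ[ℝ] ℝ) (x : V → ℝ), (∑ v, x v) ≠ 0 →
      lin l x = (∑ v, x v) * l ((∑ v, x v)⁻¹ • x) := by
    intro l x hx
    rw [show l ((∑ v, x v)⁻¹ • x) = l.linear ((∑ v, x v)⁻¹ • x) + l 0 from congrFun l.decomp _]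
    simp only [lin, LinearMap.add_apply, LinearMap.smul_apply, hsumL, map_smul, smul_eq_mul]
    field_simp
  have hlinG : ∀ (l : (V → ℝ) →ᵃ[ℝ] (V' → ℝ)) (x : V → ℝ), (∑ v, x v) ≠ 0 →
      linG l x = (∑ v, x v) • l ((∑ v, x v)⁻¹ • x) := by
    intro l x hx
    rw [show l ((∑ v, x v)⁻¹ • x) = l.linear ((∑ v, x v)⁻¹ • x) + l 0 from congrFun l.decomp _]
    simp only [linG, LinearMap.add_apply, LinearMap.smulRight_apply, hsumL, map_smul, smul_add]
    rw [smul_inv_smul₀ hx]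
  let pos : Set ((V → ℝ) →ₗ[ℝ] ℝ) := Set.range fun v => LinearMap.proj v
  let neg : Set ((V → ℝ) →ₗ[ℝ] ℝ) := Set.range fun v => -LinearMap.proj v
  have hpos : ∀ {Λ' : Set ((V → ℝ) →ₗ[ℝ] ℝ)} {x}, x ∈ polyhedralCone (pos ∪ Λ') → ∀ v, 0 ≤ x v :=
    fun hx v => hx _ (Or.inl ⟨v, rfl⟩)
  -- The cones over the simplices of the triangulation. The cone `{0}` is added since there need not
  -- be any simplices.
  let C : Set (Set ((V → ℝ) →ₗ[ℝ] ℝ) × ((V → ℝ) →ₗ[ℝ] (V' → ℝ))) :=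
    insert (pos ∪ neg, 0) ((fun s => (pos ∪ lin '' Λ s, linG (G s))) '' T.faces)
  have hzero : ∀ x ∈ polyhedralCone (pos ∪ neg), x = 0 := fun x hx => by
    ext v
    have h1 := hpos hx v
    have h2 : 0 ≤ -x v := hx _ (Or.inr ⟨v, rfl⟩)
    exact le_antisymm (neg_nonneg.1 h2) h1
  have hmem : ∀ s ∈ T.faces, ∀ x ∈ polyhedralCone (pos ∪ lin '' Λ s), x ≠ 0 →
      (∑ v, x v)⁻¹ • x ∈ convexHull ℝ (s : Set (V → ℝ)) := by
    intro s hs x hx hx0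
    have hsum := sum_pos_of_nonneg_of_ne_zero (hpos hx) hx0
    rw [hΛ s hs]
    intro l hl
    have := hx _ (Or.inr ⟨l, hl, rfl⟩)
    rw [hlin l x hsum.ne'] at this
    exact nonneg_of_mul_nonneg_right this hsum
  refine ⟨f, ⟨C, (hT.image _).insert _, ?_, ?_, ?_⟩, ?_, ?_, ?_⟩
  · rintro _ (rfl | ⟨s, hs, rfl⟩)
    · exact (Set.finite_range _).union (Set.finite_range _)
    · exact (Set.finite_range _).union ((hΛfin s hs).image _)
  · ext x
    simp only [C, Set.biUnion_insert, Set.biUnion_image, Set.mem_union, Set.mem_iUnion]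
    constructor
    · intro hx
      by_cases hx0 : x = 0
      · left
        rintro l (⟨v, rfl⟩ | ⟨v, rfl⟩) <;> simp [hx0]
      · right
        have hsum := sum_pos_of_nonneg_of_ne_zero hx.1 hx0
        have h1 := inv_sum_smul_mem_realization hx hx0
        rw [← hTX, T.mem_space_iff] at h1
        obtain ⟨s, hs, h1⟩ := h1
        refine ⟨s, hs, ?_⟩
        rintro _ (⟨v, rfl⟩ | ⟨l, hl, rfl⟩)
        · exact hx.1 v
        · rw [hlin l x hsum.ne']
          exact mul_nonneg hsum.le ((hΛ s hs _).1 h1 l hl)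
    · rintro (hx | ⟨s, hs, hx⟩)
      · rw [hzero x hx]; exact ⟨fun _ => le_rfl, Or.inl rfl⟩
      · by_cases hx0 : x = 0
        · rw [hx0]; exact ⟨fun _ => le_rfl, Or.inl rfl⟩
        · have hsum := sum_pos_of_nonneg_of_ne_zero (hpos hx) hx0
          have h1 := T.convexHull_subset_space hs (hmem s hs x hx hx0)
          rw [hTX] at h1
          have := smul_mem_coneOver h1 hsum.le
          rwa [smul_inv_smul₀ hsum.ne'] at this
  · rintro _ (rfl | ⟨s, hs, rfl⟩) x hx
    · simp [f, hzero x hx]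
    · by_cases hx0 : x = 0
      · simp [f, hx0]
      · have hsum := sum_pos_of_nonneg_of_ne_zero (hpos hx) hx0
        have h1 := hmem s hs x hx hx0
        have h2 : (∑ v, x v)⁻¹ • x ∈ K.realization := by
          rw [← hTX]; exact T.convexHull_subset_space hs h1
        simp only [f]
        rw [hlinG _ _ hsum.ne', he' _ h2, hG s hs ⟨_, h2⟩ h1]
  · intro x hx
    by_cases hx0 : x = 0
    · simp only [f, hx0]
      exact ⟨fun _ => by simp, Or.inl (by simp)⟩
    · simp only [f, he' _ (inv_sum_smul_mem_realization hx hx0)]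
      exact smul_mem_coneOver (Subtype.prop _) (sum_pos_of_nonneg_of_ne_zero hx.1 hx0).le
  -- The extension preserves the coordinate sum.
  · have hfsum : ∀ x ∈ coneOver K, ∑ v, f x v = ∑ v, x v := by
      intro x hx
      by_cases hx0 : x = 0
      · simp [f, hx0]
      · simp only [f, he' _ (inv_sum_smul_mem_realization hx hx0), Pi.smul_apply, smul_eq_mul,
          ← Finset.mul_sum]
        rw [(mem_realization_iff.1 (Subtype.prop _)).2.2, mul_one]
    intro x hx y hy hxy
    have hsum : ∑ v, x v = ∑ v, y v := by rw [← hfsum x hx, hxy, hfsum y hy]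
    by_cases hx0 : x = 0
    · by_contra hne
      have hy0 : y ≠ 0 := fun h => hne (hx0.trans h.symm)
      have := sum_pos_of_nonneg_of_ne_zero hy.1 hy0
      rw [← hsum, hx0] at this
      simp at this
    · have hsx := sum_pos_of_nonneg_of_ne_zero hx.1 hx0
      have hy0 : y ≠ 0 := by
        rintro rfl
        rw [hsum] at hsx
        simp at hsx
      have hmy := inv_sum_smul_mem_realization hy hy0
      simp only [f] at hxy
      rw [← hsum] at hxy hmy
      rw [he' _ (inv_sum_smul_mem_realization hx hx0), he' _ hmy] at hxy
      have h1 := e.injective (Subtype.ext (smul_right_injective _ hsx.ne' hxy))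
      exact smul_right_injective _ (inv_ne_zero hsx.ne') (Subtype.ext_iff.1 h1)
  · intro y hy
    by_cases hy0 : y = 0
    · exact ⟨0, ⟨fun _ => le_rfl, Or.inl rfl⟩, by simp [f, hy0]⟩
    · have hsum := sum_pos_of_nonneg_of_ne_zero hy.1 hy0
      let x := e.symm ⟨_, inv_sum_smul_mem_realization hy hy0⟩
      have hx1 : ∑ v, (x : V → ℝ) v = 1 := (mem_realization_iff.1 x.2).2.2
      refine ⟨(∑ v, y v) • (x : V → ℝ), smul_mem_coneOver x.2 hsum.le, ?_⟩
      have h1 : ∑ v, ((∑ v, y v) • (x : V → ℝ)) v = ∑ v, y v := by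
        simp only [Pi.smul_apply, smul_eq_mul, ← Finset.mul_sum, hx1, mul_one]
      simp only [f, h1]
      rw [inv_smul_smul₀ hsum.ne', he' _ x.2]
      simp only [Subtype.coe_eta, x, e.apply_symm_apply]
      rw [smul_inv_smul₀ hsum.ne']

theorem IsConewiseLinear.linearMap_comp {E F G : Type*} [NormedAddCommGroup E] [NormedSpace ℝ E]
    [NormedAddCommGroup F] [NormedSpace ℝ F] [NormedAddCommGroup G] [NormedSpace ℝ G] {S : Set E}
    {f : E → F} (hf : IsConewiseLinear S f) (A : F →ₗ[ℝ] G) : IsConewiseLinear S (A ∘ f) := by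
  obtain ⟨C, hC, hCfin, hCS, hfC⟩ := hf
  refine ⟨(fun c => (c.1, A ∘ₗ c.2)) '' C, hC.image _, ?_, ?_, ?_⟩
  · rintro _ ⟨c, hc, rfl⟩
    exact hCfin c hc
  · rw [hCS, Set.biUnion_image]
  · rintro _ ⟨c, hc, rfl⟩ x hx
    simp [hfC c hc x hx]

/-- The cone over a piecewise linear `(n - 1)`-sphere is mapped bijectively to `ℝ ^ n` by a conewise
linear map. -/
theorem exists_coneMap_euclideanSpace {K : PreAbstractSimplicialComplex V} {n : ℕ}
    (h : PLHomeomorphic K.realization (simplexBoundary n).realization) :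
    ∃ g : (V → ℝ) → EuclideanSpace ℝ (Fin n), IsConewiseLinear (coneOver K) g ∧
      Set.BijOn g (coneOver K) Set.univ := by
  obtain ⟨f, hf, hbij⟩ := exists_coneMap h
  exact ⟨_, hf.linearMap_comp (orthantProjection n), (bijOn_orthantProjection n).comp hbij⟩

/-- A conewise linear bijection from the cone over a complex to a vector space induces, by
normalization, a bijection from the realization to the unit sphere. -/
theorem bijOn_normalize {W : Type*} [NormedAddCommGroup W] [NormedSpace ℝ W]
    {K : PreAbstractSimplicialComplex V} {g : (V → ℝ) → W} (hg : IsConewiseLinear (coneOver K) g)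
    (hbij : Set.BijOn g (coneOver K) Set.univ) :
    ContinuousOn (fun x => ‖g x‖⁻¹ • g x) K.realization ∧
      Set.BijOn (fun x => ‖g x‖⁻¹ • g x) K.realization (Metric.sphere 0 1) := by
  have hsub := realization_subset_coneOver K
  have h0 : (0 : V → ℝ) ∈ coneOver K := ⟨fun _ => le_rfl, Or.inl rfl⟩
  have hg0 : g 0 = 0 := hg.map_zero h0
  have hne : ∀ x ∈ K.realization, g x ≠ 0 := fun x hx h => by
    have : x = 0 := hbij.injOn (hsub hx) h0 (h.trans hg0.symm)
    have h1 := (mem_realization_iff.1 hx).2.2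
    rw [this] at h1
    simp at h1
  have hc := hg.continuousOn.mono hsub
  refine ⟨(hc.norm.inv₀ fun x hx => norm_ne_zero_iff.2 (hne x hx)).smul hc, fun x hx => ?_,
    fun x hx y hy hxy => ?_, fun u hu => ?_⟩
  · have := hne x hx
    simp [norm_smul, this]
  · have hx0 := norm_pos_iff.2 (hne x hx)
    have hy0 := norm_pos_iff.2 (hne y hy)
    dsimp only at hxy
    rw [← hg.map_smul (hsub hx) (inv_nonneg.2 hx0.le),
      ← hg.map_smul (hsub hy) (inv_nonneg.2 hy0.le)] at hxy
    have h1 := hbij.injOn (hg.smul_mem (hsub hx) (inv_nonneg.2 hx0.le))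
      (hg.smul_mem (hsub hy) (inv_nonneg.2 hy0.le)) hxy
    -- Points of the realization on a common ray agree, as their coordinate sums are `1`.
    have h2 : ‖g x‖⁻¹ = ‖g y‖⁻¹ := by
      have := congrArg (fun z : V → ℝ => ∑ v, z v) h1
      simpa [← Finset.mul_sum, (mem_realization_iff.1 hx).2.2,
        (mem_realization_iff.1 hy).2.2] using this
    rw [← h2] at h1
    exact smul_right_injective _ (inv_ne_zero hx0.ne') h1
  · obtain ⟨x, hx, rfl⟩ := hbij.surjOn (Set.mem_univ u)
    have hu1 : ‖g x‖ = 1 := by simpa using hu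
    have hx0 : x ≠ 0 := by
      rintro rfl
      rw [hg0] at hu1
      simp at hu1
    have hsum := sum_pos_of_nonneg_of_ne_zero hx.1 hx0
    refine ⟨_, inv_sum_smul_mem_realization hx hx0, ?_⟩
    dsimp only
    rw [hg.map_smul hx (inv_nonneg.2 hsum.le), norm_smul, hu1, mul_one, Real.norm_of_nonneg
      (inv_nonneg.2 hsum.le), inv_smul_smul₀ (inv_ne_zero hsum.ne')]

end ConeMap

/-! ### Charts of balls -/

section Chart

/-- The inverse of a continuous injection of a compact set into a Hausdorff space is continuous. -/
theorem continuousOn_of_leftInvOn {X Y : Type*} [TopologicalSpace X] [TopologicalSpace Y]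
    [T2Space Y] {f : X → Y} {g : Y → X} {A : Set X} (hA : IsCompact A) (hf : ContinuousOn f A)
    (hg : Set.LeftInvOn g f A) : ContinuousOn g (f '' A) := by
  rw [continuousOn_iff_isClosed]
  intro t ht
  refine ⟨f '' (A ∩ t), ((hA.inter_right ht).image_of_continuousOn
    (hf.mono Set.inter_subset_left)).isClosed, ?_⟩
  ext y
  constructor
  · rintro ⟨hy, x, hx, rfl⟩
    exact ⟨⟨x, ⟨hx, by rwa [Set.mem_preimage, hg hx] at hy⟩, rfl⟩, x, hx, rfl⟩
  · rintro ⟨⟨x, ⟨hx, hxt⟩, rfl⟩, -⟩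
    exact ⟨by rwa [Set.mem_preimage, hg hx], x, hx, rfl⟩

/-- A positively homogeneous continuous bijection from a closed cone in the positive orthant to
`ℝ ^ m` gives a parametrization of the truncated cone by the unit ball: the bijection is rescaled
along rays so that the norm of the image is the coordinate sum. -/
theorem exists_ball_chart {V : Type*} [Fintype V] {S : Set (V → ℝ)} (hS : IsClosed S)
    (hnn : ∀ z ∈ S, ∀ v, 0 ≤ z v) (hsmul : ∀ z ∈ S, ∀ r : ℝ, 0 ≤ r → r • z ∈ S) {m : ℕ}
    {h : (V → ℝ) → (Fin m → ℝ)} (hcont : ContinuousOn h S) (hbij : Set.BijOn h S Set.univ)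
    (hhom : ∀ z ∈ S, ∀ r : ℝ, 0 ≤ r → h (r • z) = r • h z) :
    ∃ χ : (Fin m → ℝ) → (V → ℝ), ContinuousOn χ (Metric.closedBall 0 1) ∧
      Set.BijOn χ (Metric.closedBall 0 1) {z ∈ S | ∑ v, z v ≤ 1} ∧
      Set.BijOn χ (Metric.ball 0 1) {z ∈ S | ∑ v, z v < 1} := by
  obtain ⟨z₀, hz₀, -⟩ := hbij.surjOn (Set.mem_univ 0)
  have h0S : (0 : V → ℝ) ∈ S := by simpa using hsmul z₀ hz₀ 0 le_rfl
  have hh0 : h 0 = 0 := by simpa using hhom z₀ hz₀ 0 le_rfl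
  have hne : ∀ z ∈ S, z ≠ 0 → 0 < ‖h z‖ := fun z hz hz0 =>
    norm_pos_iff.2 fun hhz => hz0 (hbij.injOn hz h0S (hhz.trans hh0.symm))
  have hspos : ∀ z ∈ S, z ≠ 0 → 0 < ∑ v, z v := fun z hz hz0 =>
    sum_pos_of_nonneg_of_ne_zero (hnn z hz) hz0
  -- The norm of `β z` is the coordinate sum of `z`, so `β` takes the truncated cone to the ball.
  let β : (V → ℝ) → (Fin m → ℝ) := fun z => ((∑ v, z v) * ‖h z‖⁻¹) • h z
  have hβ0 : β 0 = 0 := by simp [β]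
  have hβnorm : ∀ z ∈ S, ‖β z‖ = ∑ v, z v := by
    intro z hz
    by_cases hz0 : z = 0
    · simp [hz0, hβ0]
    · have h1 := hne z hz hz0
      have h2 := hspos z hz hz0
      simp only [β, norm_smul, norm_mul, norm_inv, norm_norm, Real.norm_of_nonneg h2.le]
      field_simp
  have hβbij : Set.BijOn β S Set.univ := by
    refine ⟨fun _ _ => trivial, fun z hz z' hz' hzz' => ?_, fun u _ => ?_⟩
    · have hs : ∑ v, z v = ∑ v, z' v := by rw [← hβnorm z hz, hzz', hβnorm z' hz']
      by_cases hz0 : z = 0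
      · by_contra hcon
        have := hspos z' hz' fun h => hcon (hz0.trans h.symm)
        rw [← hs, hz0] at this
        simp at this
      · have hsz := hspos z hz hz0
        have hz0' : z' ≠ 0 := by
          rintro rfl
          rw [hs] at hsz
          simp at hsz
        have h1 := hne z hz hz0
        have h2 := hne z' hz' hz0'
        have hzz'' : h (‖h z‖⁻¹ • z) = h (‖h z'‖⁻¹ • z') := by
          simp only [β, ← hs, mul_smul] at hzz'
          rw [hhom z hz _ (inv_nonneg.2 h1.le), hhom z' hz' _ (inv_nonneg.2 h2.le)]
          exact smul_right_injective _ hsz.ne' hzz'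
        have h3 := hbij.injOn (hsmul z hz _ (inv_nonneg.2 h1.le))
          (hsmul z' hz' _ (inv_nonneg.2 h2.le)) hzz''
        have h4 := congrArg (fun y : V → ℝ => ∑ v, y v) h3
        simp only [Pi.smul_apply, smul_eq_mul, ← Finset.mul_sum, ← hs] at h4
        rw [← mul_right_cancel₀ hsz.ne' h4] at h3
        exact smul_right_injective _ (inv_ne_zero h1.ne') h3
    · by_cases hu : u = 0
      · exact ⟨0, h0S, hβ0.trans hu.symm⟩
      · obtain ⟨z, hz, rfl⟩ := hbij.surjOn (Set.mem_univ u)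
        have hz0 : z ≠ 0 := fun h => hu (by rw [h, hh0])
        have h1 := hne z hz hz0
        have h2 := hspos z hz hz0
        have h3 : 0 < ‖h z‖ / ∑ v, z v := div_pos h1 h2
        refine ⟨(‖h z‖ / ∑ v, z v) • z, hsmul z hz _ h3.le, ?_⟩
        simp only [β, hhom z hz _ h3.le, Pi.smul_apply, smul_eq_mul, ← Finset.mul_sum, norm_smul,
          Real.norm_of_nonneg h3.le, smul_smul]
        convert one_smul ℝ (h z)
        field_simp
  have hβcont : ContinuousOn β S := by
    intro z hz
    by_cases hz0 : z = 0
    · subst hz0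
      rw [ContinuousWithinAt, hβ0, tendsto_zero_iff_norm_tendsto_zero]
      have h1 : Filter.Tendsto (fun z : V → ℝ => ∑ v, z v) (nhdsWithin 0 S) (nhds 0) := by
        have hc : Continuous fun z : V → ℝ => ∑ v, z v := by fun_prop
        have := hc.tendsto 0
        simp only [Pi.zero_apply, Finset.sum_const_zero] at this
        exact this.mono_left nhdsWithin_le_nhds
      exact h1.congr' (Filter.eventuallyEq_of_mem self_mem_nhdsWithin fun z hz => (hβnorm z hz).symm)
    · have hc : Continuous fun z : V → ℝ => ∑ v, z v := by fun_prop
      exact (hc.continuousWithinAt.mul ((hcont z hz).norm.inv₀ (hne z hz hz0).ne')).smul (hcont z hz)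
  let χ := Function.invFunOn β S
  have hinv : Set.InvOn χ β S Set.univ := hβbij.invOn_invFunOn
  have hχ : ∀ u, χ u ∈ S := fun u => Function.invFunOn_mem (hβbij.surjOn (Set.mem_univ u))
  have hχsum : ∀ u, ∑ v, χ u v = ‖u‖ := fun u => by
    rw [← hβnorm _ (hχ u), hinv.2 (Set.mem_univ u)]
  have hχinj : Function.Injective χ := fun u u' huu' => by
    rw [← hinv.2 (Set.mem_univ u), huu', hinv.2 (Set.mem_univ u')]
  refine ⟨χ, ?_, ⟨fun u hu => ⟨hχ u, ?_⟩, hχinj.injOn, ?_⟩,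
    ⟨fun u hu => ⟨hχ u, ?_⟩, hχinj.injOn, ?_⟩⟩
  · have hcompact : IsCompact {z ∈ S | ∑ v, z v ≤ 1} := by
      refine Metric.isCompact_of_isClosed_isBounded
        (hS.inter (isClosed_le (f := fun z : V → ℝ => ∑ v, z v) (by fun_prop)
          continuous_const)) ?_
      refine (Metric.isBounded_closedBall (x := 0) (r := 1)).subset fun z hz => ?_
      rw [mem_closedBall_zero_iff, pi_norm_le_iff_of_nonneg zero_le_one]
      intro v
      rw [Real.norm_of_nonneg (hnn z hz.1 v)]
      exact (Finset.single_le_sum (fun w _ => hnn z hz.1 w) (Finset.mem_univ v)).trans hz.2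
    have := continuousOn_of_leftInvOn hcompact (hβcont.mono fun z hz => hz.1)
      (hinv.1.mono fun z hz => hz.1)
    -- `χ` is continuous on the image of the compact truncated cone under `β`, which is the ball.
    refine this.mono fun u hu => ⟨χ u, ⟨hχ u, ?_⟩, hinv.2 (Set.mem_univ u)⟩
    rw [hχsum]; simpa using hu
  · rw [hχsum]; simpa using hu
  · rintro z ⟨hz, hz1⟩
    refine ⟨β z, ?_, hinv.1 hz⟩
    rw [mem_closedBall_zero_iff, hβnorm z hz]; exact hz1
  · rw [hχsum]; simpa using hu
  · rintro z ⟨hz, hz1⟩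
    refine ⟨β z, ?_, hinv.1 hz⟩
    rw [mem_ball_zero_iff, hβnorm z hz]; exact hz1

end Chart

/-! ### Regular CW complexes from posets -/

section CWStructure

open Metric Set

/-- A regular CW structure from a finite poset of closed cells, each parametrized by a closed ball
such that the boundary is covered by smaller cells. -/
theorem exists_CWComplex_of_cells {X : Type} [TopologicalSpace X] [T2Space X] {C : Set X}
    {Q : Type*} [Finite Q] [PartialOrder Q] {dim : Q → ℕ} (hdim : StrictMono dim) (e o : Q → Set X)
    (hchart : ∀ q, ∃ χ : (Fin (dim q) → ℝ) → X, ContinuousOn χ (closedBall 0 1) ∧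
      BijOn χ (closedBall 0 1) (e q) ∧ BijOn χ (ball 0 1) (o q))
    (hdisj : ∀ q q', q ≠ q' → Disjoint (o q) (o q'))
    (hboundary : ∀ q, e q ⊆ o q ∪ ⋃ q' < q, e q') (hunion : ⋃ q, e q = C) :
    ∃ _ : Topology.CWComplex C, IsRegularCW C ∧ closedCells C = Set.range e := by
  classical
  obtain ⟨N, ⟨enum⟩⟩ := Finite.exists_equiv_fin Q
  -- The cells have to be indexed by a type in the universe of `X`.
  let cell : ℕ → Type := fun m => {i : Fin N // dim (enum.symm i) = m}
  have hchart' : ∀ (m : ℕ) (i : cell m), ∃ χ : (Fin m → ℝ) → X, ContinuousOn χ (closedBall 0 1) ∧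
      BijOn χ (closedBall 0 1) (e (enum.symm i.1)) ∧ BijOn χ (ball 0 1) (o (enum.symm i.1)) := by
    rintro _ ⟨i, rfl⟩
    exact hchart _
  choose χ hcont hclosed hopen using hchart'
  let map : (m : ℕ) → cell m → PartialEquiv (Fin m → ℝ) X := fun m i =>
    { toFun := χ m i
      invFun := Function.invFunOn (χ m i) (closedBall 0 1)
      source := ball 0 1
      target := o (enum.symm i.1)
      map_source' := (hopen m i).mapsTo
      map_target' := fun x hx => by
        obtain ⟨u, hu, rfl⟩ := (hopen m i).surjOn hx
        rwa [(hclosed m i).injOn.leftInvOn_invFunOn (ball_subset_closedBall hu)]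
      left_inv' := fun u hu =>
        (hclosed m i).injOn.leftInvOn_invFunOn (ball_subset_closedBall hu)
      right_inv' := fun x hx => by
        obtain ⟨u, hu, rfl⟩ := (hopen m i).surjOn hx
        rw [(hclosed m i).injOn.leftInvOn_invFunOn (ball_subset_closedBall hu)] }
  have himage : ∀ m i, map m i '' closedBall 0 1 = e (enum.symm i.1) := fun m i =>
    (hclosed m i).image_eq
  have himage' : ∀ m i, map m i '' ball 0 1 = o (enum.symm i.1) := fun m i =>
    (hopen m i).image_eq
  let cw : Topology.CWComplex C := Topology.CWComplex.mkFinite C cell map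
    (by
      obtain ⟨b, hb⟩ := (Set.finite_range dim).bddAbove
      filter_upwards [Filter.eventually_gt_atTop b] with m hm
      exact ⟨fun i => absurd (hb ⟨enum.symm i.1, i.2⟩) (not_le.2 hm)⟩)
    (fun m => Subtype.finite)
    (fun m i => rfl) (fun m i => hcont m i)
    (fun m i => (continuousOn_of_leftInvOn (isCompact_closedBall _ _) (hcont m i)
      (hclosed m i).injOn.leftInvOn_invFunOn).mono
        (by rw [(hclosed m i).image_eq]
            exact fun x hx => by
              obtain ⟨u, hu, rfl⟩ := (hopen m i).surjOn hx
              exact (hclosed m i).mapsTo (ball_subset_closedBall hu)))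
    (by
      rintro ⟨m, i⟩ - ⟨m', i'⟩ - hne
      show Disjoint (map m i '' ball 0 1) (map m' i' '' ball 0 1)
      rw [himage', himage']
      refine hdisj _ _ fun h => hne ?_
      obtain ⟨i, rfl⟩ := i
      obtain ⟨i', rfl⟩ := i'
      obtain rfl := enum.symm.injective h
      rfl)
    (by
      intro m i u hu
      have hmem : χ m i u ∈ e (enum.symm i.1) := (hclosed m i).mapsTo (sphere_subset_closedBall hu)
      rcases hboundary _ hmem with h | h
      · obtain ⟨u', hu', huu'⟩ := (hopen m i).surjOn h
        have : u' = u := (hclosed m i).injOn (ball_subset_closedBall hu')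
          (sphere_subset_closedBall hu) huu'
        subst this
        exact absurd (mem_sphere.1 hu) (ne_of_lt (mem_ball.1 hu'))
      · simp only [mem_iUnion] at h ⊢
        obtain ⟨q', hq', h⟩ := h
        refine ⟨dim q', by rw [← i.2]; exact hdim hq', ⟨enum q', by simp⟩, ?_⟩
        rw [himage]
        simpa using h)
    (by
      rw [← hunion]
      ext x
      simp only [mem_iUnion, himage]
      constructor
      · rintro ⟨m, i, hx⟩
        exact ⟨_, hx⟩
      · rintro ⟨q, hx⟩
        exact ⟨dim q, ⟨enum q, by simp⟩, by simpa using hx⟩)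
  refine ⟨cw, fun m i => (hclosed m i).injOn, ?_⟩
  ext s
  constructor
  · rintro ⟨m, i, rfl⟩
    exact ⟨enum.symm i.1, (himage m i).symm⟩
  · rintro ⟨q, rfl⟩
    refine ⟨dim q, (⟨enum q, by simp⟩ : cell (dim q)), ?_⟩
    refine Eq.trans ?_ (himage (dim q) ⟨enum q, by simp⟩).symm
    simp

end CWStructure

/-! ### The cells of a piecewise linear sphere -/

section OrderComplexCells

variable {Q : Type*} [PartialOrder Q]

/-- The points of the order complex which are supported on elements below `q`: a cone with apex
`q`. -/
def orderCell (q : Q) : Set (Q → ℝ) :=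
  {x ∈ (orderComplex Q).realization | ∀ v, x v ≠ 0 → v ≤ q}

/-- The points of the order complex whose support has largest element `q`. -/
def openOrderCell (q : Q) : Set (Q → ℝ) :=
  {x ∈ orderCell q | x q ≠ 0}

theorem orderCell_mono {q q' : Q} (h : q ≤ q') : orderCell q ⊆ orderCell q' := fun _ hx =>
  ⟨hx.1, fun v hv => (hx.2 v hv).trans h⟩

theorem disjoint_openOrderCell {q q' : Q} (h : q ≠ q') :
    Disjoint (openOrderCell q) (openOrderCell q') := by
  rw [Set.disjoint_left]
  intro x hx hx'
  exact h (le_antisymm (hx'.1.2 q hx.2) (hx.1.2 q' hx'.2))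

variable [Fintype Q]

theorem single_mem_orderCell [DecidableEq Q] (q : Q) : Pi.single q (1 : ℝ) ∈ orderCell q := by
  have hsupp : ∀ v, (Pi.single q (1 : ℝ) : Q → ℝ) v ≠ 0 → v = q := fun v hv => by
    by_contra h
    simp [h] at hv
  refine ⟨mem_realization_iff.2 ⟨fun v => ?_, ⟨⟨q, by simp⟩, ?_⟩, by simp⟩, fun v hv =>
    (hsupp v hv).le⟩
  · by_cases h : v = q <;> simp [h]
  · intro v hv w hw hne
    exact absurd ((hsupp v (by simpa using hv)).trans (hsupp w (by simpa using hw)).symm) hne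

theorem orderCell_subset_iff {q q' : Q} : orderCell q ⊆ orderCell q' ↔ q ≤ q' := by
  classical
  exact ⟨fun h => (h (single_mem_orderCell q)).2 q (by simp), orderCell_mono⟩

theorem exists_mem_openOrderCell {x : Q → ℝ} (hx : x ∈ (orderComplex Q).realization) :
    ∃ q, x ∈ openOrderCell q := by
  obtain ⟨-, ⟨⟨v, hv⟩, hchain⟩, -⟩ := mem_realization_iff.1 hx
  obtain ⟨q, hq, hmax⟩ := (coordSupport x).exists_maximal ⟨v, hv⟩
  refine ⟨q, ⟨hx, fun v hv => ?_⟩, by simpa using hq⟩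
  rcases hchain.total (by simpa using hv : v ∈ (coordSupport x : Set Q)) hq with h | h
  · exact h
  · exact hmax (by simpa using hv) h

/-- A longest chain with smallest element `q`. -/
theorem exists_longest_chain_above (q : Q) : ∃ c : Finset Q, q ∈ c ∧ (∀ v ∈ c, q ≤ v) ∧
    IsChain (· ≤ ·) (c : Set Q) ∧ ∀ c' : Finset Q, q ∈ c' → (∀ v ∈ c', q ≤ v) →
      IsChain (· ≤ ·) (c' : Set Q) → c'.card ≤ c.card := by
  classical
  obtain ⟨c, hc, hmax⟩ := Finset.exists_max_image
    (Finset.univ.filter fun c : Finset Q => q ∈ c ∧ (∀ v ∈ c, q ≤ v) ∧ IsChain (· ≤ ·) (c : Set Q))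
    Finset.card ⟨{q}, by simp⟩
  simp only [Finset.mem_filter, Finset.mem_univ, true_and] at hc hmax
  exact ⟨c, hc.1, hc.2.1, hc.2.2, fun c' h1 h2 h3 => hmax c' ⟨h1, h2, h3⟩⟩

/-- The link of a longest chain with smallest element `q` consists of the chains strictly
below `q`. -/
theorem mem_linkCone_iff {q : Q} {c : Finset Q} (hq : q ∈ c) (hqc : ∀ v ∈ c, q ≤ v)
    (hc : IsChain (· ≤ ·) (c : Set Q)) (hmax : ∀ c' : Finset Q, q ∈ c' → (∀ v ∈ c', q ≤ v) →
      IsChain (· ≤ ·) (c' : Set Q) → c'.card ≤ c.card) {z : Q → ℝ} :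
    z ∈ linkCone (orderComplex Q) c ↔ (∀ v, 0 ≤ z v) ∧ (∀ v, z v ≠ 0 → v < q) ∧
      ∀ v w, z v ≠ 0 → z w ≠ 0 → v ≤ w ∨ w ≤ v := by
  classical
  constructor
  · rintro ⟨h1, h2, u, ⟨-, hu⟩, hcu, hzu⟩
    refine ⟨h1, fun v hv => ?_, fun v w hv hw => hu.total (hzu v hv) (hzu w hw)⟩
    have hvc : v ∉ c := fun h => hv (h2 v h)
    rcases hu.total (hzu v hv) (hcu hq) with h | h
    · exact lt_of_le_of_ne h fun hvq => hvc (hvq ▸ hq)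
    · have := hmax (insert v c) (Finset.mem_insert_of_mem hq)
        (fun w hw => (Finset.mem_insert.1 hw).elim (fun hw => hw ▸ h) (hqc w))
        (hu.mono fun w hw => by
          rcases Finset.mem_insert.1 hw with rfl | hw
          · exact hzu w hv
          · exact hcu hw)
      rw [Finset.card_insert_of_notMem hvc] at this
      omega
  · rintro ⟨h1, h2, h3⟩
    refine ⟨h1, fun v hv => ?_, coordSupport z ∪ c, ⟨⟨q, Finset.mem_union_right _ hq⟩, ?_⟩,
      Finset.subset_union_right, fun v hv => Finset.mem_union_left _ (by simpa using hv)⟩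
    · by_contra h
      exact absurd (h2 v h) (not_lt_of_ge (hqc v hv))
    · intro v hv w hw _
      show v ≤ w ∨ w ≤ v
      simp only [Finset.coe_union, Set.mem_union, Finset.mem_coe, mem_coordSupport] at hv hw
      rcases hv with hv | hv <;> rcases hw with hw | hw
      · exact h3 v w hv hw
      · exact Or.inl ((h2 v hv).le.trans (hqc w hw))
      · exact Or.inr ((h2 w hw).le.trans (hqc v hv))
      · exact hc.total hv hw

/-- The cell of `q` is the join of `q` with the link of a longest chain above `q`. -/
theorem bijOn_join [DecidableEq Q] {q : Q} {S : Set (Q → ℝ)}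
    (hS : ∀ z, z ∈ S ↔ (∀ v, 0 ≤ z v) ∧ (∀ v, z v ≠ 0 → v < q) ∧
      ∀ v w, z v ≠ 0 → z w ≠ 0 → v ≤ w ∨ w ≤ v) :
    Set.BijOn (fun z : Q → ℝ => z + (1 - ∑ v, z v) • Pi.single q 1) {z ∈ S | ∑ v, z v ≤ 1}
      (orderCell q) ∧
    Set.BijOn (fun z : Q → ℝ => z + (1 - ∑ v, z v) • Pi.single q 1) {z ∈ S | ∑ v, z v < 1}
      (openOrderCell q) := by
  let f : (Q → ℝ) → (Q → ℝ) := fun z => z + (1 - ∑ v, z v) • Pi.single q 1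
  have hzq : ∀ z ∈ S, z q = 0 := fun z hz => by
    by_contra h
    exact lt_irrefl _ (((hS z).1 hz).2.1 q h)
  have hfq : ∀ z ∈ S, f z q = 1 - ∑ v, z v := fun z hz => by simp [f, hzq z hz]
  have hfv : ∀ z v, v ≠ q → f z v = z v := fun z v hv => by simp [f, hv]
  have hmaps : ∀ z ∈ S, ∑ v, z v ≤ 1 → f z ∈ orderCell q := by
    intro z hz hz1
    obtain ⟨h1, h2, h3⟩ := (hS z).1 hz
    have hsupp : ∀ v, f z v ≠ 0 → v = q ∨ z v ≠ 0 := fun v hv => by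
      by_cases h : v = q
      · exact Or.inl h
      · exact Or.inr (by rwa [hfv z v h] at hv)
    have hsum : ∑ v, f z v = 1 := by
      simp [f, Finset.sum_add_distrib, ← Finset.mul_sum]
    refine ⟨mem_realization_iff.2 ⟨fun v => ?_, ⟨?_, ?_⟩, hsum⟩, fun v hv => ?_⟩
    · by_cases h : v = q
      · rw [h, hfq z hz]; linarith
      · rw [hfv z v h]; exact h1 v
    · obtain ⟨v, -, hv⟩ := Finset.exists_ne_zero_of_sum_ne_zero (hsum.trans_ne one_ne_zero)
      exact ⟨v, by simpa using hv⟩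
    · intro v hv w hw _
      show v ≤ w ∨ w ≤ v
      rcases hsupp v (by simpa using hv) with rfl | hv' <;>
        rcases hsupp w (by simpa using hw) with rfl | hw'
      · exact Or.inl le_rfl
      · exact Or.inr (h2 w hw').le
      · exact Or.inl (h2 v hv').le
      · exact h3 v w hv' hw'
    · rcases hsupp v hv with rfl | hv
      · exact le_rfl
      · exact (h2 v hv).le
  have hinj : Set.InjOn f S := by
    intro z hz z' hz' hzz'
    ext v
    by_cases h : v = q
    · rw [h, hzq z hz, hzq z' hz']
    · rw [← hfv z v h, hzz', hfv z' v h]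
  have hsurj : ∀ x ∈ orderCell q, ∃ z ∈ S, ∑ v, z v = 1 - x q ∧ f z = x := by
    rintro x ⟨hx, hxq⟩
    obtain ⟨h1, ⟨-, h2⟩, h3⟩ := mem_realization_iff.1 hx
    let z := x - x q • Pi.single q (1 : ℝ)
    have hzqq : z q = 0 := by simp [z]
    have hzv : ∀ v, v ≠ q → z v = x v := fun v hv => by simp [z, hv]
    have hne : ∀ v, z v ≠ 0 → v ≠ q ∧ x v ≠ 0 := fun v hv => by
      have : v ≠ q := fun h => hv (h ▸ hzqq)
      exact ⟨this, by rwa [hzv v this] at hv⟩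
    have hsum : ∑ v, z v = 1 - x q := by simp [z, Finset.sum_sub_distrib, h3, ← Finset.mul_sum]
    refine ⟨z, (hS z).2 ⟨fun v => ?_, fun v hv => ?_, fun v w hv hw => ?_⟩, hsum, ?_⟩
    · by_cases h : v = q
      · rw [h, hzqq]
      · rw [hzv v h]; exact h1 v
    · exact lt_of_le_of_ne (hxq v (hne v hv).2) (hne v hv).1
    · exact h2.total (by simpa using (hne v hv).2) (by simpa using (hne w hw).2)
    · simp only [f, hsum]
      simp [z]
  refine ⟨⟨fun z hz => hmaps z hz.1 hz.2, hinj.mono fun z hz => hz.1, fun x hx => ?_⟩,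
    ⟨fun z hz => ⟨hmaps z hz.1 hz.2.le, ?_⟩, hinj.mono fun z hz => hz.1, fun x hx => ?_⟩⟩
  · obtain ⟨z, hz, hsum, hzx⟩ := hsurj x hx
    exact ⟨z, ⟨hz, by rw [hsum]; linarith [(mem_realization_iff.1 hx.1).1 q]⟩, hzx⟩
  · have h1 : ∑ v, z v < 1 := hz.2
    have h2 := hfq z hz.1
    show f z q ≠ 0
    rw [h2]
    exact (sub_pos.2 h1).ne'
  · obtain ⟨z, hz, hsum, hzx⟩ := hsurj x hx.1
    have h1 : 0 < x q := lt_of_le_of_ne ((mem_realization_iff.1 hx.1.1).1 q) hx.2.symm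
    exact ⟨z, ⟨hz, by rw [hsum]; linarith⟩, hzx⟩

/-- If the order complex of a finite poset is a piecewise linear sphere, then the poset is the face
poset of a regular CW decomposition of the sphere. -/
theorem exists_CWComplex_of_plSphere {n : ℕ}
    (h : PLHomeomorphic (orderComplex Q).realization (simplexBoundary n).realization) :
    ∃ (e : Q → Set (EuclideanSpace ℝ (Fin n)))
      (_ : Topology.CWComplex (Metric.sphere (0 : EuclideanSpace ℝ (Fin n)) 1)),
      IsRegularCW (Metric.sphere (0 : EuclideanSpace ℝ (Fin n)) 1) ∧
      closedCells (Metric.sphere (0 : EuclideanSpace ℝ (Fin n)) 1) = Set.range e ∧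
      (∀ q q', e q ⊆ e q' ↔ q ≤ q') ∧
      ∀ q q', e q ∩ e q' ⊆ ⋃ r ∈ {r | r ≤ q ∧ r ≤ q'}, e r := by
  classical
  obtain ⟨g, hg, hbij⟩ := exists_coneMap_euclideanSpace h
  obtain ⟨hcont, hΨ⟩ := bijOn_normalize hg hbij
  set Ψ : (Q → ℝ) → EuclideanSpace ℝ (Fin n) := fun x => ‖g x‖⁻¹ • g x
  choose c hqc hcq hchain hmax using exists_longest_chain_above (Q := Q)
  have hface : ∀ q, c q ∈ (orderComplex Q).faces := fun q => ⟨⟨q, hqc q⟩, hchain q⟩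
  choose dim hdim k hk hkbij hkhom using fun q => exists_bijOn_linkCone hg hbij (hface q)
  -- A longest chain above `q'` is extended by any `q < q'`, and `dim q` is `n` minus the length.
  have hmono : StrictMono dim := by
    intro q q' hqq'
    have hnotMem : q ∉ c q' := fun h => absurd (hcq q' q h) (not_le_of_gt hqq')
    have h1 := hmax q (insert q (c q')) (Finset.mem_insert_self _ _)
      (fun v hv => (Finset.mem_insert.1 hv).elim (fun h => h ▸ le_rfl)
        fun h => hqq'.le.trans (hcq q' v h))
      (by
        rw [Finset.coe_insert]
        exact (hchain q').insert fun v hv _ => Or.inl (hqq'.le.trans (hcq q' v hv)))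
    rw [Finset.card_insert_of_notMem hnotMem] at h1
    have := hdim q
    have := hdim q'
    omega
  have hsub : ∀ q : Q, orderCell q ⊆ (orderComplex Q).realization := fun q x hx => hx.1
  have hosub : ∀ q : Q, openOrderCell q ⊆ orderCell q := fun q x hx => hx.1
  obtain ⟨cw, hreg, hcells⟩ := exists_CWComplex_of_cells
    (C := Metric.sphere (0 : EuclideanSpace ℝ (Fin n)) 1) hmono
    (fun q => Ψ '' orderCell q) (fun q => Ψ '' openOrderCell q)
    (fun q => by
      obtain ⟨χ, hχ, hχc, hχo⟩ := exists_ball_chart (isClosed_linkCone _ (c q))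
        (fun z hz => hz.1) (fun z hz r hr => smul_mem_linkCone hz hr) (hk q) (hkbij q) (hkhom q)
      obtain ⟨hjc, hjo⟩ := bijOn_join (q := q) (S := linkCone (orderComplex Q) (c q))
        fun z => mem_linkCone_iff (hqc q) (hcq q) (hchain q) (hmax q)
      have hjcont : Continuous fun z : Q → ℝ => z + (1 - ∑ v, z v) • (Pi.single q 1 : Q → ℝ) := by
        fun_prop
      exact ⟨_, hcont.comp (hjcont.comp_continuousOn hχ)
          ((hjc.mapsTo.comp hχc.mapsTo).mono_right (hsub q)),
        (((hΨ.injOn.mono (hsub q)).bijOn_image).comp hjc).comp hχc,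
        (((hΨ.injOn.mono ((hosub q).trans (hsub q))).bijOn_image).comp hjo).comp hχo⟩)
    (fun q q' hqq' => by
      rw [Set.disjoint_left]
      rintro _ ⟨x, hx, rfl⟩ ⟨x', hx', hxx'⟩
      rw [hΨ.injOn (hsub q' (hosub q' hx')) (hsub q (hosub q hx)) hxx'] at hx'
      exact Set.disjoint_left.1 (disjoint_openOrderCell hqq') hx hx')
    (by
      rintro q _ ⟨x, hx, rfl⟩
      obtain ⟨r, hr⟩ := exists_mem_openOrderCell hx.1
      rcases (hx.2 r hr.2).eq_or_lt with rfl | hlt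
      · exact Or.inl ⟨x, hr, rfl⟩
      · exact Or.inr (Set.mem_biUnion hlt ⟨x, hr.1, rfl⟩))
    (by
      rw [← Set.image_iUnion, ← hΨ.image_eq]
      congr 1
      ext x
      simp only [Set.mem_iUnion]
      exact ⟨fun ⟨q, hq⟩ => hq.1, fun hx => (exists_mem_openOrderCell hx).imp fun q hq => hq.1⟩)
  refine ⟨_, cw, hreg, hcells, fun q q' => ?_, fun q q' => ?_⟩
  · rw [hΨ.injOn.image_subset_image_iff (hsub q) (hsub q'), orderCell_subset_iff]
  · rw [← hΨ.injOn.image_inter (hsub q) (hsub q')]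
    rintro _ ⟨x, ⟨hx, hx'⟩, rfl⟩
    obtain ⟨r, hr⟩ := exists_mem_openOrderCell hx.1
    exact Set.mem_biUnion (show r ∈ {r | r ≤ q ∧ r ≤ q'} from ⟨hx.2 r hr.2, hx'.2 r hr.2⟩)
      ⟨x, hr.1, rfl⟩

end OrderComplexCells

/-! ### Order isomorphisms and face lattices -/

section OrderIso

theorem mapsTo_funLeft {P Q : Type*} [PartialOrder P] [PartialOrder Q] [Finite P] [Finite Q]
    (e : P ≃o Q) : Set.MapsTo (LinearMap.funLeft ℝ ℝ e.symm) (orderComplex P).realization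
      (orderComplex Q).realization := by
  have := Fintype.ofFinite P
  have := Fintype.ofFinite Q
  intro x hx
  rw [mem_realization_iff] at hx ⊢
  obtain ⟨h1, ⟨⟨v, hv⟩, h2⟩, h3⟩ := hx
  refine ⟨fun v => h1 _, ⟨⟨e v, ?_⟩, fun v hv w hw _ => ?_⟩, ?_⟩
  · simpa [LinearMap.funLeft] using hv
  · have hv' : e.symm v ∈ coordSupport x := by simpa [LinearMap.funLeft] using hv
    have hw' : e.symm w ∈ coordSupport x := by simpa [LinearMap.funLeft] using hw
    simpa using h2.total hv' hw'
  · rw [← h3]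
    exact e.symm.toEquiv.sum_comp x

/-- Isomorphic posets have linearly isomorphic order complexes. -/
theorem bijOn_funLeft {P Q : Type*} [PartialOrder P] [PartialOrder Q] [Finite P] [Finite Q]
    (e : P ≃o Q) : Set.BijOn (LinearMap.funLeft ℝ ℝ e.symm) (orderComplex P).realization
      (orderComplex Q).realization := by
  refine ⟨mapsTo_funLeft e, ?_, fun y hy => ?_⟩
  · exact (LinearMap.funLeft_injective_of_surjective ℝ ℝ _ e.symm.surjective).injOn
  · refine ⟨_, mapsTo_funLeft e.symm hy, ?_⟩
    ext v
    simp [LinearMap.funLeft]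

/-- An order embedding which misses exactly the bottom and the top element. -/
noncomputable def orderIsoProperPart {P Q : Type*} [PartialOrder P] [PartialOrder Q]
    (f : Q ↪o P) (hf : ∀ x, (¬ IsBot x ∧ ¬ IsTop x) ↔ x ∈ Set.range f) : Q ≃o properPart P where
  toEquiv := Equiv.ofBijective (fun q => ⟨f q, (hf _).2 ⟨q, rfl⟩⟩)
    ⟨fun q q' h => f.injective (Subtype.ext_iff.1 h), fun ⟨x, hx⟩ => by
      obtain ⟨q, rfl⟩ := (hf x).1 hx
      exact ⟨q, rfl⟩⟩
  map_rel_iff' := f.le_iff_le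

theorem nonempty_orderIso_properPart {P Q : Type*} [PartialOrder P] [PartialOrder Q]
    (e : P ≃o WithTop (WithBot Q)) : Nonempty (Q ≃o properPart P) := by
  refine ⟨orderIsoProperPart
    ((WithBot.coeOrderHom.trans WithTop.coeOrderHom).trans e.symm.toOrderEmbedding) fun x => ?_⟩
  have h1 : IsBot x ↔ e x = ⊥ := by
    rw [← isBot_iff_eq_bot]
    exact ⟨fun h y => by simpa using e.monotone (h (e.symm y)), fun h y => e.le_iff_le.1 (h _)⟩
  have h2 : IsTop x ↔ e x = ⊤ := by
    rw [← isTop_iff_eq_top]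
    exact ⟨fun h y => by simpa using e.monotone (h (e.symm y)), fun h y => e.le_iff_le.1 (h _)⟩
  rw [h1, h2]
  constructor
  · rintro ⟨h3, h4⟩
    obtain ⟨y, hy⟩ := WithTop.ne_top_iff_exists.1 h4
    have hyb : y ≠ ⊥ := by
      rintro rfl
      exact h3 hy.symm
    obtain ⟨q, hq⟩ := WithBot.ne_bot_iff_exists.1 hyb
    refine ⟨q, ?_⟩
    show e.symm ((q : WithBot Q) : WithTop (WithBot Q)) = x
    rw [hq, hy, e.symm_apply_apply]
  · rintro ⟨q, rfl⟩
    show e (e.symm ((q : WithBot Q) : WithTop (WithBot Q))) ≠ ⊥ ∧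
      e (e.symm ((q : WithBot Q) : WithTop (WithBot Q))) ≠ ⊤
    rw [e.apply_symm_apply]
    refine ⟨fun h => ?_, WithTop.coe_ne_top⟩
    have h' : (q : WithBot Q) = ⊥ := WithTop.coe_injective h
    exact WithBot.coe_ne_bot h'

end OrderIso

section FaceLattice

theorem IsFaceLatticeOfStronglyRegularPLSphere.exists_plHomeomorphic {P : Type*} [PartialOrder P]
    [Finite P] (h : IsFaceLatticeOfStronglyRegularPLSphere P) :
    ∃ n, PLHomeomorphic (orderComplex (properPart P)).realization
      (simplexBoundary n).realization := by
  obtain ⟨n, cw, -, hPL, ⟨e⟩⟩ := h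
  obtain ⟨f⟩ := nonempty_orderIso_properPart e
  have : Finite (closedCells (Metric.sphere (0 : EuclideanSpace ℝ (Fin n)) 1)) :=
    Finite.of_injective f f.injective
  exact ⟨n, hPL.of_bijOn _ (bijOn_funLeft f.symm)⟩

/-- A finite poset in which bounded-below pairs have meets, and whose order complex is a piecewise
linear sphere, becomes the face lattice of a strongly regular sphere when a bottom and a top element
are adjoined. -/
theorem isFaceLatticeOfStronglyRegularPLSphere {P Q : Type*} [PartialOrder P] [PartialOrder Q]
    [Finite Q] {n : ℕ}
    (h : PLHomeomorphic (orderComplex Q).realization (simplexBoundary n).realization)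
    (hmeet : ∀ a b c : Q, c ≤ a → c ≤ b → ∃ m, m ≤ a ∧ m ≤ b ∧ ∀ d, d ≤ a → d ≤ b → d ≤ m)
    (e : P ≃o WithTop (WithBot Q)) : IsFaceLatticeOfStronglyRegularPLSphere P := by
  have := Fintype.ofFinite Q
  obtain ⟨cell, cw, hreg, hcells, hle, hinter⟩ := exists_CWComplex_of_plSphere h
  let f : Q ≃o closedCells (Metric.sphere (0 : EuclideanSpace ℝ (Fin n)) 1) :=
    { toEquiv := Equiv.ofBijective (fun q => ⟨cell q, by rw [hcells]; exact ⟨q, rfl⟩⟩)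
        ⟨fun q q' hqq' => by
          have h1 : cell q = cell q' := Subtype.ext_iff.1 hqq'
          exact le_antisymm ((hle q q').1 h1.le) ((hle q' q).1 h1.ge), fun ⟨s, hs⟩ => by
          rw [hcells] at hs
          obtain ⟨q, rfl⟩ := hs
          exact ⟨q, rfl⟩⟩
      map_rel_iff' := hle _ _ }
  have : Finite (closedCells (Metric.sphere (0 : EuclideanSpace ℝ (Fin n)) 1)) :=
    Finite.of_injective f.symm f.symm.injective
  refine ⟨n, cw, ⟨hreg, ?_⟩, h.of_bijOn _ (bijOn_funLeft f.symm),
    ⟨e.trans f.withBotCongr.withTopCongr⟩⟩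
  rw [hcells]
  rintro _ ⟨a, rfl⟩ _ ⟨b, rfl⟩
  rcases Set.eq_empty_or_nonempty (cell a ∩ cell b) with hempty | ⟨x, hx⟩
  · exact Or.inl hempty
  · right
    obtain ⟨c, ⟨hca, hcb⟩, -⟩ := Set.mem_iUnion₂.1 (hinter a b hx)
    obtain ⟨m, hma, hmb, hm⟩ := hmeet a b c hca hcb
    refine ⟨m, Set.Subset.antisymm (Set.subset_inter ((hle _ _).2 hma) ((hle _ _).2 hmb))
      ((hinter a b).trans (Set.iUnion₂_subset fun d hd => (hle _ _).2 (hm d hd.1 hd.2)))⟩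

end FaceLattice

section BierOrderIso

variable {P : Type*} [PartialOrder P] [BoundedOrder P] {I : Set P}

/-- The Bier poset consists of its proper part, the bottom interval `[⊥, ⊤]` and the top. -/
noncomputable def bierOrderIso (hbot : ⊥ ∈ I) (htop : ⊤ ∉ I) :
    Bier P I ≃o WithTop (WithBot (ProperBier I)) :=
  haveI hmin : ∀ b : BierInterval I, (⟨⊥, ⊤, hbot, htop, bot_le⟩ : BierInterval I) ≤ b :=
    fun _ => ⟨bot_le, le_top⟩
  let f : WithBot (ProperBier I) → BierInterval I := fun b =>
    b.recBotCoe ⟨⊥, ⊤, hbot, htop, bot_le⟩ Subtype.val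
  haveI hf : ∀ b c, f b ≤ f c ↔ b ≤ c := by
    intro b c
    induction b with
    | bot => exact iff_of_true (hmin _) bot_le
    | coe b =>
      induction c with
      | bot =>
        refine iff_of_false (fun h => b.2 ?_) (WithBot.not_coe_le_bot b)
        exact ⟨le_bot_iff.1 h.1, top_le_iff.1 h.2⟩
      | coe c => exact (WithBot.coe_le_coe (a := b) (b := c)).symm
  haveI hinj : Function.Injective f := fun b c h =>
    le_antisymm ((hf b c).1 h.le) ((hf c b).1 h.ge)
  haveI hsurj : Function.Surjective f := fun b => by
    by_cases hb : b.lo = ⊥ ∧ b.hi = ⊤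
    · exact ⟨⊥, BierInterval.ext hb.1.symm hb.2.symm⟩
    · exact ⟨((⟨b, hb⟩ : ProperBier I) : WithBot (ProperBier I)), rfl⟩
  let e : WithBot (ProperBier I) ≃o BierInterval I :=
    ⟨Equiv.ofBijective f ⟨hinj, hsurj⟩, fun {b c} => hf b c⟩
  e.symm.withTopCongr

end BierOrderIso

theorem mainTheorem5 {L : Type*} [Lattice L] [Finite L] (I : Set L) (hI : IsLowerSet I)
    (hI_nonempty : I.Nonempty) (hI_proper : I ≠ Set.univ) :
    PLHomeomorphic (orderComplex (properPart (Bier L I))).realization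
      (orderComplex (properPart L)).realization ∧
    (IsFaceLatticeOfStronglyRegularPLSphere L →
      IsFaceLatticeOfStronglyRegularPLSphere (Bier L I)) := by
  have := Fintype.ofFinite L
  have : Nonempty L := hI_nonempty.to_subtype.map Subtype.val
  let _ : BoundedOrder L := Fintype.toBoundedOrder L
  have hbot : ⊥ ∈ I := hI_nonempty.elim fun x hx => hI bot_le hx
  have htop : ⊤ ∉ I := fun h => hI_proper (Set.eq_univ_of_forall fun _ => hI le_top h)
  have hbij := ProperBier.bijOn_position hI hbot htop
  obtain ⟨f⟩ := nonempty_orderIso_properPart (bierOrderIso hbot htop)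
  refine ⟨plHomeomorphic_of_bijOn
    (Fintype.linearCombination ℝ ProperBier.position ∘ₗ LinearMap.funLeft ℝ ℝ f)
    (hbij.comp (bijOn_funLeft f.symm)), fun h => ?_⟩
  obtain ⟨n, hn⟩ := h.exists_plHomeomorphic
  refine isFaceLatticeOfStronglyRegularPLSphere (hn.of_bijOn _ hbij) ?_ (bierOrderIso hbot htop)
  -- The meet of `[x, y]` and `[v, w]` is `[x ⊓ v, y ⊔ w]`.
  rintro a b c hca hcb
  let m : BierInterval I := ⟨a.1.lo ⊓ b.1.lo, a.1.hi ⊔ b.1.hi, hI inf_le_left a.1.lo_mem,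
    fun h => a.1.hi_notMem (hI le_sup_left h), inf_le_left.trans (a.1.lo_le_hi.trans le_sup_left)⟩
  have hm : ∀ d : ProperBier I, d ≤ a → d ≤ b → d.1 ≤ m := fun d hda hdb =>
    ⟨le_inf hda.1 hdb.1, sup_le hda.2 hdb.2⟩
  refine ⟨⟨m, fun hm0 => c.2 ?_⟩, ⟨inf_le_left, le_sup_left⟩, ⟨inf_le_right, le_sup_right⟩, hm⟩
  have := hm c hca hcb
  exact ⟨le_bot_iff.1 (this.1.trans hm0.1.le), top_le_iff.1 (hm0.2.ge.trans this.2)⟩
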